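/- Let $d\ge 1$, let $\|\cdot\|$ be the Euclidean norm on $\mathbb{R}^d$ and $0^0:=1$. For a locally Lipschitz $f:\mathbb{R}^d\to\mathbb{R}$ let $f^{\circ}(x;v)=\limsup_{x'\to x,\,t\downarrow 0}\frac{f(x'+tv)-f(x')}{t}$, let $\partial_C f(x)=\{s:\langle s,v\rangle\le f^{\circ}(x;v)\ \forall v\}$ be the Clarke subdifferential, and for $\delta>0$ let $\partial_G^{\delta}f(x)=\mathrm{conv}\big(\bigcup_{\|y-x\|\le\delta}\partial_C f(y)\big)$ be the Goldstein $\delta$-subdifferential. Write $\mathrm{dist}(x,S)=\inf_{y\in S}\|x-y\|$. Assume that $f$ is subdifferentially polynomially bounded with parameters $R_1\ge 0$, $R_2>0$ and an integer $m\ge 0$, where $R_1=0$ if and only if $m=0$; that is, $f$ is locally Lipschitz and $\sup_{\zeta\in\partial_C f(x)}\|\zeta\|\le R_1\|x\|^m+R_2$ for all $x\in\mathbb{R}^d$. Assume also $\inf f>-\infty$, and let $\delta\in(0,1)$. Define $\mathcal{P}=4R_2+2^{m+1}R_1(m+d)^{m/2}$, $$\kappa_2=\frac{\delta\,\mathcal{P}^{-1/d}}{\sqrt{d\pi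 e}},\qquad \kappa_1=\min\Big\{\big[2^{m+1}R_1(m+d)^{m/2}\big]^{-1/m},\ \frac{\delta\,\mathcal{P}^{-1/d}}{\sqrt{d\pi e}}\Big\}\quad(m\ge1),$$ $$\breve{\mathcal N}(m)=\begin{cases}\max\big\{\min\{5R_2,1\}^{-1/\min\{m,d\}},\kappa_1\big\}^{4\min\{m,d\}+2}+1,& m\ge1,\\ \max\big\{\min\{5R_2,1\}^{-1/d},\kappa_2\big\}^{4d+2}+1,& m=0,\end{cases}$$ $$\breve\sigma(m)=\begin{cases}\kappa_1T^{-1/(4\min\{m,d\}+2)},& m\ge1,\\ \kappa_2T^{-1/(4d+2)},& m=0.\end{cases}$$ Let $T\ge\breve{\mathcal N}(m)$ be a positive integer, $\sigma=\gamma=\breve\sigma(m)$ and $\tau_k=\gamma/\sqrt{T+1}$ for $k=0,\dots,T$. Let $x^0\in\mathbb{R}^d$, let $u^0,u^1,\dots$ be independent standard Gaussian random vectors in $\mathbb{R}^d$, and let $$v^k=\tfrac1\sigma\,[f(x^k+\sigma u^k)-f(x^k)]\,u^k,\qquad x^{k+1}=x^k-\tau_k\,\frac{v^k}{\|x^k\|^{2m}+1}.$$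 Set $\breve{\mathcal H}_{(0)}=1$ and, for integers $p\ge1$, $\breve{\mathcal H}_{(p)}=3^{p-1}\big(R_2^p(2p+d)^p+2^{(m-1)p}R_1^p[(m+2)p+d]^{(m+2)p/2}\big)$; set $\breve{\mathcal M}(x)=(2^{m-1}R_1\|x\|^m+R_2)\sqrt d+2^{m-1}R_1(m+1+d)^{(m+1)/2}$ and $$\begin{aligned}K={}&f(x^0)-\inf f+\breve{\mathcal M}(x^0)+\tfrac12\breve{\mathcal H}_{(2)}\big(2^{2m-2}R_1(m+1+d)^{\frac{m+1}2}+R_2\sqrt d\big)\\&+2^{2m-3}\breve{\mathcal H}_{(2)}R_1\sqrt d+2^{m-1}R_1\breve{\mathcal H}_{(m+2)}(m+2)^{-1}\sqrt d .\end{aligned}$$ Then the following hold, all expectations being finite. (i) If $m\ge1$, the set $\mathcal S=\arg\min f$ is nonempty and bounded, and for some $\mu>0$ one has $f(x)-\inf f\ge\frac\mu2\,\mathrm{dist}(x,\mathcal S)^2$ for all $x\in\mathbb{R}^d$, then $$\min_{0\le k\le T}\mathbb{E}\Big[\mathrm{dist}\big(0,\partial_G^{\delta}f(x^k)\big)^{\frac1{2\lceil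 m/2\rceil}}\Big]\le\frac{\big(1+\sqrt{\widetilde K}\big)\big(2K^{1/2}\kappa_1^{-1/2}+2\big)^{\frac1{2\lceil m/2\rceil}}}{T^{\left(\frac14-\frac1{8\min\{m,d\}+4}\right)\frac1{2\lceil m/2\rceil}}},$$ where $\widetilde K=8\mu^{-1}K+4d+2\sup_{w\in\mathcal S}\|w\|^2$. (ii) If $m=0$, then $$\min_{0\le k\le T}\mathbb{E}\big[\mathrm{dist}\big(0,\partial_G^{\delta}f(x^k)\big)\big]\le\big(2K^{1/2}\kappa_2^{-1/2}+2\big)\,T^{-\left(\frac14-\frac1{8d+4}\right)}.$$ -/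

import Mathlib

open MeasureTheory ProbabilityTheory Filter Topology

noncomputable section

/-- The Clarke directional derivative
`f°(x; v) = limsup_{x' → x, t ↓ 0} (f (x' + t v) - f x') / t`. It is used for locally Lipschitz
`f` only, for which the quotients are bounded near the limit, so that the real-valued `limsup`
is the genuine one. -/
def clarkeDirDeriv {d : ℕ} (f : EuclideanSpace ℝ (Fin d) → ℝ) (x v : EuclideanSpace ℝ (Fin d)) :
    ℝ :=
  limsup (fun p : EuclideanSpace ℝ (Fin d) × ℝ => (f (p.1 + p.2 • v) - f p.1) / p.2)
    (𝓝 x ×ˢ 𝓝[>] (0 : ℝ))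

/-- The Clarke subdifferential `∂_C f(x) = {s | ⟨s, v⟩ ≤ f°(x; v) for all v}`. -/
def clarkeSubdiff {d : ℕ} (f : EuclideanSpace ℝ (Fin d) → ℝ) (x : EuclideanSpace ℝ (Fin d)) :
    Set (EuclideanSpace ℝ (Fin d)) :=
  {s | ∀ v, inner ℝ s v ≤ clarkeDirDeriv f x v}

/-- The Goldstein `δ`-subdifferential: the convex hull of the union of the Clarke subdifferentials
over the closed ball of radius `δ` around `x`. -/
def goldsteinSubdiff {d : ℕ} (f : EuclideanSpace ℝ (Fin d) → ℝ) (δ : ℝ)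
    (x : EuclideanSpace ℝ (Fin d)) : Set (EuclideanSpace ℝ (Fin d)) :=
  convexHull ℝ (⋃ y ∈ Metric.closedBall x δ, clarkeSubdiff f y)

/-- `f` is subdifferentially polynomially bounded with parameters `R₁`, `R₂` and `m`.
In Mathlib `0 ^ 0 = 1`, which is the convention wanted for `x = 0`, `m = 0`. -/
structure IsSPBWith {d : ℕ} (f : EuclideanSpace ℝ (Fin d) → ℝ) (R₁ R₂ : ℝ) (m : ℕ) : Prop where
  locallyLipschitz : LocallyLipschitz f
  R₁_nonneg : 0 ≤ R₁
  R₂_pos : 0 < R₂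
  R₁_eq_zero_iff : R₁ = 0 ↔ m = 0
  norm_le : ∀ x, ∀ ζ ∈ clarkeSubdiff f x, ‖ζ‖ ≤ R₁ * ‖x‖ ^ m + R₂

/-- The random search direction `v = ((f (x + σ u) - f x) / σ) u`. -/
def zoDirection {d : ℕ} (f : EuclideanSpace ℝ (Fin d) → ℝ) (σ : ℝ)
    (x u : EuclideanSpace ℝ (Fin d)) : EuclideanSpace ℝ (Fin d) :=
  ((f (x + σ • u) - f x) / σ) • u

/-- The iterates of the unconstrained zeroth-order algorithm with initial point `x₀`, smoothing
parameter `σ`, step parameters `τ` and sampled directions `u 0, u 1, …`: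
`x^{k+1} = x^k - τ_k v^k / (‖x^k‖^{2m} + 1)`. -/
def zoIterate {d : ℕ} (f : EuclideanSpace ℝ (Fin d) → ℝ) (m : ℕ) (σ : ℝ) (τ : ℕ → ℝ)
    (x₀ : EuclideanSpace ℝ (Fin d)) (u : ℕ → EuclideanSpace ℝ (Fin d)) :
    ℕ → EuclideanSpace ℝ (Fin d)
  | 0 => x₀
  | k + 1 =>
    zoIterate f m σ τ x₀ u k -
      (τ k / (‖zoIterate f m σ τ x₀ u k‖ ^ (2 * m) + 1)) •
        zoDirection f σ (zoIterate f m σ τ x₀ u k) (u k)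

/-- The set `𝒮 = argmin f` of global minimizers of `f`. -/
def argminSet {d : ℕ} (f : EuclideanSpace ℝ (Fin d) → ℝ) : Set (EuclideanSpace ℝ (Fin d)) :=
  {x | ∀ y, f x ≤ f y}

/-- `𝒫 = 4 R₂ + 2^{m+1} R₁ (m + d)^{m/2}`. -/
def constP (R₁ R₂ : ℝ) (m d : ℕ) : ℝ :=
  4 * R₂ + 2 ^ (m + 1) * R₁ * ((m : ℝ) + d) ^ ((m : ℝ) / 2)

/-- `κ₂ = δ 𝒫^{-1/d} / √(d π e)`. -/
def constKappa₂ (R₁ R₂ : ℝ) (m d : ℕ) (δ : ℝ) : ℝ :=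
  δ * constP R₁ R₂ m d ^ (-(1 / (d : ℝ))) / √((d : ℝ) * Real.pi * Real.exp 1)

/-- `κ₁ = min {[2^{m+1} R₁ (m + d)^{m/2}]^{-1/m}, δ 𝒫^{-1/d} / √(d π e)}` (used for `m ≥ 1`). -/
def constKappa₁ (R₁ R₂ : ℝ) (m d : ℕ) (δ : ℝ) : ℝ :=
  min ((2 ^ (m + 1) * R₁ * ((m : ℝ) + d) ^ ((m : ℝ) / 2)) ^ (-(1 / (m : ℝ))))
    (δ * constP R₁ R₂ m d ^ (-(1 / (d : ℝ))) / √((d : ℝ) * Real.pi * Real.exp 1))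

/-- The lower bound `N̆(m)` on the number of iterations. -/
def breveN (R₁ R₂ : ℝ) (m d : ℕ) (δ : ℝ) : ℝ :=
  if 1 ≤ m then
    max ((min (5 * R₂) 1) ^ (-(1 / ((min m d : ℕ) : ℝ)))) (constKappa₁ R₁ R₂ m d δ)
      ^ (4 * min m d + 2) + 1
  else
    max ((min (5 * R₂) 1) ^ (-(1 / (d : ℝ)))) (constKappa₂ R₁ R₂ m d δ) ^ (4 * d + 2) + 1

/-- The smoothing parameter `σ̆(m)`, a power of `T` times a constant. -/
def breveSigma (R₁ R₂ : ℝ) (m d : ℕ) (δ : ℝ) (T : ℕ) : ℝ :=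
  if 1 ≤ m then
    constKappa₁ R₁ R₂ m d δ * (T : ℝ) ^ (-(1 / (4 * ((min m d : ℕ) : ℝ) + 2)))
  else
    constKappa₂ R₁ R₂ m d δ * (T : ℝ) ^ (-(1 / (4 * (d : ℝ) + 2)))

/-- The constant `ℋ̆_(p)`. -/
def breveH (R₁ R₂ : ℝ) (m d p : ℕ) : ℝ :=
  if 1 ≤ p then
    3 ^ (p - 1) * (R₂ ^ p * (2 * (p : ℝ) + d) ^ p +
      (2 : ℝ) ^ (((m : ℤ) - 1) * p) * R₁ ^ p *
        (((m : ℝ) + 2) * p + d) ^ (((m : ℝ) + 2) * p / 2))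
  else 1

/-- The function `ℳ̆(x)`. -/
def breveM (R₁ R₂ : ℝ) (m d : ℕ) (x : EuclideanSpace ℝ (Fin d)) : ℝ :=
  ((2 : ℝ) ^ ((m : ℤ) - 1) * R₁ * ‖x‖ ^ m + R₂) * √(d : ℝ) +
    (2 : ℝ) ^ ((m : ℤ) - 1) * R₁ * ((m : ℝ) + 1 + d) ^ (((m : ℝ) + 1) / 2)

/-- The constant `K`, which depends on `f`, its parameters, `d` and the initial point `x₀`. -/
def constK {d : ℕ} (f : EuclideanSpace ℝ (Fin d) → ℝ) (R₁ R₂ : ℝ) (m : ℕ)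
    (x₀ : EuclideanSpace ℝ (Fin d)) : ℝ :=
  f x₀ - (⨅ y, f y) + breveM R₁ R₂ m d x₀ +
    (1 / 2) * breveH R₁ R₂ m d 2 *
      ((2 : ℝ) ^ (2 * (m : ℤ) - 2) * R₁ * ((m : ℝ) + 1 + d) ^ (((m : ℝ) + 1) / 2) + R₂ * √(d : ℝ)) +
    (2 : ℝ) ^ (2 * (m : ℤ) - 3) * breveH R₁ R₂ m d 2 * R₁ * √(d : ℝ) +
    (2 : ℝ) ^ ((m : ℤ) - 1) * R₁ * breveH R₁ R₂ m d (m + 2) * ((m : ℝ) + 2)⁻¹ * √(d : ℝ)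

/-- `K̃ = 8 K / μ + 4 d + 2 sup_{w ∈ 𝒮} ‖w‖²`. -/
def constKTilde {d : ℕ} (f : EuclideanSpace ℝ (Fin d) → ℝ) (R₁ R₂ : ℝ) (m : ℕ)
    (x₀ : EuclideanSpace ℝ (Fin d)) (μ : ℝ) : ℝ :=
  8 * μ⁻¹ * constK f R₁ R₂ m x₀ + 4 * (d : ℝ) + 2 * sSup ((fun w => ‖w‖ ^ 2) '' argminSet f)

end

/-!
The convergence rate is a descent argument for the Gaussian smoothing `F(x) = E[f(x + σ u)]`, whose
gradient `g(x)` is the mean of the random search direction `v`.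

*Descent.* By the Cameron–Martin formula, `F` is differentiable with gradient `g`, for merely
continuous `f` of polynomial growth (`IsSPBWith.hasDerivAt_gaussianSmoothing_zero`). The Clarke mean
value inequality turns the bound on the subdifferential into a bound on the local Lipschitz constants
of `f`, hence into a local Lipschitz bound for `g`, and so into a descent inequality with a remainder
polynomial in the step (`IsSPBWith.gaussianSmoothing_add_le`). The moments of `v` grow in `x` as does
the normalization `‖x‖ ^ (2 * m) + 1` of the step, so the error of one step is at most
`τ² / σ` times a constant (`IsSPBWith.lintegral_gaussianSmoothing_step`). The iterate `x k` is
independent of the direction `u k`, so this integrates along the iterates and telescopes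
(`IsSPBWith.lintegral_add_sum_le`): every `E[F(x k)] - inf f` is at most `K`, and for some `k` the
mean of `‖g(x k)‖² / (‖x k‖ ^ (2 * m) + 1)` is at most `K / (σ √(T + 1))`
(`IsSPBWith.expectation_bounds`). Extended nonnegative integrals are used until all expectations are
known to be finite.

*Stationarity.* By Rademacher's theorem `f` is differentiable almost everywhere, and `g(x)` is the
Gaussian average of `∇f(x + σ u)` (`IsSPBWith.smoothedGradient_eq_integral_gradient`). Restricted to
`‖σ u‖ ≤ δ` and renormalized, the average lies in the closure of the Goldstein subdifferential at
`x`, since gradients belong to the Clarke subdifferential; the remaining tail is controlled by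
Gaussian moments. For the given parameters this bounds the distance of `0` from the Goldstein
subdifferential by `5/4 ‖g(x)‖` plus `5/16 (2 + ‖x‖ ^ m)` times the rate
(`IsSPBWith.infDist_goldsteinSubdiff_le`).

*Rates.* For `m = 0` the two parts combine by the Cauchy–Schwarz inequality. For `m ≥ 1` the
distance is at most the product of `√(‖x k‖ ^ (2 * m) + 1)` and a random variable that is small in
mean square. Quadratic growth bounds `E‖x k‖²` by the smoothed optimality gap
(`IsSPBWith.norm_sq_le_of_quadratic_growth`), and the exponent `1 / (2⌈m/2⌉) ≤ 1 / m` is small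
enough for a Hölder-type inequality (`integrable_rpow_mul_rpow_and_integral_le`) to need no more
than these second moments.
-/

variable {d : ℕ}

local notation "𝔼" => EuclideanSpace ℝ (Fin d)

/-! ### Clarke calculus of locally Lipschitz functions -/

lemma tendsto_add_smul_clarke (x v : 𝔼) :
    Tendsto (fun p : 𝔼 × ℝ => p.1 + p.2 • v) (𝓝 x ×ˢ 𝓝[>] (0 : ℝ)) (𝓝 x) := by
  have : Tendsto (fun p : 𝔼 × ℝ => p.1 + p.2 • v) (𝓝 x ×ˢ 𝓝 (0 : ℝ)) (𝓝 (x + (0 : ℝ) • v)) :=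
    tendsto_fst.add (tendsto_snd.smul_const v)
  rw [zero_smul, add_zero] at this
  exact this.mono_left (prod_mono le_rfl nhdsWithin_le_nhds)

lemma LipschitzOnWith.eventually_abs_quotient_le {f : 𝔼 → ℝ} {K : NNReal} {t : Set 𝔼}
    (hK : LipschitzOnWith K f t) {x : 𝔼} (ht : t ∈ 𝓝 x) (v : 𝔼) :
    ∀ᶠ p : 𝔼 × ℝ in 𝓝 x ×ˢ 𝓝[>] (0 : ℝ),
      |(f (p.1 + p.2 • v) - f p.1) / p.2| ≤ K * ‖v‖ := by
  have h1 : ∀ᶠ p : 𝔼 × ℝ in 𝓝 x ×ˢ 𝓝[>] (0 : ℝ), p.1 ∈ t :=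
    tendsto_fst.eventually ht
  have h2 : ∀ᶠ p : 𝔼 × ℝ in 𝓝 x ×ˢ 𝓝[>] (0 : ℝ), 0 < p.2 :=
    tendsto_snd.eventually self_mem_nhdsWithin
  filter_upwards [h1, h2, (tendsto_add_smul_clarke x v).eventually ht] with p hp1 hp2 hp3
  have := hK.dist_le_mul _ hp3 _ hp1
  rw [Real.dist_eq, dist_eq_norm, add_sub_cancel_left, norm_smul, Real.norm_eq_abs,
    abs_of_pos hp2] at this
  rw [abs_div, abs_of_pos hp2, div_le_iff₀ hp2]
  linarith

lemma eventually_abs_quotient_le {f : 𝔼 → ℝ} (hf : LocallyLipschitz f) (x : 𝔼) :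
    ∃ K : ℝ, 0 ≤ K ∧ ∀ v : 𝔼, ∀ᶠ p : 𝔼 × ℝ in 𝓝 x ×ˢ 𝓝[>] (0 : ℝ),
      |(f (p.1 + p.2 • v) - f p.1) / p.2| ≤ K * ‖v‖ := by
  obtain ⟨K, t, ht, hK⟩ := hf x
  exact ⟨K, K.2, fun v => hK.eventually_abs_quotient_le ht v⟩

lemma eventually_quotient_lt_of_clarkeDirDeriv_lt {f : 𝔼 → ℝ} (hf : LocallyLipschitz f) {x v : 𝔼}
    {c : ℝ} (h : clarkeDirDeriv f x v < c) :
    ∀ᶠ p : 𝔼 × ℝ in 𝓝 x ×ˢ 𝓝[>] (0 : ℝ), (f (p.1 + p.2 • v) - f p.1) / p.2 < c := by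
  obtain ⟨K, -, hK⟩ := eventually_abs_quotient_le hf x
  refine eventually_lt_of_limsup_lt h ?_
  exact ⟨K * ‖v‖, by
    rw [eventually_map]; filter_upwards [hK v] with p hp using (abs_le.1 hp).2⟩

lemma clarkeDirDeriv_le_of_eventually {f : 𝔼 → ℝ} (hf : LocallyLipschitz f) {x v : 𝔼}
    {c : ℝ} (h : ∀ᶠ p : 𝔼 × ℝ in 𝓝 x ×ˢ 𝓝[>] (0 : ℝ), (f (p.1 + p.2 • v) - f p.1) / p.2 ≤ c) :
    clarkeDirDeriv f x v ≤ c := by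
  obtain ⟨K, -, hK⟩ := eventually_abs_quotient_le hf x
  refine limsup_le_of_le ?_ h
  refine IsBoundedUnder.isCoboundedUnder_le ⟨-(K * ‖v‖), ?_⟩
  rw [eventually_map]; filter_upwards [hK v] with p hp using (abs_le.1 hp).1

lemma le_clarkeDirDeriv_of_frequently {f : 𝔼 → ℝ} (hf : LocallyLipschitz f) {x v : 𝔼}
    {c : ℝ} (h : ∃ᶠ p : 𝔼 × ℝ in 𝓝 x ×ˢ 𝓝[>] (0 : ℝ), c ≤ (f (p.1 + p.2 • v) - f p.1) / p.2) :
    c ≤ clarkeDirDeriv f x v := by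
  by_contra! hlt
  obtain ⟨p, hp1, hp2⟩ :=
    (h.and_eventually (eventually_quotient_lt_of_clarkeDirDeriv_lt hf hlt)).exists
  linarith

lemma clarkeDirDeriv_add_le {f : 𝔼 → ℝ} (hf : LocallyLipschitz f) (x v w : 𝔼) :
    clarkeDirDeriv f x (v + w) ≤ clarkeDirDeriv f x v + clarkeDirDeriv f x w := by
  refine le_of_forall_pos_le_add fun ε hε => ?_
  refine clarkeDirDeriv_le_of_eventually hf ?_
  have h1 := eventually_quotient_lt_of_clarkeDirDeriv_lt hf
    (show clarkeDirDeriv f x v < clarkeDirDeriv f x v + ε / 2 by linarith)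
  have h2 := eventually_quotient_lt_of_clarkeDirDeriv_lt hf
    (show clarkeDirDeriv f x w < clarkeDirDeriv f x w + ε / 2 by linarith)
  have h3 : Tendsto (fun p : 𝔼 × ℝ => (p.1 + p.2 • v, p.2)) (𝓝 x ×ˢ 𝓝[>] (0 : ℝ))
      (𝓝 x ×ˢ 𝓝[>] (0 : ℝ)) :=
      (tendsto_add_smul_clarke x v).prodMk tendsto_snd
  filter_upwards [h1, h3.eventually h2] with p hp1 hp2
  have : (f (p.1 + p.2 • (v + w)) - f p.1) / p.2 =
      (f (p.1 + p.2 • v + p.2 • w) - f (p.1 + p.2 • v)) / p.2 +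
        (f (p.1 + p.2 • v) - f p.1) / p.2 := by
    rw [smul_add, ← add_assoc]; ring
  rw [this]
  linarith

lemma clarkeDirDeriv_smul_le {f : 𝔼 → ℝ} (hf : LocallyLipschitz f) (x v : 𝔼) {c : ℝ} (hc : 0 < c) :
    clarkeDirDeriv f x (c • v) ≤ c * clarkeDirDeriv f x v := by
  refine le_of_forall_pos_le_add fun ε hε => ?_
  refine clarkeDirDeriv_le_of_eventually hf ?_
  have h1 := eventually_quotient_lt_of_clarkeDirDeriv_lt hf
    (show clarkeDirDeriv f x v < clarkeDirDeriv f x v + ε / c by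
      have := div_pos hε hc; linarith)
  have h3 : Tendsto (fun p : 𝔼 × ℝ => (p.1, p.2 * c)) (𝓝 x ×ˢ 𝓝[>] (0 : ℝ))
      (𝓝 x ×ˢ 𝓝[>] (0 : ℝ)) := by
    refine Tendsto.prodMk tendsto_fst ?_
    refine tendsto_nhdsWithin_iff.2 ⟨?_, ?_⟩
    · have : Tendsto (fun p : 𝔼 × ℝ => p.2 * c) (𝓝 x ×ˢ 𝓝 (0 : ℝ)) (𝓝 (0 * c)) :=
        tendsto_snd.mul_const c
      rw [zero_mul] at this
      exact this.mono_left (prod_mono le_rfl nhdsWithin_le_nhds)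
    · have h2 : ∀ᶠ p : 𝔼 × ℝ in 𝓝 x ×ˢ 𝓝[>] (0 : ℝ), 0 < p.2 :=
        tendsto_snd.eventually self_mem_nhdsWithin
      filter_upwards [h2] with p hp using mul_pos hp hc
  filter_upwards [h3.eventually h1] with p hp
  have : (f (p.1 + p.2 • c • v) - f p.1) / p.2 =
      c * ((f (p.1 + (p.2 * c) • v) - f p.1) / (p.2 * c)) := by
    rw [smul_smul]; field_simp
  rw [this]
  calc _ ≤ c * (clarkeDirDeriv f x v + ε / c) := by gcongr
    _ = _ := by field_simp

lemma clarkeDirDeriv_smul {f : 𝔼 → ℝ} (hf : LocallyLipschitz f) (x v : 𝔼) {c : ℝ} (hc : 0 < c) :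
    clarkeDirDeriv f x (c • v) = c * clarkeDirDeriv f x v := by
  refine le_antisymm (clarkeDirDeriv_smul_le hf x v hc) ?_
  have := clarkeDirDeriv_smul_le hf x (c • v) (inv_pos.2 hc)
  rw [smul_smul, inv_mul_cancel₀ hc.ne', one_smul, inv_mul_eq_div, le_div_iff₀ hc] at this
  linarith

lemma clarkeDirDeriv_zero {f : 𝔼 → ℝ} (hf : LocallyLipschitz f) (x : 𝔼) :
    clarkeDirDeriv f x 0 = 0 := by
  have := clarkeDirDeriv_smul hf x 0 (c := 2) (by norm_num)
  rw [smul_zero] at this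
  linarith

/-- By Hahn–Banach, the Clarke directional derivative is the support function of the Clarke
subdifferential, and the supremum is attained. -/
lemma exists_mem_clarkeSubdiff_inner_eq {f : 𝔼 → ℝ} (hf : LocallyLipschitz f) (x v : 𝔼) :
    ∃ ζ ∈ clarkeSubdiff f x, inner ℝ ζ v = clarkeDirDeriv f x v := by
  obtain ⟨p, hp, hpv⟩ : ∃ p : 𝔼 →ₗ.[ℝ] ℝ, (∀ y : p.domain, p y ≤ clarkeDirDeriv f x y) ∧
      ∃ h : v ∈ p.domain, p ⟨v, h⟩ = clarkeDirDeriv f x v := by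
    by_cases hv : v = 0
    · refine ⟨⟨⊥, 0⟩, ?_, ?_⟩
      · rintro ⟨y, hy⟩
        rw [Submodule.mem_bot] at hy
        subst hy
        exact (clarkeDirDeriv_zero hf x).ge
      · subst hv
        exact ⟨Submodule.zero_mem _, (clarkeDirDeriv_zero hf x).symm⟩
    · refine ⟨LinearPMap.mkSpanSingleton v (clarkeDirDeriv f x v) hv, ?_,
        Submodule.mem_span_singleton_self v, LinearPMap.mkSpanSingleton_apply ℝ ℝ hv _⟩
      rintro ⟨y, hy⟩
      obtain ⟨c, rfl⟩ := Submodule.mem_span_singleton.1 hy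
      have h1 : LinearPMap.mkSpanSingleton v (clarkeDirDeriv f x v) hv ⟨c • v, hy⟩ =
          c • clarkeDirDeriv f x v := LinearPMap.mkSpanSingleton'_apply _ _ _ _ _
      rw [h1, smul_eq_mul]
      rcases lt_trichotomy c 0 with hc | hc | hc
      · have h1 := clarkeDirDeriv_smul hf x v (neg_pos.2 hc)
        have h2 := clarkeDirDeriv_add_le hf x (c • v) (-c • v)
        rw [← add_smul, add_neg_cancel, zero_smul, clarkeDirDeriv_zero hf, h1] at h2
        show c * clarkeDirDeriv f x v ≤ clarkeDirDeriv f x (c • v)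
        linarith
      · subst hc
        simp [clarkeDirDeriv_zero hf]
      · exact (clarkeDirDeriv_smul hf x v hc).ge
  obtain ⟨hv, hpv⟩ := hpv
  obtain ⟨g, hg0, hg⟩ := exists_extension_of_le_sublinear p (clarkeDirDeriv f x)
    (fun c hc y => clarkeDirDeriv_smul hf x y hc) (clarkeDirDeriv_add_le hf x) hp
  refine ⟨(InnerProductSpace.toDual ℝ 𝔼).symm (LinearMap.toContinuousLinearMap g),
    fun w => ?_, ?_⟩
  · rw [InnerProductSpace.toDual_symm_apply]
    exact hg w
  · rw [InnerProductSpace.toDual_symm_apply, ← hpv]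
    exact hg0 ⟨v, hv⟩

lemma clarkeSubdiff_nonempty {f : 𝔼 → ℝ} (hf : LocallyLipschitz f) (x : 𝔼) :
    (clarkeSubdiff f x).Nonempty :=
  let ⟨ζ, hζ, _⟩ := exists_mem_clarkeSubdiff_inner_eq hf x 0
  ⟨ζ, hζ⟩

/-- One-sided mean value inequality along a segment, obtained by comparing the upper right
derivative with the Clarke directional derivative. -/
lemma sub_le_of_clarkeDirDeriv_le {f : 𝔼 → ℝ} (hf : LocallyLipschitz f) {x v : 𝔼} {L : ℝ}
    (h : ∀ t ∈ Set.Icc (0 : ℝ) 1, clarkeDirDeriv f (x + t • v) v ≤ L) : f (x + v) - f x ≤ L := by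
  refine le_of_forall_pos_le_add fun ε hε => ?_
  have key := image_le_of_liminf_slope_right_lt_deriv_boundary'
    (f := fun t : ℝ => f (x + t • v)) (f' := fun t => clarkeDirDeriv f (x + t • v) v)
    (a := 0) (b := 1) (B := fun t => f x + (L + ε) * t) (B' := fun _ => L + ε)
    (by have := hf.continuous; fun_prop)
    (by
      intro t ht r hr
      have h1 := eventually_quotient_lt_of_clarkeDirDeriv_lt hf hr
      have h2 : Tendsto (fun z : ℝ => (x + t • v, z - t)) (𝓝[>] t)
          (𝓝 (x + t • v) ×ˢ 𝓝[>] (0 : ℝ)) := by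
        refine tendsto_const_nhds.prodMk (tendsto_nhdsWithin_iff.2 ⟨?_, ?_⟩)
        · have : Tendsto (fun z : ℝ => z - t) (𝓝 t) (𝓝 (t - t)) :=
            (continuous_id.sub continuous_const).tendsto t
          rw [sub_self] at this
          exact this.mono_left nhdsWithin_le_nhds
        · filter_upwards [self_mem_nhdsWithin] with z hz using sub_pos.2 (Set.mem_Ioi.1 hz)
      refine Eventually.frequently ?_
      filter_upwards [h2.eventually h1] with z hz
      rw [slope_def_field]
      convert hz using 4
      rw [add_assoc, ← add_smul]; congr 3; ring)
    (by simp) (by fun_prop)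
    (by
      intro t _
      have : HasDerivAt (fun t : ℝ => f x + (L + ε) * t) (L + ε) t := by
        simpa using ((hasDerivAt_id t).const_mul (L + ε)).const_add (f x)
      exact this.hasDerivWithinAt)
    (by
      intro t ht _
      have := h t ⟨ht.1, ht.2.le⟩
      linarith)
  have := key (Set.right_mem_Icc.2 zero_le_one)
  simp only [one_smul, mul_one] at this
  linarith

/-- The gradient of a locally Lipschitz function belongs to the Clarke subdifferential. -/
lemma gradient_mem_clarkeSubdiff {f : 𝔼 → ℝ} (hf : LocallyLipschitz f) {x : 𝔼}
    (hx : DifferentiableAt ℝ f x) : gradient f x ∈ clarkeSubdiff f x := by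
  intro v
  have h1 : inner ℝ (gradient f x) v = fderiv ℝ f x v := by
    rw [gradient, InnerProductSpace.toDual_symm_apply]
  rw [h1]
  have h2 : HasDerivAt (fun t : ℝ => f (x + t • v)) (fderiv ℝ f x v) 0 :=
    hx.hasFDerivAt.hasLineDerivAt v
  have h3 := h2.tendsto_slope_zero_right
  refine le_of_forall_lt_imp_le_of_dense fun c hc => ?_
  refine le_clarkeDirDeriv_of_frequently hf ?_
  have h4 := h3.eventually (lt_mem_nhds hc)
  have h5 : Tendsto (fun z : ℝ => (x, z)) (𝓝[>] 0) (𝓝 x ×ˢ 𝓝[>] (0 : ℝ)) :=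
    tendsto_const_nhds.prodMk tendsto_id
  refine h5.frequently (Eventually.frequently ?_)
  filter_upwards [h4] with t ht
  simp only [zero_add, zero_smul, add_zero, smul_eq_mul] at ht
  rw [div_eq_inv_mul]
  exact ht.le

/-! ### Growth and differentiability under a polynomial bound -/

namespace IsSPBWith

variable {f : EuclideanSpace ℝ (Fin d) → ℝ} {R₁ R₂ : ℝ} {m : ℕ}

lemma clarkeDirDeriv_le (hf : IsSPBWith f R₁ R₂ m) (x v : 𝔼) :
    clarkeDirDeriv f x v ≤ (R₁ * ‖x‖ ^ m + R₂) * ‖v‖ := by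
  obtain ⟨ζ, hζ, h⟩ := exists_mem_clarkeSubdiff_inner_eq hf.locallyLipschitz x v
  rw [← h]
  exact (real_inner_le_norm _ _).trans
    (mul_le_mul_of_nonneg_right (hf.norm_le x ζ hζ) (norm_nonneg _))

lemma sub_le (hf : IsSPBWith f R₁ R₂ m) {x v : 𝔼} {r : ℝ}
    (h : ∀ t ∈ Set.Icc (0 : ℝ) 1, ‖x + t • v‖ ≤ r) :
    f (x + v) - f x ≤ (R₁ * r ^ m + R₂) * ‖v‖ := by
  refine sub_le_of_clarkeDirDeriv_le hf.locallyLipschitz fun t ht => ?_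
  refine (hf.clarkeDirDeriv_le _ _).trans ?_
  have := hf.R₁_nonneg
  gcongr
  exact h t ht

/-- Mean value inequality: the polynomial bound on the subdifferential bounds the local Lipschitz
constants of `f`. -/
lemma abs_sub_le (hf : IsSPBWith f R₁ R₂ m) {x y : 𝔼} {r : ℝ} (hx : ‖x‖ ≤ r) (hy : ‖y‖ ≤ r) :
    |f y - f x| ≤ (R₁ * r ^ m + R₂) * ‖y - x‖ := by
  have seg : ∀ a b : 𝔼, ‖a‖ ≤ r → ‖b‖ ≤ r → ∀ t ∈ Set.Icc (0 : ℝ) 1,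
      ‖a + t • (b - a)‖ ≤ r := by
    intro a b ha hb t ht
    have : a + t • (b - a) = (1 - t) • a + t • b := by module
    rw [this]
    refine (norm_add_le _ _).trans ?_
    rw [norm_smul, norm_smul, Real.norm_of_nonneg ht.1, Real.norm_of_nonneg (sub_nonneg.2 ht.2)]
    nlinarith [ht.1, ht.2]
  rw [abs_le]
  constructor
  · have := hf.sub_le (seg y x hy hx)
    rw [add_sub_cancel, norm_sub_rev] at this
    linarith
  · have := hf.sub_le (seg x y hx hy)
    rwa [add_sub_cancel] at this

/-- Rademacher's theorem, applied on balls. -/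
lemma ae_differentiableAt (hf : IsSPBWith f R₁ R₂ m) :
    ∀ᵐ x : 𝔼, DifferentiableAt ℝ f x := by
  have h : ∀ n : ℕ, ∀ᵐ x : 𝔼, x ∈ Metric.ball (0 : 𝔼) n → DifferentiableAt ℝ f x := by
    intro n
    have hL : LipschitzOnWith (Real.toNNReal (R₁ * (n : ℝ) ^ m + R₂)) f (Metric.ball (0 : 𝔼) n) := by
      refine LipschitzOnWith.of_dist_le_mul fun x hx y hy => ?_
      rw [Real.coe_toNNReal _ (by have := hf.R₁_nonneg; have := hf.R₂_pos; positivity),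
        Real.dist_eq, dist_eq_norm]
      exact hf.abs_sub_le (mem_ball_zero_iff.1 hy).le (mem_ball_zero_iff.1 hx).le
    filter_upwards [hL.ae_differentiableWithinAt_of_mem (μ := volume)] with x hx hmem
    exact (hx hmem).differentiableAt (Metric.isOpen_ball.mem_nhds hmem)
  filter_upwards [ae_all_iff.2 h] with x hx
  obtain ⟨n, hn⟩ := exists_nat_gt ‖x‖
  exact hx n (mem_ball_zero_iff.2 hn)

end IsSPBWith

/-! ### Semicontinuity of the distance to the Goldstein subdifferential -/

/-- Local boundedness and closed graph of the Clarke subdifferential give outer semicontinuity. -/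
lemma eventually_clarkeSubdiff_subset_thickening {f : 𝔼 → ℝ} (hf : LocallyLipschitz f) (x : 𝔼)
    {ε : ℝ} (hε : 0 < ε) :
    ∀ᶠ y in 𝓝 x, clarkeSubdiff f y ⊆ Metric.thickening ε (clarkeSubdiff f x) := by
  by_contra hcon
  obtain ⟨y, hy, hfy⟩ := exists_seq_forall_of_frequently (not_eventually.1 hcon)
  simp only [Set.not_subset] at hfy
  choose ζ hζ hζ' using hfy
  have usc : ∀ (v : 𝔼) (c : ℝ), clarkeDirDeriv f x v < c →
      ∀ᶠ z in 𝓝 x, clarkeDirDeriv f z v ≤ c := by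
    intro v c hc
    have h1 := eventually_quotient_lt_of_clarkeDirDeriv_lt hf hc
    rw [eventually_prod_iff] at h1
    obtain ⟨pa, ha, pb, hb, hab⟩ := h1
    filter_upwards [eventually_eventually_nhds.2 ha] with z hz
    refine clarkeDirDeriv_le_of_eventually hf ?_
    rw [eventually_prod_iff]
    exact ⟨pa, hz, pb, hb, fun hx y hy => (hab hx hy).le⟩
  obtain ⟨K, hK0, hK⟩ : ∃ K : ℝ, 0 ≤ K ∧ ∀ᶠ z in 𝓝 x, ∀ s ∈ clarkeSubdiff f z, ‖s‖ ≤ K := by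
    obtain ⟨K, t, ht, hK⟩ := hf x
    refine ⟨K, K.2, ?_⟩
    filter_upwards [eventually_eventually_nhds.2 ht] with z hz s hs
    have h1 : clarkeDirDeriv f z s ≤ K * ‖s‖ := clarkeDirDeriv_le_of_eventually hf
      ((hK.eventually_abs_quotient_le hz s).mono fun p hp => (abs_le.1 hp).2)
    have h2 := (hs s).trans h1
    rw [real_inner_self_eq_norm_sq] at h2
    by_contra! hlt
    nlinarith [K.2]
  have hb : ∀ᶠ n in atTop, ζ n ∈ Metric.closedBall (0 : 𝔼) K := by
    filter_upwards [hy.eventually hK] with n hn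
    exact mem_closedBall_zero_iff.2 (hn _ (hζ n))
  obtain ⟨s, -, φ, hφ, hlim⟩ :=
    (isCompact_closedBall (0 : 𝔼) K).isSeqCompact.subseq_of_frequently_in hb.frequently
  have hs : s ∈ clarkeSubdiff f x := by
    intro v
    refine le_of_forall_pos_le_add fun η hη => ?_
    have h1 := (hy.comp hφ.tendsto_atTop).eventually
      (usc v (clarkeDirDeriv f x v + η) (by linarith))
    refine le_of_tendsto (hlim.inner tendsto_const_nhds) ?_
    filter_upwards [h1] with n hn
    exact (hζ (φ n) v).trans hn
  obtain ⟨n, hn⟩ := ((Metric.tendsto_nhds.1 hlim) ε hε).exists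
  exact hζ' (φ n) (Metric.mem_thickening_iff.2 ⟨s, hs, hn⟩)

lemma clarkeSubdiff_subset_goldsteinSubdiff (f : 𝔼 → ℝ) {δ : ℝ} {x y : 𝔼}
    (hy : y ∈ Metric.closedBall x δ) : clarkeSubdiff f y ⊆ goldsteinSubdiff f δ x :=
  (Set.subset_biUnion_of_mem (u := fun y => clarkeSubdiff f y) hy).trans (subset_convexHull ℝ _)

lemma goldsteinSubdiff_nonempty {f : 𝔼 → ℝ} (hf : LocallyLipschitz f) {δ : ℝ} (hδ : 0 ≤ δ)
    (x : 𝔼) : (goldsteinSubdiff f δ x).Nonempty :=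
  (clarkeSubdiff_nonempty hf x).mono
    (clarkeSubdiff_subset_goldsteinSubdiff f (Metric.mem_closedBall_self hδ))

lemma eventually_goldsteinSubdiff_subset_thickening {f : 𝔼 → ℝ} (hf : LocallyLipschitz f)
    {δ : ℝ} (x : 𝔼) {ε : ℝ} (hε : 0 < ε) :
    ∀ᶠ y in 𝓝 x, goldsteinSubdiff f δ y ⊆ Metric.thickening ε (goldsteinSubdiff f δ x) := by
  set U : Set 𝔼 := interior {z | clarkeSubdiff f z ⊆ Metric.thickening ε (goldsteinSubdiff f δ x)}
  have hU : Metric.closedBall x δ ⊆ U := by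
    intro y hy
    refine mem_interior_iff_mem_nhds.2 ?_
    filter_upwards [eventually_clarkeSubdiff_subset_thickening hf y hε] with z hz
    exact hz.trans (Metric.thickening_subset_of_subset _
      (clarkeSubdiff_subset_goldsteinSubdiff f hy))
  obtain ⟨η, hη, hη'⟩ :=
    (isCompact_closedBall x δ).exists_thickening_subset_open isOpen_interior hU
  filter_upwards [Metric.ball_mem_nhds x hη] with y hy
  refine convexHull_min ?_ ((convex_convexHull ℝ _).thickening ε)
  refine Set.iUnion₂_subset fun z hz => ?_
  have : z ∈ U := by
    refine hη' (Metric.mem_thickening_iff.2 ⟨z + (x - y), ?_, ?_⟩)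
    · rw [Metric.mem_closedBall, dist_eq_norm] at hz ⊢
      convert hz using 2; abel
    · rw [Metric.mem_ball, dist_eq_norm] at hy
      rw [dist_eq_norm]
      convert hy using 2; abel
  exact interior_subset this

/-- Lower semicontinuity makes the distance a measurable function of the point, so that its
expectation at a random point is a genuine one. -/
lemma lowerSemicontinuous_infDist_goldsteinSubdiff {f : 𝔼 → ℝ} (hf : LocallyLipschitz f)
    {δ : ℝ} (hδ : 0 ≤ δ) :
    LowerSemicontinuous fun x => Metric.infDist 0 (goldsteinSubdiff f δ x) := by
  intro x c hc
  have hε : 0 < (Metric.infDist 0 (goldsteinSubdiff f δ x) - c) / 2 := by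
    linarith
  filter_upwards [eventually_goldsteinSubdiff_subset_thickening hf x hε] with y hy
  have h2 : Metric.infDist 0 (goldsteinSubdiff f δ x) -
      (Metric.infDist 0 (goldsteinSubdiff f δ x) - c) / 2 ≤
      Metric.infDist 0 (goldsteinSubdiff f δ y) := by
    refine (Metric.le_infDist (goldsteinSubdiff_nonempty hf hδ y)).2 fun s hs => ?_
    obtain ⟨w, hw, hw'⟩ := Metric.mem_thickening_iff.1 (hy hs)
    have h3 := Metric.infDist_le_dist_of_mem (x := (0 : 𝔼)) hw
    have h4 := dist_triangle (0 : 𝔼) s w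
    linarith
  linarith

/-! ### The standard Gaussian measure: density, translations, moments -/

/-- The density of the standard Gaussian measure on `ℝᵈ` with respect to Lebesgue measure. -/
noncomputable def stdGaussianDensity (u : EuclideanSpace ℝ (Fin d)) : ℝ :=
  (2 * Real.pi) ^ (-((d : ℝ) / 2)) * Real.exp (-(1 / 2) * ‖u‖ ^ 2)

lemma stdGaussianDensity_pos (u : 𝔼) : 0 < stdGaussianDensity u := by
  unfold stdGaussianDensity
  positivity

lemma measurable_stdGaussianDensity : Measurable (stdGaussianDensity : 𝔼 → ℝ) := by
  unfold stdGaussianDensity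
  fun_prop

lemma integral_cexp_mul_stdGaussianDensity (t : 𝔼) :
    ∫ u : 𝔼, (stdGaussianDensity u : ℂ) * Complex.exp ((inner ℝ u t : ℝ) * Complex.I) =
      Complex.exp (-‖t‖ ^ 2 / 2) := by
  have h := GaussianFourier.integral_cexp_neg_mul_sq_norm_add (V := 𝔼) (b := 1 / 2)
    (by norm_num) Complex.I t
  have h2 : ∀ u : 𝔼, (stdGaussianDensity u : ℂ) * Complex.exp ((inner ℝ u t : ℝ) * Complex.I) =
      (((2 * Real.pi) ^ (-((d : ℝ) / 2)) : ℝ) : ℂ) *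
        Complex.exp (-(1 / 2) * ‖u‖ ^ 2 + Complex.I * (inner ℝ t u : ℝ)) := by
    intro u
    unfold stdGaussianDensity
    rw [Complex.ofReal_mul, mul_assoc, Complex.ofReal_exp, ← Complex.exp_add, real_inner_comm]
    congr 2
    push_cast
    ring
  simp_rw [h2]
  rw [integral_const_mul, h, ← mul_assoc]
  have h3 : (((2 * Real.pi) ^ (-((d : ℝ) / 2)) : ℝ) : ℂ) *
      (Real.pi / (1 / 2) : ℂ) ^ (Module.finrank ℝ 𝔼 / 2 : ℂ) = 1 := by
    have : (Real.pi / (1 / 2) : ℂ) = ((2 * Real.pi : ℝ) : ℂ) := by push_cast; ring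
    rw [this, finrank_euclideanSpace_fin]
    have h4 : ((d : ℂ) / 2) = (((d : ℝ) / 2 : ℝ) : ℂ) := by push_cast; ring
    rw [h4, ← Complex.ofReal_cpow (by positivity), ← Complex.ofReal_mul,
      ← Real.rpow_add (by positivity)]
    simp
  rw [h3, one_mul]
  congr 1
  rw [Complex.I_sq]
  ring

lemma integrable_stdGaussianDensity : Integrable (stdGaussianDensity : 𝔼 → ℝ) := by
  have h := GaussianFourier.integrable_cexp_neg_mul_sq_norm_add (V := 𝔼) (b := 1 / 2)
    (by norm_num) 0 0
  have h2 := (h.norm).const_mul ((2 * Real.pi) ^ (-((d : ℝ) / 2)))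
  refine h2.congr (ae_of_all _ fun u => ?_)
  simp only [stdGaussianDensity, zero_mul, add_zero]
  rw [Complex.norm_exp]
  congr 2
  have : (-(1 / 2) * (‖u‖ : ℂ) ^ 2) = ((-(1 / 2) * ‖u‖ ^ 2 : ℝ) : ℂ) := by push_cast; ring
  rw [this, Complex.ofReal_re]

lemma stdGaussian_eq_withDensity :
    stdGaussian 𝔼 = volume.withDensity fun u => ENNReal.ofReal (stdGaussianDensity u) := by
  have : IsFiniteMeasure
      ((volume : Measure 𝔼).withDensity fun u => ENNReal.ofReal (stdGaussianDensity u)) :=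
    isFiniteMeasure_withDensity_ofReal integrable_stdGaussianDensity.2
  refine Measure.ext_of_charFun (funext fun t => ?_)
  rw [charFun_stdGaussian, charFun_apply,
    integral_withDensity_eq_integral_toReal_smul (by
      exact measurable_stdGaussianDensity.ennreal_ofReal) (ae_of_all _ fun _ => ENNReal.ofReal_lt_top),
    ← integral_cexp_mul_stdGaussianDensity]
  refine integral_congr_ae (ae_of_all _ fun u => ?_)
  simp only [ENNReal.toReal_ofReal (stdGaussianDensity_pos u).le, Complex.real_smul]

lemma stdGaussian_absolutelyContinuous : stdGaussian 𝔼 ≪ volume := by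
  rw [stdGaussian_eq_withDensity]
  exact withDensity_absolutelyContinuous _ _

lemma integral_stdGaussian (G : 𝔼 → ℝ) :
    ∫ u, G u ∂stdGaussian 𝔼 = ∫ u, stdGaussianDensity u * G u := by
  rw [stdGaussian_eq_withDensity, integral_withDensity_eq_integral_toReal_smul
    measurable_stdGaussianDensity.ennreal_ofReal (ae_of_all _ fun _ => ENNReal.ofReal_lt_top)]
  refine integral_congr_ae (ae_of_all _ fun u => ?_)
  simp only [ENNReal.toReal_ofReal (stdGaussianDensity_pos u).le, smul_eq_mul]

/-- The Cameron–Martin formula for translations of the standard Gaussian measure. -/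
lemma integral_add_stdGaussian (G : 𝔼 → ℝ) (a : 𝔼) :
    ∫ u, G (u + a) ∂stdGaussian 𝔼 =
      ∫ u, G u * Real.exp (inner ℝ a u - ‖a‖ ^ 2 / 2) ∂stdGaussian 𝔼 := by
  rw [integral_stdGaussian, integral_stdGaussian]
  rw [← integral_add_right_eq_self
    (fun u => stdGaussianDensity u * (G u * Real.exp (inner ℝ a u - ‖a‖ ^ 2 / 2))) a]
  refine integral_congr_ae (ae_of_all _ fun u => ?_)
  simp only [stdGaussianDensity]
  have : Real.exp (-(1 / 2) * ‖u‖ ^ 2) =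
      Real.exp (-(1 / 2) * ‖u + a‖ ^ 2) * Real.exp (inner ℝ a (u + a) - ‖a‖ ^ 2 / 2) := by
    rw [← Real.exp_add]
    congr 1
    rw [norm_add_sq_real, inner_add_right, real_inner_self_eq_norm_sq, real_inner_comm]
    ring
  rw [this]
  ring

/-- Push-forward of Lebesgue null sets: almost every Gaussian perturbation of a point avoids a
given Lebesgue-null set. -/
lemma ae_stdGaussian_add_smul {p : 𝔼 → Prop} (hp : ∀ᵐ y : 𝔼, p y) (x : 𝔼) {σ : ℝ} (hσ : σ ≠ 0) :
    ∀ᵐ u ∂stdGaussian 𝔼, p (x + σ • u) := by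
  refine stdGaussian_absolutelyContinuous.ae_le ?_
  have h1 : Measure.QuasiMeasurePreserving (fun u : 𝔼 => σ • u) volume volume := by
    refine ⟨by fun_prop, ?_⟩
    rw [Measure.map_addHaar_smul _ hσ]
    exact Measure.smul_absolutelyContinuous
  have h2 : Measure.QuasiMeasurePreserving (fun u : 𝔼 => x + u) volume volume :=
    (measurePreserving_add_left volume x).quasiMeasurePreserving
  exact (h2.comp h1).ae hp

lemma integrable_exp_mul_norm_stdGaussian (c : ℝ) :
    Integrable (fun u : 𝔼 => Real.exp (c * ‖u‖)) (stdGaussian 𝔼) := by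
  obtain ⟨C, hC, hint⟩ := IsGaussian.exists_integrable_exp_sq (stdGaussian 𝔼)
  refine (hint.const_mul (Real.exp (c ^ 2 / (4 * C)))).mono' (by fun_prop)
    (ae_of_all _ fun u => ?_)
  rw [Real.norm_of_nonneg (Real.exp_pos _).le, ← Real.exp_add, Real.exp_le_exp]
  have : c ^ 2 / (4 * C) + C * ‖u‖ ^ 2 - c * ‖u‖ = (c / (2 * C) - ‖u‖) ^ 2 * C := by
    field_simp; ring
  nlinarith [mul_nonneg (sq_nonneg (c / (2 * C) - ‖u‖)) hC.le]

lemma integrable_norm_pow_mul_exp_stdGaussian (n : ℕ) (c : ℝ) :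
    Integrable (fun u : 𝔼 => ‖u‖ ^ n * Real.exp (c * ‖u‖)) (stdGaussian 𝔼) := by
  refine ((integrable_exp_mul_norm_stdGaussian (d := d) (c + 1)).const_mul (n.factorial : ℝ)).mono'
    (by fun_prop) (ae_of_all _ fun u => ?_)
  rw [Real.norm_of_nonneg (by positivity), add_mul, one_mul, Real.exp_add]
  have := Real.pow_div_factorial_le_exp ‖u‖ (norm_nonneg _) n
  rw [div_le_iff₀ (by positivity)] at this
  nlinarith [Real.exp_pos (c * ‖u‖)]

lemma integrable_norm_pow_stdGaussian (n : ℕ) :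
    Integrable (fun u : 𝔼 => ‖u‖ ^ n) (stdGaussian 𝔼) := by
  simpa using integrable_norm_pow_mul_exp_stdGaussian (d := d) n 0

lemma integral_norm_pow_add_two_stdGaussian (hd : 1 ≤ d) (n : ℕ) :
    ∫ u : 𝔼, ‖u‖ ^ (n + 2) ∂stdGaussian 𝔼 = (d + n) * ∫ u : 𝔼, ‖u‖ ^ n ∂stdGaussian 𝔼 := by
  have : Nontrivial 𝔼 := by
    have : Nonempty (Fin d) := ⟨⟨0, hd⟩⟩
    infer_instance
  -- polar coordinates turn each moment into a value of the Gamma function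
  have key : ∀ k : ℕ, ∫ u : 𝔼, ‖u‖ ^ k ∂stdGaussian 𝔼 =
      d * volume.real (Metric.ball (0 : 𝔼) 1) * (2 * Real.pi) ^ (-((d : ℝ) / 2)) *
        ((1 / 2 : ℝ) ^ (-((d : ℝ) + k) / 2) * (1 / 2) * Real.Gamma (((d : ℝ) + k) / 2)) := by
    intro k
    have hd' : ((d - 1 : ℕ) : ℝ) = (d : ℝ) - 1 := by rw [Nat.cast_sub hd]; simp
    have h1 := integral_fun_norm_addHaar (volume : Measure 𝔼)
      (fun r : ℝ => (2 * Real.pi) ^ (-((d : ℝ) / 2)) * Real.exp (-(1 / 2) * r ^ 2) * r ^ k)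
    rw [integral_stdGaussian]
    unfold stdGaussianDensity
    have h2 := integral_rpow_mul_exp_neg_mul_rpow (p := 2) (q := (d : ℝ) - 1 + k) (b := 1 / 2)
      (by norm_num) (by
        have : (1 : ℝ) ≤ d := by exact_mod_cast hd
        have : (0 : ℝ) ≤ k := Nat.cast_nonneg k
        linarith) (by norm_num)
    have e : (d : ℝ) - 1 + k + 1 = d + k := by ring
    rw [e] at h2
    have h3 : ∫ r in Set.Ioi (0 : ℝ), r ^ (d - 1) •
        ((2 * Real.pi) ^ (-((d : ℝ) / 2)) * Real.exp (-(1 / 2) * r ^ 2) * r ^ k) =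
        (2 * Real.pi) ^ (-((d : ℝ) / 2)) *
          ∫ r in Set.Ioi (0 : ℝ), r ^ ((d : ℝ) - 1 + k) * Real.exp (-(1 / 2) * r ^ (2 : ℝ)) := by
      rw [← integral_const_mul]
      refine setIntegral_congr_fun measurableSet_Ioi fun r hr => ?_
      have hr' : (0 : ℝ) < r := hr
      simp only [smul_eq_mul]
      rw [Real.rpow_add hr', ← hd', Real.rpow_natCast, Real.rpow_natCast, Real.rpow_two]
      ring
    rw [h1, finrank_euclideanSpace_fin, nsmul_eq_mul, smul_eq_mul, h3, h2]
    ring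
  rw [key, key]
  have hpos : (0 : ℝ) < ((d : ℝ) + n) / 2 := by
    have : (1 : ℝ) ≤ d := by exact_mod_cast hd
    positivity
  have e1 : ((d : ℝ) + (n + 2 : ℕ)) / 2 = ((d : ℝ) + n) / 2 + 1 := by push_cast; ring
  have e2 : -((d : ℝ) + (n + 2 : ℕ)) / 2 = -((d : ℝ) + n) / 2 + (-1) := by push_cast; ring
  rw [e1, e2, Real.Gamma_add_one hpos.ne', Real.rpow_add (by norm_num), Real.rpow_neg_one]
  ring

lemma integral_norm_pow_two_mul_stdGaussian_le (hd : 1 ≤ d) (p : ℕ) :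
    ∫ u : 𝔼, ‖u‖ ^ (2 * p) ∂stdGaussian 𝔼 ≤ ((p : ℝ) + d) ^ p := by
  induction p with
  | zero => simp
  | succ p ih =>
    rw [mul_add, mul_one, integral_norm_pow_add_two_stdGaussian hd]
    have hx : (0 : ℝ) < (p : ℝ) + d := by
      have : (1 : ℝ) ≤ d := by exact_mod_cast hd
      positivity
    calc _ ≤ ((d : ℝ) + (2 * p : ℕ)) * ((p : ℝ) + d) ^ p := by gcongr
      _ ≤ _ := by
        have h := one_add_mul_le_pow (a := 1 / ((p : ℝ) + d)) (by
          have : 0 < 1 / ((p : ℝ) + d) := by positivity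
          linarith) (p + 1)
        have h2 := mul_le_mul_of_nonneg_left h (pow_nonneg hx.le (p + 1))
        rw [← mul_pow] at h2
        have e1 : ((p : ℝ) + d) * (1 + 1 / ((p : ℝ) + d)) = ((p + 1 : ℕ) : ℝ) + d := by
          field_simp; push_cast; ring
        rw [e1] at h2
        refine le_trans ?_ h2
        rw [pow_succ]
        have e2 : ((p : ℝ) + d) ^ p * ((p : ℝ) + d) *
            (1 + ((p + 1 : ℕ) : ℝ) * (1 / ((p : ℝ) + d))) =
            ((p : ℝ) + d) ^ p * ((p : ℝ) + d + (p + 1)) := by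
          field_simp; push_cast; ring
        rw [e2, mul_comm]
        refine mul_le_mul_of_nonneg_left ?_ (by positivity)
        push_cast
        linarith

lemma integral_norm_sq_stdGaussian (hd : 1 ≤ d) :
    ∫ u : 𝔼, ‖u‖ ^ 2 ∂stdGaussian 𝔼 = d := by
  have := integral_norm_pow_add_two_stdGaussian hd 0
  simpa using this

lemma sq_integral_le {Ω : Type*} [MeasurableSpace Ω] {P : Measure Ω} [IsProbabilityMeasure P]
    {X : Ω → ℝ} (h1 : Integrable X P) (h2 : Integrable (fun ω => X ω ^ 2) P) :
    (∫ ω, X ω ∂P) ^ 2 ≤ ∫ ω, X ω ^ 2 ∂P :=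
  (even_two.convexOn_pow (𝕜 := ℝ)).map_integral_le (by fun_prop) isClosed_univ
    (ae_of_all _ fun _ => Set.mem_univ _) h1 h2

/-- The moment bound `E‖u‖^p ≤ (p + d)^{p/2}`, from the even moments by Cauchy–Schwarz. -/
lemma integral_norm_pow_stdGaussian_le (hd : 1 ≤ d) (p : ℕ) :
    ∫ u : 𝔼, ‖u‖ ^ p ∂stdGaussian 𝔼 ≤ ((p : ℝ) + d) ^ ((p : ℝ) / 2) := by
  have hsq : (∫ u : 𝔼, ‖u‖ ^ p ∂stdGaussian 𝔼) ^ 2 ≤ ∫ u : 𝔼, ‖u‖ ^ (2 * p) ∂stdGaussian 𝔼 := by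
    have e : ∀ u : 𝔼, ‖u‖ ^ (2 * p) = (‖u‖ ^ p) ^ 2 := fun u => by rw [← pow_mul, mul_comm]
    simp_rw [e]
    refine sq_integral_le (integrable_norm_pow_stdGaussian p) ?_
    simp_rw [← e]
    exact integrable_norm_pow_stdGaussian _
  have h := hsq.trans (integral_norm_pow_two_mul_stdGaussian_le hd p)
  have h0 : (0 : ℝ) ≤ (p : ℝ) + d := by positivity
  refine (abs_le_of_sq_le_sq' ?_ (by positivity)).2
  rw [← Real.rpow_natCast (((p : ℝ) + d) ^ ((p : ℝ) / 2)) 2, ← Real.rpow_mul h0]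
  have : (p : ℝ) / 2 * ((2 : ℕ) : ℝ) = p := by push_cast; ring
  rw [this, Real.rpow_natCast]
  exact h

lemma integral_norm_stdGaussian_le (hd : 1 ≤ d) :
    ∫ u : 𝔼, ‖u‖ ∂stdGaussian 𝔼 ≤ √(d : ℝ) := by
  refine Real.le_sqrt_of_sq_le ?_
  rw [← integral_norm_sq_stdGaussian hd]
  exact sq_integral_le (by simpa using integrable_norm_pow_stdGaussian (d := d) 1)
    (integrable_norm_pow_stdGaussian 2)

/-! ### Gaussian smoothing -/

/-- The coefficient `2^{m-1} R₁`, with which `R₁ (a + b)^m` splits into `a^m` and `b^m`. For `m = 0`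
the exponent is `-1`, and the splitting holds because `R₁ = 0`. -/
noncomputable def splitCoeff (R₁ : ℝ) (m : ℕ) : ℝ := (2 : ℝ) ^ ((m : ℤ) - 1) * R₁

/-- The coefficient `2^{2m-2} R₁`, with which `R₁ (a + b + c)^m` splits after two steps. -/
noncomputable def splitCoeffTwo (R₁ : ℝ) (m : ℕ) : ℝ := (2 : ℝ) ^ (2 * (m : ℤ) - 2) * R₁

/-- The Gaussian smoothing `x ↦ E[f(x + σ u)]` of `f`. -/
noncomputable def gaussianSmoothing (f : EuclideanSpace ℝ (Fin d) → ℝ) (σ : ℝ)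
    (x : EuclideanSpace ℝ (Fin d)) : ℝ :=
  ∫ u, f (x + σ • u) ∂stdGaussian (EuclideanSpace ℝ (Fin d))

/-- The mean of the random search direction at `x`; it turns out to be the gradient of the
Gaussian smoothing. -/
noncomputable def smoothedGradient (f : EuclideanSpace ℝ (Fin d) → ℝ) (σ : ℝ)
    (x : EuclideanSpace ℝ (Fin d)) : EuclideanSpace ℝ (Fin d) :=
  ∫ u, zoDirection f σ x u ∂stdGaussian (EuclideanSpace ℝ (Fin d))

lemma add_pow_le_two_zpow_mul {m : ℕ} (hm : m ≠ 0) {a b : ℝ} (ha : 0 ≤ a) (hb : 0 ≤ b) :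
    (a + b) ^ m ≤ (2 : ℝ) ^ ((m : ℤ) - 1) * (a ^ m + b ^ m) := by
  have h := _root_.add_pow_le ha hb m
  have e : (2 : ℝ) ^ ((m : ℤ) - 1) = 2 ^ (m - 1) := by
    rw [← zpow_natCast, Nat.cast_sub (Nat.one_le_iff_ne_zero.2 hm)]
    simp
  rw [e]
  exact h

lemma integrable_norm_stdGaussian : Integrable (fun u : 𝔼 => ‖u‖) (stdGaussian 𝔼) := by
  simpa using integrable_norm_pow_stdGaussian (d := d) 1

lemma integral_smul_stdGaussian (c : ℝ) : ∫ u : 𝔼, c • u ∂stdGaussian 𝔼 = 0 := by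
  rw [integral_smul, integral_id_stdGaussian, smul_zero]

namespace IsSPBWith

variable {f : EuclideanSpace ℝ (Fin d) → ℝ} {R₁ R₂ : ℝ} {m : ℕ}

lemma splitCoeff_nonneg (hf : IsSPBWith f R₁ R₂ m) : 0 ≤ splitCoeff R₁ m := by
  have := hf.R₁_nonneg
  unfold splitCoeff; positivity

lemma splitCoeffTwo_nonneg (hf : IsSPBWith f R₁ R₂ m) : 0 ≤ splitCoeffTwo R₁ m := by
  have := hf.R₁_nonneg
  unfold splitCoeffTwo; positivity

lemma mul_add_pow_le (hf : IsSPBWith f R₁ R₂ m) {a b : ℝ} (ha : 0 ≤ a) (hb : 0 ≤ b) :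
    R₁ * (a + b) ^ m ≤ splitCoeff R₁ m * (a ^ m + b ^ m) := by
  by_cases hm : m = 0
  · simp [splitCoeff, hf.R₁_eq_zero_iff.2 hm]
  · have := mul_le_mul_of_nonneg_left (add_pow_le_two_zpow_mul hm ha hb) hf.R₁_nonneg
    unfold splitCoeff
    linarith

lemma splitCoeff_mul_add_pow_le (hf : IsSPBWith f R₁ R₂ m) {a b : ℝ} (ha : 0 ≤ a) (hb : 0 ≤ b) :
    splitCoeff R₁ m * (a + b) ^ m ≤ splitCoeffTwo R₁ m * (a ^ m + b ^ m) := by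
  by_cases hm : m = 0
  · simp [splitCoeff, splitCoeffTwo, hf.R₁_eq_zero_iff.2 hm]
  · have := mul_le_mul_of_nonneg_left (add_pow_le_two_zpow_mul hm ha hb) hf.splitCoeff_nonneg
    refine this.trans (le_of_eq ?_)
    unfold splitCoeff splitCoeffTwo
    have e : (2 : ℝ) ^ (2 * (m : ℤ) - 2) = 2 ^ ((m : ℤ) - 1) * 2 ^ ((m : ℤ) - 1) := by
      rw [← zpow_add₀ two_ne_zero]; congr 1; ring
    rw [e]; ring

lemma continuous (hf : IsSPBWith f R₁ R₂ m) : Continuous f := hf.locallyLipschitz.continuous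

lemma abs_shift_sub_le (hf : IsSPBWith f R₁ R₂ m) (x u : 𝔼) {σ : ℝ} (hσ : 0 ≤ σ) :
    |f (x + σ • u) - f x| ≤ (splitCoeff R₁ m * ‖x‖ ^ m + R₂) * (σ * ‖u‖) +
      splitCoeff R₁ m * σ ^ (m + 1) * ‖u‖ ^ (m + 1) := by
  have h1 : ‖σ • u‖ = σ * ‖u‖ := by rw [norm_smul, Real.norm_of_nonneg hσ]
  have hs : 0 ≤ σ * ‖u‖ := by positivity
  have h2 := hf.abs_sub_le (x := x) (y := x + σ • u) (r := ‖x‖ + σ * ‖u‖) (by linarith)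
    ((norm_add_le _ _).trans_eq (by rw [h1]))
  rw [add_sub_cancel_left, h1] at h2
  have h3 := hf.mul_add_pow_le (norm_nonneg x) hs
  have h4 := mul_le_mul_of_nonneg_right h3 hs
  refine h2.trans ?_
  have e : (σ * ‖u‖) ^ m * (σ * ‖u‖) = σ ^ (m + 1) * ‖u‖ ^ (m + 1) := by
    rw [← pow_succ, mul_pow]
  have : splitCoeff R₁ m * (‖x‖ ^ m + (σ * ‖u‖) ^ m) * (σ * ‖u‖) =
      splitCoeff R₁ m * ‖x‖ ^ m * (σ * ‖u‖) +
        splitCoeff R₁ m * ((σ * ‖u‖) ^ m * (σ * ‖u‖)) := by ring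
  rw [this, e] at h4
  linarith

lemma integrable_shift_bound (a b : ℝ) (n : ℕ) :
    Integrable (fun u : 𝔼 => a * ‖u‖ + b * ‖u‖ ^ n) (stdGaussian 𝔼) :=
  (integrable_norm_stdGaussian.const_mul a).add ((integrable_norm_pow_stdGaussian n).const_mul b)

lemma integrable_shift_sub (hf : IsSPBWith f R₁ R₂ m) (x : 𝔼) {σ : ℝ} (hσ : 0 ≤ σ) :
    Integrable (fun u : 𝔼 => f (x + σ • u) - f x) (stdGaussian 𝔼) := by
  have hc := hf.continuous
  refine (integrable_shift_bound ((splitCoeff R₁ m * ‖x‖ ^ m + R₂) * σ)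
    (splitCoeff R₁ m * σ ^ (m + 1)) (m + 1)).mono' (by fun_prop) (ae_of_all _ fun u => ?_)
  rw [Real.norm_eq_abs, mul_assoc _ σ]
  exact hf.abs_shift_sub_le x u hσ

lemma integrable_shift (hf : IsSPBWith f R₁ R₂ m) (x : 𝔼) {σ : ℝ} (hσ : 0 ≤ σ) :
    Integrable (fun u : 𝔼 => f (x + σ • u)) (stdGaussian 𝔼) := by
  refine ((hf.integrable_shift_sub x hσ).add (integrable_const (f x))).congr
    (ae_of_all _ fun u => ?_)
  simp

lemma norm_zoDirection_le (hf : IsSPBWith f R₁ R₂ m) (x u : 𝔼) {σ : ℝ} (hσ : 0 < σ) :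
    ‖zoDirection f σ x u‖ ≤ (splitCoeff R₁ m * ‖x‖ ^ m + R₂) * ‖u‖ ^ 2 +
      splitCoeff R₁ m * σ ^ m * ‖u‖ ^ (m + 2) := by
  unfold zoDirection
  rw [norm_smul, norm_div, Real.norm_of_nonneg hσ.le, Real.norm_eq_abs, div_mul_eq_mul_div,
    div_le_iff₀ hσ]
  refine (mul_le_mul_of_nonneg_right (hf.abs_shift_sub_le x u hσ.le) (norm_nonneg u)).trans
    (le_of_eq ?_)
  ring

lemma continuous_zoDirection (hf : IsSPBWith f R₁ R₂ m) (σ : ℝ) :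
    Continuous fun p : 𝔼 × 𝔼 => zoDirection f σ p.1 p.2 := by
  have hc := hf.continuous
  unfold zoDirection
  fun_prop

lemma integrable_zoDirection_norm_pow (hf : IsSPBWith f R₁ R₂ m) (x : 𝔼) {σ : ℝ} (hσ : 0 < σ)
    (p : ℕ) : Integrable (fun u => ‖zoDirection f σ x u‖ ^ p) (stdGaussian 𝔼) := by
  have hc := hf.continuous_zoDirection σ
  have hc' : Continuous fun u => zoDirection f σ x u := hc.comp (by fun_prop : Continuous fun u => (x, u))
  set A := splitCoeff R₁ m * ‖x‖ ^ m + R₂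
  set B := splitCoeff R₁ m * σ ^ m
  have hA : 0 ≤ A := by
    have := hf.splitCoeff_nonneg; have := hf.R₂_pos; positivity
  have hB : 0 ≤ B := by have := hf.splitCoeff_nonneg; positivity
  have hi : Integrable (fun u : 𝔼 => 2 ^ (p - 1) * (A ^ p * ‖u‖ ^ (2 * p) +
      B ^ p * ‖u‖ ^ ((m + 2) * p))) (stdGaussian 𝔼) :=
    (((integrable_norm_pow_stdGaussian _).const_mul _).add
      ((integrable_norm_pow_stdGaussian _).const_mul _)).const_mul _
  refine hi.mono' (by fun_prop) (ae_of_all _ fun u => ?_)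
  rw [Real.norm_of_nonneg (by positivity)]
  calc ‖zoDirection f σ x u‖ ^ p ≤ (A * ‖u‖ ^ 2 + B * ‖u‖ ^ (m + 2)) ^ p := by
        gcongr; exact hf.norm_zoDirection_le x u hσ
    _ ≤ 2 ^ (p - 1) * ((A * ‖u‖ ^ 2) ^ p + (B * ‖u‖ ^ (m + 2)) ^ p) :=
        _root_.add_pow_le (by positivity) (by positivity) p
    _ = _ := by rw [mul_pow, mul_pow, ← pow_mul, ← pow_mul]

lemma integrable_zoDirection (hf : IsSPBWith f R₁ R₂ m) (x : 𝔼) {σ : ℝ} (hσ : 0 < σ) :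
    Integrable (fun u => zoDirection f σ x u) (stdGaussian 𝔼) := by
  have hc' : Continuous fun u => zoDirection f σ x u :=
    (hf.continuous_zoDirection σ).comp (by fun_prop : Continuous fun u => (x, u))
  refine (integrable_norm_iff hc'.aestronglyMeasurable).1 ?_
  simpa using hf.integrable_zoDirection_norm_pow x hσ 1

lemma integral_shift_mul_inner (hf : IsSPBWith f R₁ R₂ m) (x h : 𝔼) {σ : ℝ} (hσ : 0 < σ) :
    ∫ u, f (x + σ • u) * inner ℝ (σ⁻¹ • h) u ∂stdGaussian 𝔼 =
      inner ℝ (smoothedGradient f σ x) h := by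
  have h1 : ∀ u : 𝔼, f (x + σ • u) * inner ℝ (σ⁻¹ • h) u =
      inner ℝ h (zoDirection f σ x u + (f x / σ) • u) := by
    intro u
    unfold zoDirection
    rw [← add_smul, inner_smul_right, real_inner_smul_left]
    field_simp
    ring
  simp_rw [h1]
  have i2 : Integrable (fun u : 𝔼 => (f x / σ) • u) (stdGaussian 𝔼) :=
    (IsGaussian.integrable_fun_id.smul (f x / σ)).congr (ae_of_all _ fun _ => rfl)
  refine (integral_inner ((hf.integrable_zoDirection x hσ).add i2) h).trans ?_
  simp only [Pi.add_apply]
  rw [integral_add (hf.integrable_zoDirection x hσ) i2, integral_smul_stdGaussian, add_zero,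
    real_inner_comm, smoothedGradient]

/-- Differentiation of the smoothing along a line. The Cameron–Martin formula moves the shift
from `f` to the Gaussian density, so no differentiability of `f` is needed. -/
lemma hasDerivAt_gaussianSmoothing_zero (hf : IsSPBWith f R₁ R₂ m) (x h : 𝔼) {σ : ℝ} (hσ : 0 < σ) :
    HasDerivAt (fun t : ℝ => gaussianSmoothing f σ (x + t • h))
      (inner ℝ (smoothedGradient f σ x) h) 0 := by
  have hc := hf.continuous
  set a : 𝔼 := σ⁻¹ • h with ha
  have hF : (fun t : ℝ => gaussianSmoothing f σ (x + t • h)) = fun t : ℝ =>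
      ∫ u, f (x + σ • u) * Real.exp (t * inner ℝ a u - t ^ 2 * (‖a‖ ^ 2 / 2)) ∂stdGaussian 𝔼 := by
    funext t
    have h1 := integral_add_stdGaussian (fun u : 𝔼 => f (x + σ • u)) (t • a)
    unfold gaussianSmoothing
    have e1 : ∀ u : 𝔼, x + σ • (u + t • a) = x + t • h + σ • u := by
      intro u
      rw [ha, smul_add, smul_comm t, smul_smul, mul_inv_cancel₀ hσ.ne', one_smul]
      abel
    simp_rw [e1] at h1
    rw [h1]
    refine integral_congr_ae (ae_of_all _ fun u => ?_)
    simp only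
    rw [real_inner_smul_left, norm_smul, mul_pow, Real.norm_eq_abs, sq_abs]
    congr 2
    ring
  rw [hF, ← hf.integral_shift_mul_inner x h hσ, ← ha]
  set Bd : 𝔼 → ℝ := fun u => (|f x| + ((splitCoeff R₁ m * ‖x‖ ^ m + R₂) * σ) * ‖u‖ +
    splitCoeff R₁ m * σ ^ (m + 1) * ‖u‖ ^ (m + 1)) * ((‖a‖ * ‖u‖ + ‖a‖ ^ 2) *
      Real.exp (‖a‖ * ‖u‖)) with hBd
  have hBdi : Integrable Bd (stdGaussian 𝔼) := by
    have E := fun n => integrable_norm_pow_mul_exp_stdGaussian (d := d) n ‖a‖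
    have := ((((E 1).const_mul (|f x| * ‖a‖)).add ((E 0).const_mul (|f x| * ‖a‖ ^ 2))).add
      (((E 2).const_mul (((splitCoeff R₁ m * ‖x‖ ^ m + R₂) * σ) * ‖a‖)).add
        ((E 1).const_mul (((splitCoeff R₁ m * ‖x‖ ^ m + R₂) * σ) * ‖a‖ ^ 2)))).add
      (((E (m + 2)).const_mul ((splitCoeff R₁ m * σ ^ (m + 1)) * ‖a‖)).add
        ((E (m + 1)).const_mul ((splitCoeff R₁ m * σ ^ (m + 1)) * ‖a‖ ^ 2)))
    refine this.congr (ae_of_all _ fun u => ?_)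
    simp only [hBd, Pi.add_apply]
    ring
  have habs : ∀ u, |f (x + σ • u)| ≤ |f x| + ((splitCoeff R₁ m * ‖x‖ ^ m + R₂) * σ) * ‖u‖ +
      splitCoeff R₁ m * σ ^ (m + 1) * ‖u‖ ^ (m + 1) := by
    intro u
    have h1 := hf.abs_shift_sub_le x u hσ.le
    have h2 := abs_sub_abs_le_abs_sub (f (x + σ • u)) (f x)
    linarith
  have key := (hasDerivAt_integral_of_dominated_loc_of_deriv_le (μ := stdGaussian 𝔼)
    (F := fun (t : ℝ) (u : 𝔼) =>
      f (x + σ • u) * Real.exp (t * inner ℝ a u - t ^ 2 * (‖a‖ ^ 2 / 2)))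
    (F' := fun (t : ℝ) (u : 𝔼) => f (x + σ • u) * ((inner ℝ a u - t * ‖a‖ ^ 2) *
      Real.exp (t * inner ℝ a u - t ^ 2 * (‖a‖ ^ 2 / 2)))) (x₀ := 0) (bound := Bd)
    (s := Metric.ball 0 1) (Metric.ball_mem_nhds _ one_pos)
    (Eventually.of_forall fun t => by fun_prop)
    (by simpa using hf.integrable_shift x hσ.le) (by fun_prop)
    (ae_of_all _ fun u t ht => ?_) hBdi (ae_of_all _ fun u t _ => ?_)).2
  · simpa using key
  · have ht' : |t| ≤ 1 := by
      rw [mem_ball_zero_iff, Real.norm_eq_abs] at ht; exact ht.le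
    have hin : |inner ℝ a u| ≤ ‖a‖ * ‖u‖ := abs_real_inner_le_norm a u
    rw [norm_mul, norm_mul, Real.norm_eq_abs, Real.norm_eq_abs, Real.norm_of_nonneg
      (Real.exp_pos _).le]
    refine mul_le_mul (habs u) (mul_le_mul ?_ ?_ (Real.exp_pos _).le (by positivity))
      (by positivity) ((abs_nonneg _).trans (habs u))
    · refine (abs_sub _ _).trans (add_le_add hin ?_)
      rw [abs_mul, abs_of_nonneg (sq_nonneg ‖a‖)]
      exact mul_le_of_le_one_left (sq_nonneg _) ht'
    · rw [Real.exp_le_exp]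
      have h1 : t * inner ℝ a u ≤ ‖a‖ * ‖u‖ := by
        refine (le_abs_self _).trans ?_
        rw [abs_mul]
        exact (mul_le_of_le_one_left (abs_nonneg _) ht').trans hin
      have : 0 ≤ t ^ 2 * (‖a‖ ^ 2 / 2) := by positivity
      linarith
  · have h1 : HasDerivAt (fun t : ℝ => t * inner ℝ a u - t ^ 2 * (‖a‖ ^ 2 / 2))
        (inner ℝ a u - t * ‖a‖ ^ 2) t := by
      have := ((hasDerivAt_id t).mul_const (inner ℝ a u)).sub
        ((hasDerivAt_pow 2 t).mul_const (‖a‖ ^ 2 / 2))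
      refine this.congr_deriv ?_
      simp; ring
    refine (h1.exp.const_mul (f (x + σ • u))).congr_deriv ?_
    ring

lemma hasDerivAt_gaussianSmoothing (hf : IsSPBWith f R₁ R₂ m) (x h : 𝔼) {σ : ℝ} (hσ : 0 < σ)
    (t : ℝ) : HasDerivAt (fun t : ℝ => gaussianSmoothing f σ (x + t • h))
      (inner ℝ (smoothedGradient f σ (x + t • h)) h) t := by
  have h1 := hf.hasDerivAt_gaussianSmoothing_zero (x + t • h) h hσ
  have h2 : HasDerivAt (fun s : ℝ => s - t) 1 t := (hasDerivAt_id t).sub_const t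
  have h3 := HasDerivAt.scomp_of_eq t h1 h2 (by simp)
  rw [one_smul] at h3
  refine h3.congr_of_eventuallyEq (Eventually.of_forall fun s => ?_)
  simp only [Function.comp]
  rw [add_assoc, ← add_smul]
  congr 3
  ring

lemma norm_gradient_shift_le (hf : IsSPBWith f R₁ R₂ m) (x : 𝔼) {σ : ℝ} (hσ : 0 < σ) :
    ∀ᵐ u ∂stdGaussian 𝔼, ‖gradient f (x + σ • u)‖ ≤
      (splitCoeff R₁ m * ‖x‖ ^ m + R₂) + splitCoeff R₁ m * σ ^ m * ‖u‖ ^ m := by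
  filter_upwards [ae_stdGaussian_add_smul hf.ae_differentiableAt x hσ.ne'] with u hu
  have h1 := hf.norm_le _ _ (gradient_mem_clarkeSubdiff hf.locallyLipschitz hu)
  have h2 : ‖x + σ • u‖ ≤ ‖x‖ + σ * ‖u‖ := by
    refine (norm_add_le _ _).trans ?_
    rw [norm_smul, Real.norm_of_nonneg hσ.le]
  have h3 := hf.mul_add_pow_le (norm_nonneg x) (by positivity : 0 ≤ σ * ‖u‖)
  have h4 : R₁ * ‖x + σ • u‖ ^ m ≤ R₁ * (‖x‖ + σ * ‖u‖) ^ m := by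
    have := hf.R₁_nonneg; gcongr
  rw [mul_pow] at h3
  linarith

lemma measurable_gradient (f : 𝔼 → ℝ) : Measurable (gradient f) := by
  unfold gradient
  exact (InnerProductSpace.toDual ℝ 𝔼).symm.continuous.measurable.comp (measurable_fderiv ℝ f)

lemma integrable_gradient_shift (hf : IsSPBWith f R₁ R₂ m) (x : 𝔼) {σ : ℝ} (hσ : 0 < σ) :
    Integrable (fun u => gradient f (x + σ • u)) (stdGaussian 𝔼) := by
  refine ((integrable_const (splitCoeff R₁ m * ‖x‖ ^ m + R₂)).add
    ((integrable_norm_pow_stdGaussian m).const_mul (splitCoeff R₁ m * σ ^ m))).mono' ?_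
    (hf.norm_gradient_shift_le x hσ)
  exact ((measurable_gradient f).comp (by fun_prop)).aestronglyMeasurable

/-- The mean of the search direction is the Gaussian average of the almost everywhere defined
gradient of `f`: differentiating the smoothing under the integral sign gives a second expression
for the derivative found by the Cameron–Martin formula. -/
lemma smoothedGradient_eq_integral_gradient (hf : IsSPBWith f R₁ R₂ m) (x : 𝔼) {σ : ℝ}
    (hσ : 0 < σ) :
    smoothedGradient f σ x = ∫ u, gradient f (x + σ • u) ∂stdGaussian 𝔼 := by
  have hc := hf.continuous
  refine ext_inner_left ℝ fun h => ?_
  rw [← integral_inner (hf.integrable_gradient_shift x hσ), real_inner_comm]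
  refine (hf.hasDerivAt_gaussianSmoothing_zero x h hσ).unique ?_
  set C : 𝔼 → ℝ := fun u => (splitCoeff R₁ m * (‖x‖ + ‖h‖) ^ m + R₂) * ‖h‖ +
    (splitCoeff R₁ m * σ ^ m * ‖h‖) * ‖u‖ ^ m with hC
  have hCn : ∀ u, 0 ≤ C u := by
    intro u
    have := hf.splitCoeff_nonneg; have := hf.R₂_pos
    simp only [hC]; positivity
  unfold gaussianSmoothing
  refine (hasDerivAt_integral_of_dominated_loc_of_lip (μ := stdGaussian 𝔼)
    (F := fun (t : ℝ) (u : 𝔼) => f (x + t • h + σ • u))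
    (F' := fun u => inner ℝ h (gradient f (x + σ • u))) (x₀ := 0) (bound := C)
    (s := Metric.ball 0 1) (Metric.ball_mem_nhds _ one_pos)
    (Eventually.of_forall fun t => by fun_prop)
    (by simpa using hf.integrable_shift x hσ.le)
    ((hf.integrable_gradient_shift x hσ).aestronglyMeasurable.const_inner)
    (ae_of_all _ fun u => ?_)
    ((integrable_const _).add ((integrable_norm_pow_stdGaussian m).const_mul _)) ?_).2
  · refine LipschitzOnWith.of_dist_le_mul fun s hs t ht => ?_
    rw [Real.coe_nnabs, abs_of_nonneg (hCn u), Real.dist_eq, Real.dist_eq]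
    have hn : ∀ t ∈ Metric.ball (0 : ℝ) 1, ‖x + t • h + σ • u‖ ≤ (‖x‖ + ‖h‖) + σ * ‖u‖ := by
      intro t ht
      rw [mem_ball_zero_iff] at ht
      refine (norm_add₃_le).trans ?_
      rw [norm_smul, norm_smul, Real.norm_of_nonneg hσ.le]
      nlinarith [norm_nonneg h]
    have h1 := hf.abs_sub_le (hn t ht) (hn s hs)
    have e : x + s • h + σ • u - (x + t • h + σ • u) = (s - t) • h := by module
    rw [e, norm_smul, Real.norm_eq_abs] at h1
    refine h1.trans ?_
    have h3 := hf.mul_add_pow_le (by positivity : 0 ≤ ‖x‖ + ‖h‖) (by positivity : 0 ≤ σ * ‖u‖)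
    rw [mul_pow] at h3
    have h4 := mul_le_mul_of_nonneg_right (add_le_add_left h3 R₂)
      (by positivity : 0 ≤ |s - t| * ‖h‖)
    refine h4.trans (le_of_eq ?_)
    simp only [hC]; ring
  · filter_upwards [ae_stdGaussian_add_smul hf.ae_differentiableAt x hσ.ne'] with u hu
    have h1 : HasDerivAt (fun t : ℝ => f (x + σ • u + t • h)) (fderiv ℝ f (x + σ • u) h) 0 :=
      hu.hasFDerivAt.hasLineDerivAt h
    have e1 : inner ℝ h (gradient f (x + σ • u)) = fderiv ℝ f (x + σ • u) h := by
      rw [real_inner_comm, gradient, InnerProductSpace.toDual_symm_apply]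
    rw [e1]
    refine h1.congr_of_eventuallyEq (Eventually.of_forall fun t => ?_)
    simp only
    rw [add_right_comm]

end IsSPBWith

/-! ### Descent along one step of the algorithm -/

lemma one_add_pow_le_one_add_sq_pow {a : ℝ} (ha : 0 ≤ a) (n : ℕ) :
    1 + a ^ (n + 2) ≤ (1 + a ^ 2) ^ (n + 2) := by
  have h1 : a ^ n ≤ (1 + a ^ 2) ^ n := by
    gcongr
    nlinarith [sq_nonneg (a - 1)]
  have h2 : 1 ≤ (1 + a ^ 2) ^ n := one_le_pow₀ (by nlinarith)
  have h3 : 0 ≤ a ^ n := pow_nonneg ha n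
  rw [pow_add, pow_add]
  nlinarith [sq_nonneg a, mul_nonneg (sq_nonneg a) h3, mul_le_mul_of_nonneg_left h1 (sq_nonneg a),
    mul_nonneg (sq_nonneg a) (sub_nonneg.2 h2), mul_nonneg (sq_nonneg (a ^ 2)) (h3.trans h1)]

lemma add_add_pow_succ_le {a b c : ℝ} (ha : 0 ≤ a) (hb : 0 ≤ b) (hc : 0 ≤ c) (n : ℕ) :
    (a + b + c) ^ (n + 1) ≤ 3 ^ n * (a ^ (n + 1) + b ^ (n + 1) + c ^ (n + 1)) := by
  have h := pow_sum_div_card_le_sum_pow (s := Finset.univ) (f := ![a, b, c]) (by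
    intro i _; fin_cases i <;> simpa) n
  rw [div_le_iff₀ (by simp)] at h
  simp only [Fin.sum_univ_three, Finset.card_univ, Fintype.card_fin] at h
  simpa [mul_comm] using h

lemma breveH_nonneg {R₁ R₂ : ℝ} (h1 : 0 ≤ R₁) (h2 : 0 ≤ R₂) (m d p : ℕ) :
    0 ≤ breveH R₁ R₂ m d p := by
  unfold breveH
  split_ifs <;> positivity

/-- The part of `constK` that bounds the total error of the descent steps. -/
noncomputable def descentConst (R₁ R₂ : ℝ) (m d : ℕ) : ℝ :=
  (1 / 2) * breveH R₁ R₂ m d 2 *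
      (splitCoeffTwo R₁ m * ((m : ℝ) + 1 + d) ^ (((m : ℝ) + 1) / 2) + R₂ * √(d : ℝ)) +
    (1 / 2) * splitCoeffTwo R₁ m * breveH R₁ R₂ m d 2 * √(d : ℝ) +
    splitCoeff R₁ m * breveH R₁ R₂ m d (m + 2) * ((m : ℝ) + 2)⁻¹ * √(d : ℝ)

lemma constK_eq (f : 𝔼 → ℝ) (R₁ R₂ : ℝ) (m : ℕ) (x₀ : 𝔼) :
    constK f R₁ R₂ m x₀ =
      f x₀ - (⨅ y, f y) + breveM R₁ R₂ m d x₀ + descentConst R₁ R₂ m d := by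
  have e : (2 : ℝ) ^ (2 * (m : ℤ) - 3) = 1 / 2 * 2 ^ (2 * (m : ℤ) - 2) := by
    rw [show 2 * (m : ℤ) - 2 = (2 * (m : ℤ) - 3) + 1 by ring, zpow_add_one₀ two_ne_zero]
    ring
  unfold constK descentConst splitCoeff splitCoeffTwo
  rw [e]
  ring

namespace IsSPBWith

variable {f : EuclideanSpace ℝ (Fin d) → ℝ} {R₁ R₂ : ℝ} {m : ℕ}

lemma integral_norm_pow_add_one_stdGaussian_le (hd : 1 ≤ d) (m : ℕ) :
    ∫ u : 𝔼, ‖u‖ ^ (m + 1) ∂stdGaussian 𝔼 ≤ ((m : ℝ) + 1 + d) ^ (((m : ℝ) + 1) / 2) := by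
  have := integral_norm_pow_stdGaussian_le hd (m + 1)
  push_cast at this
  exact this

/-- Local Lipschitz bound for the gradient of the smoothing. -/
lemma norm_smoothedGradient_sub_le (hf : IsSPBWith f R₁ R₂ m) (hd : 1 ≤ d) (x h : 𝔼) {σ : ℝ}
    (hσ : 0 < σ) (hσ1 : σ ≤ 1) {t : ℝ} (ht : 0 ≤ t) :
    ‖smoothedGradient f σ (x + t • h) - smoothedGradient f σ x‖ ≤
      (t * ‖h‖ / σ) * ((splitCoeff R₁ m * (t * ‖h‖) ^ m + splitCoeffTwo R₁ m * ‖x‖ ^ m + R₂) *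
        √(d : ℝ) + splitCoeffTwo R₁ m * ((m : ℝ) + 1 + d) ^ (((m : ℝ) + 1) / 2)) := by
  have hρ := hf.splitCoeff_nonneg
  have hρ₂ := hf.splitCoeffTwo_nonneg
  have hR₂ := hf.R₂_pos
  set A := splitCoeff R₁ m * (t * ‖h‖) ^ m + splitCoeffTwo R₁ m * ‖x‖ ^ m + R₂ with hA
  have hA0 : 0 ≤ A := by positivity
  have i2 : Integrable (fun u : 𝔼 => ((f (x + t • h) - f x) / σ) • u) (stdGaussian 𝔼) :=
    (IsGaussian.integrable_fun_id.smul ((f (x + t • h) - f x) / σ)).congr (ae_of_all _ fun _ => rfl)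
  have e1 : smoothedGradient f σ (x + t • h) - smoothedGradient f σ x =
      ∫ u, ((f (x + t • h + σ • u) - f (x + σ • u)) / σ) • u ∂stdGaussian 𝔼 := by
    have h1 := integral_smul_stdGaussian (d := d) ((f (x + t • h) - f x) / σ)
    have i3 : Integrable (fun u => zoDirection f σ (x + t • h) u - zoDirection f σ x u)
        (stdGaussian 𝔼) := (hf.integrable_zoDirection _ hσ).sub (hf.integrable_zoDirection _ hσ)
    rw [smoothedGradient, smoothedGradient, ← integral_sub (hf.integrable_zoDirection _ hσ)
      (hf.integrable_zoDirection _ hσ), ← add_zero (∫ u, _ ∂stdGaussian 𝔼), ← h1,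
      ← integral_add i3 i2]
    refine integral_congr_ae (ae_of_all _ fun u => ?_)
    simp only [zoDirection]
    rw [← sub_smul, ← add_smul]
    congr 1
    ring
  rw [e1]
  have hpt : ∀ u : 𝔼, ‖((f (x + t • h + σ • u) - f (x + σ • u)) / σ) • u‖ ≤
      (t * ‖h‖ / σ) * (A * ‖u‖ + splitCoeffTwo R₁ m * ‖u‖ ^ (m + 1)) := by
    intro u
    have hsu : ‖σ • u‖ = σ * ‖u‖ := by rw [norm_smul, Real.norm_of_nonneg hσ.le]
    have hth : ‖t • h‖ = t * ‖h‖ := by rw [norm_smul, Real.norm_of_nonneg ht]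
    have hth0 : 0 ≤ t * ‖h‖ := by positivity
    have b1 : ‖x + σ • u‖ ≤ t * ‖h‖ + (‖x‖ + σ * ‖u‖) := by
      refine (norm_add_le _ _).trans ?_; rw [hsu]; linarith
    have b2 : ‖x + t • h + σ • u‖ ≤ t * ‖h‖ + (‖x‖ + σ * ‖u‖) := by
      refine norm_add₃_le.trans ?_; rw [hsu, hth]; linarith
    have h1 := hf.abs_sub_le b1 b2
    rw [show x + t • h + σ • u - (x + σ • u) = t • h by abel, hth] at h1
    -- the increment `t h` is split off first, so that its power keeps the smaller coefficient
    have h2 := hf.mul_add_pow_le hth0 (by positivity : 0 ≤ ‖x‖ + σ * ‖u‖)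
    have h3 := hf.splitCoeff_mul_add_pow_le (norm_nonneg x) (by positivity : 0 ≤ σ * ‖u‖)
    have h4 : (σ * ‖u‖) ^ m ≤ ‖u‖ ^ m := by
      gcongr
      exact mul_le_of_le_one_left (norm_nonneg u) hσ1
    have h5 := mul_le_mul_of_nonneg_left h4 hρ₂
    have h6 : R₁ * (t * ‖h‖ + (‖x‖ + σ * ‖u‖)) ^ m + R₂ ≤ A + splitCoeffTwo R₁ m * ‖u‖ ^ m := by
      rw [hA]; linarith
    have h7 := h1.trans (mul_le_mul_of_nonneg_right h6 hth0)
    rw [norm_smul, norm_div, Real.norm_of_nonneg hσ.le, Real.norm_eq_abs, div_mul_eq_mul_div,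
      div_mul_eq_mul_div, div_le_div_iff_of_pos_right hσ]
    refine (mul_le_mul_of_nonneg_right h7 (norm_nonneg u)).trans (le_of_eq ?_)
    ring
  have hi := (integrable_shift_bound (d := d) A (splitCoeffTwo R₁ m) (m + 1)).const_mul
    (t * ‖h‖ / σ)
  refine (norm_integral_le_of_norm_le hi (ae_of_all _ hpt)).trans ?_
  rw [integral_const_mul, integral_add (integrable_norm_stdGaussian.const_mul A)
    ((integrable_norm_pow_stdGaussian _).const_mul _), integral_const_mul, integral_const_mul]
  have := integral_norm_stdGaussian_le hd
  have := integral_norm_pow_add_one_stdGaussian_le hd m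
  gcongr

/-- The descent inequality for the smoothing, from the local Lipschitz bound on its gradient, with a remainder polynomial in the step. -/
lemma gaussianSmoothing_add_le (hf : IsSPBWith f R₁ R₂ m) (hd : 1 ≤ d) (x h : 𝔼) {σ : ℝ}
    (hσ : 0 < σ) (hσ1 : σ ≤ 1) :
    gaussianSmoothing f σ (x + h) ≤ gaussianSmoothing f σ x + inner ℝ (smoothedGradient f σ x) h +
      (1 / σ) * ((1 / 2) * ((splitCoeffTwo R₁ m * ‖x‖ ^ m + R₂) * √(d : ℝ) +
        splitCoeffTwo R₁ m * ((m : ℝ) + 1 + d) ^ (((m : ℝ) + 1) / 2)) * ‖h‖ ^ 2 +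
        splitCoeff R₁ m * √(d : ℝ) * ((m : ℝ) + 2)⁻¹ * ‖h‖ ^ (m + 2)) := by
  set G := splitCoeffTwo R₁ m * ((m : ℝ) + 1 + d) ^ (((m : ℝ) + 1) / 2) with hG
  set A := (splitCoeffTwo R₁ m * ‖x‖ ^ m + R₂) * √(d : ℝ) + G with hA
  set g := inner ℝ (smoothedGradient f σ x) h with hg
  set B := fun t : ℝ => gaussianSmoothing f σ x + t * g + (1 / σ) * ((1 / 2) * A * ‖h‖ ^ 2 * t ^ 2 +
        splitCoeff R₁ m * √(d : ℝ) * ((m : ℝ) + 2)⁻¹ * ‖h‖ ^ (m + 2) * t ^ (m + 2)) with hB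
  set B' := fun t : ℝ => g + (1 / σ) * (A * ‖h‖ ^ 2 * t +
        splitCoeff R₁ m * √(d : ℝ) * ‖h‖ ^ (m + 2) * t ^ (m + 1)) with hB'
  have hm2 : (m : ℝ) + 2 ≠ 0 := by positivity
  have hBd : ∀ t, HasDerivAt B (B' t) t := by
    intro t
    have h1 := ((hasDerivAt_id t).mul_const g).const_add (gaussianSmoothing f σ x)
    have h2 := (((hasDerivAt_pow 2 t).const_mul ((1 / 2) * A * ‖h‖ ^ 2)).add
      ((hasDerivAt_pow (m + 2) t).const_mul
        (splitCoeff R₁ m * √(d : ℝ) * ((m : ℝ) + 2)⁻¹ * ‖h‖ ^ (m + 2)))).const_mul (1 / σ)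
    refine (h1.add h2).congr_deriv ?_
    simp only [hB']
    push_cast
    field_simp
  have hd1 := fun t => hf.hasDerivAt_gaussianSmoothing x h hσ t
  have key := image_le_of_deriv_right_le_deriv_boundary (a := 0) (b := 1)
    (fun t _ => (hd1 t).continuousAt.continuousWithinAt)
    (fun t _ => (hd1 t).hasDerivWithinAt) (B := B) (B' := B') (by simp [hB])
    (fun t _ => (hBd t).continuousAt.continuousWithinAt)
    (fun t _ => (hBd t).hasDerivWithinAt) (by
      intro t ht
      have h1 := hf.norm_smoothedGradient_sub_le hd x h hσ hσ1 ht.1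
      have h2 : inner ℝ (smoothedGradient f σ (x + t • h)) h - g ≤
          ‖smoothedGradient f σ (x + t • h) - smoothedGradient f σ x‖ * ‖h‖ := by
        rw [hg, ← inner_sub_left]
        exact real_inner_le_norm _ _
      have h3 := mul_le_mul_of_nonneg_right h1 (norm_nonneg h)
      have e : B' t = g + t * ‖h‖ / σ * ((splitCoeff R₁ m * (t * ‖h‖) ^ m +
          splitCoeffTwo R₁ m * ‖x‖ ^ m + R₂) * √(d : ℝ) + G) * ‖h‖ := by
        simp only [hB', hA]
        rw [mul_pow]
        field_simp
        ring
      rw [e]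
      linarith) (Set.right_mem_Icc.2 zero_le_one)
  simp only [one_smul, hB, one_mul, one_pow, mul_one] at key
  exact key

lemma integral_norm_zoDirection_pow_le (hf : IsSPBWith f R₁ R₂ m) (hd : 1 ≤ d) (x : 𝔼) {σ : ℝ}
    (hσ : 0 < σ) (hσ1 : σ ≤ 1) (n : ℕ) :
    ∫ u, ‖zoDirection f σ x u‖ ^ (n + 1) ∂stdGaussian 𝔼 ≤
      breveH R₁ R₂ m d (n + 1) * (1 + (‖x‖ ^ m) ^ (n + 1)) := by
  have hρ := hf.splitCoeff_nonneg
  have hR₂ := hf.R₂_pos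
  set p := n + 1 with hp
  set ρ := splitCoeff R₁ m with hρd
  have hd1 : (1 : ℝ) ≤ d := by exact_mod_cast hd
  have hpt : ∀ u : 𝔼, ‖zoDirection f σ x u‖ ^ p ≤ 3 ^ n * ((ρ * ‖x‖ ^ m) ^ p * ‖u‖ ^ (2 * p) +
      R₂ ^ p * ‖u‖ ^ (2 * p) + ρ ^ p * ‖u‖ ^ ((m + 2) * p)) := by
    intro u
    have h1 := hf.norm_zoDirection_le x u hσ
    have h2 : ρ * σ ^ m * ‖u‖ ^ (m + 2) ≤ ρ * ‖u‖ ^ (m + 2) := by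
      have : σ ^ m ≤ 1 := pow_le_one₀ hσ.le hσ1
      gcongr
      exact mul_le_of_le_one_right hρ this
    have h3 : ‖zoDirection f σ x u‖ ≤ ρ * ‖x‖ ^ m * ‖u‖ ^ 2 + R₂ * ‖u‖ ^ 2 + ρ * ‖u‖ ^ (m + 2) := by
      linarith
    refine (pow_le_pow_left₀ (norm_nonneg _) h3 p).trans
      ((add_add_pow_succ_le (by positivity) (by positivity) (by positivity) n).trans (le_of_eq ?_))
    rw [← hp]
    simp only [mul_pow, ← pow_mul]
  have i1 := fun k => integrable_norm_pow_stdGaussian (d := d) k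
  set W : ℝ := (((m : ℝ) + 2) * p + d) ^ (((m : ℝ) + 2) * p / 2) with hW
  set A : ℝ := (2 * (p : ℝ) + d) ^ p with hAd
  have hA : ∫ u : 𝔼, ‖u‖ ^ (2 * p) ∂stdGaussian 𝔼 ≤ A := by
    refine (integral_norm_pow_two_mul_stdGaussian_le hd p).trans ?_
    rw [hAd]
    gcongr
    have : (0 : ℝ) ≤ p := Nat.cast_nonneg p
    linarith
  have hM : ∫ u : 𝔼, ‖u‖ ^ ((m + 2) * p) ∂stdGaussian 𝔼 ≤ W := by
    have := integral_norm_pow_stdGaussian_le hd ((m + 2) * p)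
    push_cast at this
    exact this
  have hAW : A ≤ W := by
    rw [hAd, hW, ← Real.rpow_natCast]
    have hm : (0 : ℝ) ≤ (m : ℝ) := Nat.cast_nonneg m
    have hp0 : (0 : ℝ) ≤ p := Nat.cast_nonneg p
    have h2 : (2 : ℝ) * p ≤ ((m : ℝ) + 2) * p := by nlinarith
    refine (Real.rpow_le_rpow (by positivity) (by linarith) hp0).trans
      (Real.rpow_le_rpow_of_exponent_le ?_ (by linarith))
    nlinarith
  have hint : ∫ u, ‖zoDirection f σ x u‖ ^ p ∂stdGaussian 𝔼 ≤
      3 ^ n * ((ρ * ‖x‖ ^ m) ^ p * W + R₂ ^ p * A + ρ ^ p * W) := by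
    have i12 : Integrable (fun u : 𝔼 => (ρ * ‖x‖ ^ m) ^ p * ‖u‖ ^ (2 * p) +
        R₂ ^ p * ‖u‖ ^ (2 * p)) (stdGaussian 𝔼) := ((i1 _).const_mul _).add ((i1 _).const_mul _)
    refine (integral_mono (hf.integrable_zoDirection_norm_pow x hσ p)
      ((i12.add ((i1 _).const_mul _)).const_mul _) hpt).trans ?_
    rw [integral_const_mul]
    simp only [Pi.add_apply]
    rw [integral_add i12 ((i1 _).const_mul _), integral_add ((i1 _).const_mul _)
      ((i1 _).const_mul _), integral_const_mul, integral_const_mul, integral_const_mul]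
    have := hA.trans hAW
    gcongr
  refine hint.trans ?_
  have hH : breveH R₁ R₂ m d p = 3 ^ n * (R₂ ^ p * A + ρ ^ p * W) := by
    unfold breveH
    rw [if_pos (by omega), hρd, splitCoeff, mul_pow, ← zpow_natCast ((2 : ℝ) ^ _), ← zpow_mul]
    rfl
  rw [hH, mul_pow]
  have h1 : 0 ≤ 3 ^ n * (R₂ ^ p * A) * (‖x‖ ^ m) ^ p := by positivity
  nlinarith

lemma ciInf_le_gaussianSmoothing (hf : IsSPBWith f R₁ R₂ m) (hbdd : BddBelow (Set.range f))
    (x : 𝔼) {σ : ℝ} (hσ : 0 < σ) : ⨅ y, f y ≤ gaussianSmoothing f σ x := by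
  have h := integral_mono (integrable_const (⨅ y, f y)) (hf.integrable_shift x hσ.le)
    (μ := stdGaussian 𝔼) fun u => ciInf_le hbdd (x + σ • u)
  simpa [gaussianSmoothing] using h

lemma gaussianSmoothing_le (hf : IsSPBWith f R₁ R₂ m) (hd : 1 ≤ d) (x : 𝔼) {σ : ℝ} (hσ : 0 < σ)
    (hσ1 : σ ≤ 1) : gaussianSmoothing f σ x ≤ f x + breveM R₁ R₂ m d x := by
  have hρ := hf.splitCoeff_nonneg
  have hR₂ := hf.R₂_pos
  set ρ := splitCoeff R₁ m with hρd
  have hpt : ∀ u : 𝔼, f (x + σ • u) ≤ f x + ((ρ * ‖x‖ ^ m + R₂) * ‖u‖ + ρ * ‖u‖ ^ (m + 1)) := by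
    intro u
    have h1 := (le_abs_self _).trans (hf.abs_shift_sub_le x u hσ.le)
    have h2 : (ρ * ‖x‖ ^ m + R₂) * (σ * ‖u‖) ≤ (ρ * ‖x‖ ^ m + R₂) * ‖u‖ := by
      gcongr
      exact mul_le_of_le_one_left (norm_nonneg u) hσ1
    have h3 : ρ * σ ^ (m + 1) * ‖u‖ ^ (m + 1) ≤ ρ * ‖u‖ ^ (m + 1) := by
      have : σ ^ (m + 1) ≤ 1 := pow_le_one₀ hσ.le hσ1
      gcongr
      exact mul_le_of_le_one_right hρ this
    linarith
  have hi := integrable_shift_bound (d := d) (ρ * ‖x‖ ^ m + R₂) ρ (m + 1)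
  unfold gaussianSmoothing
  refine (integral_mono (hf.integrable_shift x hσ.le) ((integrable_const (f x)).add hi)
    hpt).trans ?_
  simp only [Pi.add_apply]
  rw [integral_add (integrable_const _) hi, integral_add (integrable_norm_stdGaussian.const_mul _)
    ((integrable_norm_pow_stdGaussian _).const_mul _), integral_const_mul, integral_const_mul]
  simp only [integral_const, probReal_univ, smul_eq_mul, one_mul]
  have := integral_norm_stdGaussian_le hd
  have := integral_norm_pow_add_one_stdGaussian_le hd m
  unfold breveM
  change f x + ((ρ * ‖x‖ ^ m + R₂) * _ + ρ * _) ≤ f x + ((ρ * ‖x‖ ^ m + R₂) * _ + ρ * _)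
  gcongr

lemma stronglyMeasurable_smoothedGradient (hf : IsSPBWith f R₁ R₂ m) (σ : ℝ) :
    StronglyMeasurable (smoothedGradient f σ) := by
  have hc := (hf.continuous_zoDirection σ).stronglyMeasurable
  exact hc.integral_prod_right'

lemma measurable_gaussianSmoothing (hf : IsSPBWith f R₁ R₂ m) (σ : ℝ) :
    Measurable (gaussianSmoothing f σ) := by
  have hc := hf.continuous
  have : StronglyMeasurable fun p : 𝔼 × 𝔼 => f (p.1 + σ • p.2) :=
    (by fun_prop : Continuous fun p : 𝔼 × 𝔼 => f (p.1 + σ • p.2)).stronglyMeasurable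
  exact this.integral_prod_right'.measurable

/-- One step of the algorithm decreases the expected smoothing by the squared norm of its gradient,
up to an error of second order in the step size. Stated for extended nonnegative integrals, so that
no integrability of the iterates has to be known in advance. -/
lemma lintegral_gaussianSmoothing_step (hf : IsSPBWith f R₁ R₂ m) (hd : 1 ≤ d)
    (hbdd : BddBelow (Set.range f)) (x : 𝔼) {σ τ : ℝ} (hσ : 0 < σ) (hσ1 : σ ≤ 1)
    (hτ : 0 < τ) (hτ1 : τ ≤ 1) :
    ∫⁻ u, ENNReal.ofReal (gaussianSmoothing f σ
        (x - (τ / (‖x‖ ^ (2 * m) + 1)) • zoDirection f σ x u) - ⨅ y, f y) ∂stdGaussian 𝔼 +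
      ENNReal.ofReal (τ * (‖smoothedGradient f σ x‖ ^ 2 / (‖x‖ ^ (2 * m) + 1))) ≤
    ENNReal.ofReal (gaussianSmoothing f σ x - ⨅ y, f y) +
      ENNReal.ofReal (τ ^ 2 / σ * descentConst R₁ R₂ m d) := by
  have hρ := hf.splitCoeff_nonneg
  have hρ₂ := hf.splitCoeffTwo_nonneg
  have hR₂ := hf.R₂_pos
  have hH := fun p => breveH_nonneg hf.R₁_nonneg hR₂.le m d p
  set D := ‖x‖ ^ (2 * m) + 1 with hD
  have hD1 : 1 ≤ D := by rw [hD]; linarith [pow_nonneg (norm_nonneg x) (2 * m)]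
  have hD0 : 0 < D := by linarith
  set α := τ / D with hα
  have hα0 : 0 < α := by positivity
  set a := ‖x‖ ^ m with ha
  have ha0 : 0 ≤ a := by positivity
  have haD : D = 1 + a ^ 2 := by rw [hD, ha, ← pow_mul, mul_comm m 2]; ring
  set Γ := ((m : ℝ) + 1 + d) ^ (((m : ℝ) + 1) / 2) with hΓ
  have hΓ0 : 0 ≤ Γ := by positivity
  set g := smoothedGradient f σ x with hg
  set A := (1 / 2) * ((splitCoeffTwo R₁ m * a + R₂) * √(d : ℝ) + splitCoeffTwo R₁ m * Γ) with hA
  set B := splitCoeff R₁ m * √(d : ℝ) * ((m : ℝ) + 2)⁻¹ with hB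
  have hA0 : 0 ≤ A := by positivity
  have hB0 : 0 ≤ B := by positivity
  set c := ⨅ y, f y with hc
  set v := fun u : 𝔼 => zoDirection f σ x u with hv
  set rhs := fun u : 𝔼 => gaussianSmoothing f σ x - c - α * inner ℝ g (v u) +
    (1 / σ) * (A * α ^ 2 * ‖v u‖ ^ 2 + B * α ^ (m + 2) * ‖v u‖ ^ (m + 2)) with hrhs
  have hle : ∀ u, gaussianSmoothing f σ (x - α • v u) - c ≤ rhs u := by
    intro u
    have h1 := hf.gaussianSmoothing_add_le hd x (-(α • v u)) hσ hσ1
    rw [← sub_eq_add_neg, inner_neg_right, real_inner_smul_right, norm_neg, norm_smul,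
      Real.norm_of_nonneg hα0.le, mul_pow, mul_pow] at h1
    rw [← mul_assoc, ← mul_assoc (splitCoeff R₁ m * √(d : ℝ) * ((m : ℝ) + 2)⁻¹)] at h1
    simp only [hrhs, hA, hB, ha, hΓ]
    linarith
  have h0 : ∀ u, 0 ≤ rhs u := fun u =>
    (sub_nonneg.2 (hf.ciInf_le_gaussianSmoothing hbdd _ hσ)).trans (hle u)
  have iv := hf.integrable_zoDirection x hσ
  have i0 : Integrable (fun u => gaussianSmoothing f σ x - c - α * inner ℝ g (v u))
      (stdGaussian 𝔼) := (integrable_const _).sub ((iv.const_inner g).const_mul α)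
  have i2 := (hf.integrable_zoDirection_norm_pow x hσ 2).const_mul (A * α ^ 2)
  have i3 := (hf.integrable_zoDirection_norm_pow x hσ (m + 2)).const_mul (B * α ^ (m + 2))
  have i23 : Integrable (fun u => (1 / σ) * (A * α ^ 2 * ‖v u‖ ^ 2 +
      B * α ^ (m + 2) * ‖v u‖ ^ (m + 2))) (stdGaussian 𝔼) := (i2.add i3).const_mul (1 / σ)
  have irhs : Integrable rhs (stdGaussian 𝔼) := i0.add i23
  have hrint : ∫ u, rhs u ∂stdGaussian 𝔼 = gaussianSmoothing f σ x - c - α * ‖g‖ ^ 2 +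
      (1 / σ) * (A * α ^ 2 * ∫ u, ‖v u‖ ^ 2 ∂stdGaussian 𝔼 +
        B * α ^ (m + 2) * ∫ u, ‖v u‖ ^ (m + 2) ∂stdGaussian 𝔼) := by
    simp only [hrhs]
    rw [integral_add i0 i23, integral_const_mul, integral_add i2 i3,
      integral_const_mul, integral_const_mul, integral_sub (integrable_const _)
      ((iv.const_inner g).const_mul α), integral_const_mul, integral_inner iv]
    simp only [integral_const, probReal_univ, smul_eq_mul, one_mul]
    rw [← real_inner_self_eq_norm_sq]
    rfl
  -- dividing the step by `D` compensates the growth in `x` of the moments of the direction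
  have m2 : α ^ 2 * ∫ u, ‖v u‖ ^ 2 ∂stdGaussian 𝔼 ≤ τ ^ 2 * breveH R₁ R₂ m d 2 / D := by
    have h1 := hf.integral_norm_zoDirection_pow_le hd x hσ hσ1 1
    rw [← ha, ← haD] at h1
    calc _ ≤ α ^ 2 * (breveH R₁ R₂ m d 2 * D) := by gcongr
      _ = _ := by rw [hα]; field_simp
  have mm : α ^ (m + 2) * ∫ u, ‖v u‖ ^ (m + 2) ∂stdGaussian 𝔼 ≤
      τ ^ 2 * breveH R₁ R₂ m d (m + 2) := by
    have h1 := hf.integral_norm_zoDirection_pow_le hd x hσ hσ1 (m + 1)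
    rw [← ha] at h1
    have h2 := one_add_pow_le_one_add_sq_pow ha0 m
    rw [← haD] at h2
    have h3 : τ ^ (m + 2) ≤ τ ^ 2 := pow_le_pow_of_le_one hτ.le hτ1 (by omega)
    calc _ ≤ α ^ (m + 2) * (breveH R₁ R₂ m d (m + 2) * D ^ (m + 2)) := by
          have := hH (m + 2)
          refine mul_le_mul_of_nonneg_left (h1.trans ?_) (by positivity)
          exact mul_le_mul_of_nonneg_left h2 this
      _ = τ ^ (m + 2) * breveH R₁ R₂ m d (m + 2) := by
          rw [hα, div_pow]; field_simp
      _ ≤ _ := mul_le_mul_of_nonneg_right h3 (hH _)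
  -- the factor `D⁻¹` left over in `m2` compensates the growth of the coefficient `A` in `x`
  have hAD : A / D ≤ (1 / 2) * ((splitCoeffTwo R₁ m + R₂) * √(d : ℝ) + splitCoeffTwo R₁ m * Γ) := by
    rw [div_le_iff₀ hD0, hA, mul_assoc]
    refine mul_le_mul_of_nonneg_left ?_ (by norm_num)
    have haD' : a ≤ D := by rw [haD]; nlinarith [sq_nonneg (a - 1)]
    have s1 : splitCoeffTwo R₁ m * a * √(d : ℝ) ≤ splitCoeffTwo R₁ m * D * √(d : ℝ) := by gcongr
    have s2 : R₂ * √(d : ℝ) ≤ R₂ * √(d : ℝ) * D := le_mul_of_one_le_right (by positivity) hD1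
    have s3 : splitCoeffTwo R₁ m * Γ ≤ splitCoeffTwo R₁ m * Γ * D :=
      le_mul_of_one_le_right (by positivity) hD1
    linarith
  have hfinal : A * α ^ 2 * ∫ u, ‖v u‖ ^ 2 ∂stdGaussian 𝔼 +
        B * α ^ (m + 2) * ∫ u, ‖v u‖ ^ (m + 2) ∂stdGaussian 𝔼 ≤
      τ ^ 2 * descentConst R₁ R₂ m d := by
    have s1 : A * α ^ 2 * ∫ u, ‖v u‖ ^ 2 ∂stdGaussian 𝔼 ≤ τ ^ 2 * breveH R₁ R₂ m d 2 * (A / D) := by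
      have := mul_le_mul_of_nonneg_left m2 hA0
      rw [mul_assoc]
      refine this.trans (le_of_eq (by ring))
    have s2 := mul_le_mul_of_nonneg_left hAD
      (mul_nonneg (sq_nonneg τ) (hH 2))
    have s3 : B * α ^ (m + 2) * ∫ u, ‖v u‖ ^ (m + 2) ∂stdGaussian 𝔼 ≤
        B * (τ ^ 2 * breveH R₁ R₂ m d (m + 2)) := by
      rw [mul_assoc]
      exact mul_le_mul_of_nonneg_left mm hB0
    refine (add_le_add (s1.trans s2) s3).trans (le_of_eq ?_)
    rw [descentConst, hB]
    ring
  calc _ ≤ ∫⁻ u, ENNReal.ofReal (rhs u) ∂stdGaussian 𝔼 + ENNReal.ofReal (τ * (‖g‖ ^ 2 / D)) := by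
        gcongr with u
        exact hle u
    _ = ENNReal.ofReal (∫ u, rhs u ∂stdGaussian 𝔼 + τ * (‖g‖ ^ 2 / D)) := by
        rw [← ofReal_integral_eq_lintegral_ofReal irhs (ae_of_all _ h0),
          ENNReal.ofReal_add (integral_nonneg h0) (by positivity)]
    _ ≤ ENNReal.ofReal (gaussianSmoothing f σ x - c + τ ^ 2 / σ * descentConst R₁ R₂ m d) := by
        refine ENNReal.ofReal_le_ofReal ?_
        rw [hrint]
        have h1 := mul_le_mul_of_nonneg_left hfinal (by positivity : 0 ≤ 1 / σ)
        have h2 : τ * (‖g‖ ^ 2 / D) = α * ‖g‖ ^ 2 := by rw [hα]; ring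
        rw [h2]
        have h3 : τ ^ 2 / σ * descentConst R₁ R₂ m d =
          1 / σ * (τ ^ 2 * descentConst R₁ R₂ m d) := by ring
        rw [h3]
        linarith
    _ ≤ _ := ENNReal.ofReal_add_le

end IsSPBWith

/-! ### The smoothed gradient and the Goldstein subdifferential -/

lemma measureReal_compl_closedBall_stdGaussian_le (r : ℝ) (hr : 0 < r) (k : ℕ) :
    (stdGaussian 𝔼).real (Metric.closedBall 0 r)ᶜ ≤
      (∫ u : 𝔼, ‖u‖ ^ k ∂stdGaussian 𝔼) / r ^ k := by
  have h := mul_meas_ge_le_integral_of_nonneg (μ := stdGaussian 𝔼) (f := fun u : 𝔼 => ‖u‖ ^ k)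
    (ae_of_all _ fun u => by positivity) (integrable_norm_pow_stdGaussian k) (r ^ k)
  rw [le_div_iff₀ (by positivity), mul_comm]
  refine le_trans ?_ h
  refine mul_le_mul_of_nonneg_left (measureReal_mono ?_) (by positivity)
  intro u hu
  have hu' : r < ‖u‖ := by simpa using hu
  exact pow_le_pow_left₀ hr.le hu'.le k

namespace IsSPBWith

variable {f : EuclideanSpace ℝ (Fin d) → ℝ} {R₁ R₂ : ℝ} {m : ℕ}

/-- The Gaussian average of the gradient over the perturbations of norm at most `δ`, renormalized,
lies in the closure of the Goldstein `δ`-subdifferential; the rest of the average is a tail. -/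
lemma infDist_goldsteinSubdiff_le_tail (hf : IsSPBWith f R₁ R₂ m) (x : 𝔼) {σ δ q : ℝ} (hσ : 0 < σ)
    (hq : (stdGaussian 𝔼).real (Metric.closedBall 0 (δ / σ))ᶜ = q) (hq1 : q < 1) :
    Metric.infDist 0 (goldsteinSubdiff f δ x) ≤ (1 - q)⁻¹ * (‖smoothedGradient f σ x‖ +
      ((splitCoeff R₁ m * ‖x‖ ^ m + R₂) * q +
        splitCoeff R₁ m * σ ^ m * ∫ u : 𝔼, ‖u‖ ^ m ∂stdGaussian 𝔼)) := by
  have hρ := hf.splitCoeff_nonneg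
  set S : Set 𝔼 := Metric.closedBall 0 (δ / σ) with hS
  have hSm : MeasurableSet S := measurableSet_closedBall
  have hSr : (stdGaussian 𝔼).real S = 1 - q := by
    rw [← hq, probReal_compl_eq_one_sub hSm]; ring
  have hS0 : stdGaussian 𝔼 S ≠ 0 := by
    intro h0
    rw [measureReal_def, h0] at hSr
    simp at hSr
    linarith
  set G := fun u : 𝔼 => gradient f (x + σ • u) with hG
  have hGi : Integrable G (stdGaussian 𝔼) := hf.integrable_gradient_shift x hσ
  have hmem : ∀ᵐ u ∂(stdGaussian 𝔼).restrict S, G u ∈ goldsteinSubdiff f δ x := by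
    refine (ae_restrict_iff' hSm).2 ?_
    filter_upwards [ae_stdGaussian_add_smul hf.ae_differentiableAt x hσ.ne'] with u hu hus
    refine clarkeSubdiff_subset_goldsteinSubdiff f (y := x + σ • u) ?_
      (gradient_mem_clarkeSubdiff hf.locallyLipschitz hu)
    rw [hS, mem_closedBall_zero_iff, le_div_iff₀ hσ] at hus
    rw [mem_closedBall_iff_norm, add_sub_cancel_left, norm_smul, Real.norm_of_nonneg hσ.le]
    linarith
  have havg := (convex_convexHull ℝ _ : Convex ℝ (goldsteinSubdiff f δ x)).set_average_mem_closure
    hS0 (measure_ne_top _ _) hmem hGi.integrableOn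
  rw [← Metric.infDist_closure]
  refine (Metric.infDist_le_dist_of_mem havg).trans ?_
  rw [dist_zero_left, setAverage_eq, hSr, norm_smul, norm_inv,
    Real.norm_of_nonneg (by linarith : 0 ≤ 1 - q)]
  refine mul_le_mul_of_nonneg_left ?_ (inv_nonneg.2 (by linarith))
  have hsplit := integral_add_compl hSm hGi
  rw [hG, ← hf.smoothedGradient_eq_integral_gradient x hσ] at hsplit
  have hb : Integrable (fun u : 𝔼 => (splitCoeff R₁ m * ‖x‖ ^ m + R₂) +
      splitCoeff R₁ m * σ ^ m * ‖u‖ ^ m) (stdGaussian 𝔼) :=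
    (integrable_const _).add ((integrable_norm_pow_stdGaussian m).const_mul _)
  have htail : ‖∫ u in Sᶜ, G u ∂stdGaussian 𝔼‖ ≤ (splitCoeff R₁ m * ‖x‖ ^ m + R₂) * q +
        splitCoeff R₁ m * σ ^ m * ∫ u : 𝔼, ‖u‖ ^ m ∂stdGaussian 𝔼 := by
    refine (norm_integral_le_of_norm_le hb.integrableOn
      (ae_restrict_of_ae (hf.norm_gradient_shift_le x hσ))).trans ?_
    rw [integral_add (integrable_const _)
      ((integrable_norm_pow_stdGaussian m).const_mul _).integrableOn, integral_const_mul]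
    simp only [integral_const, smul_eq_mul, measureReal_restrict_apply_univ, hq]
    rw [mul_comm q]
    have : ∫ u in Sᶜ, ‖u‖ ^ m ∂stdGaussian 𝔼 ≤ ∫ u : 𝔼, ‖u‖ ^ m ∂stdGaussian 𝔼 :=
      setIntegral_le_integral (integrable_norm_pow_stdGaussian m)
        (ae_of_all _ fun u => by positivity)
    gcongr
  have e : ∫ u in S, G u ∂stdGaussian 𝔼 =
      smoothedGradient f σ x - ∫ u in Sᶜ, G u ∂stdGaussian 𝔼 := by
    rw [← hsplit]; simp [hG]
  rw [e]
  exact (norm_sub_le _ _).trans (by linarith)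

lemma constP_ge (hf : IsSPBWith f R₁ R₂ m) (hd : 1 ≤ d) :
    4 * (splitCoeff R₁ m + R₂) ≤ constP R₁ R₂ m d := by
  have hρ := hf.splitCoeff_nonneg
  have h2 : (2 : ℝ) ^ (m + 1) * R₁ = 4 * splitCoeff R₁ m := by
    unfold splitCoeff
    rw [zpow_sub₀ two_ne_zero, zpow_natCast, pow_succ]
    norm_num
    ring
  unfold constP
  rw [h2]
  have h1 : (1 : ℝ) ≤ ((m : ℝ) + d) ^ ((m : ℝ) / 2) := by
    have : (1 : ℝ) ≤ d := by exact_mod_cast hd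
    have hm : (0 : ℝ) ≤ m := Nat.cast_nonneg m
    exact Real.one_le_rpow (by linarith) (by positivity)
  nlinarith

/-- The tail estimate for the smoothing parameters of the algorithm. The tail probability `q` of
`‖u‖ > δ/σ` is bounded by Markov's inequality with the second moment, which gives `q ≤ 1/5`, and
with the moment of order `d`, which gives `q ≤ (σ √(dπe) / δ)^d ≤ η^d / 𝒫`. -/
lemma infDist_goldsteinSubdiff_le (hf : IsSPBWith f R₁ R₂ m) (hd : 1 ≤ d) (x : 𝔼) {σ δ η : ℝ}
    {n : ℕ} (hσ : 0 < σ) (hδ : 0 < δ) (hη0 : 0 ≤ η) (hη1 : η ≤ 1) (hnd : n ≤ d)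
    (hη : η ^ n ≤ 5 * R₂) (hσ₂ : σ ≤ constKappa₂ R₁ R₂ m d δ * η)
    (hσ₁ : splitCoeff R₁ m * ((m : ℝ) + d) ^ ((m : ℝ) / 2) * σ ^ m ≤ η ^ n / 4) :
    Metric.infDist 0 (goldsteinSubdiff f δ x) ≤
      5 / 4 * ‖smoothedGradient f σ x‖ + 5 / 16 * (2 + ‖x‖ ^ m) * η ^ n := by
  have hρ := hf.splitCoeff_nonneg
  have hR₂ := hf.R₂_pos
  have hd1 : (1 : ℝ) ≤ d := by exact_mod_cast hd
  have hd0 : d ≠ 0 := by omega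
  have hP4 := hf.constP_ge hd
  set Q := constP R₁ R₂ m d with hQ
  have hP0 : 0 < Q := by linarith
  have hπe : (17 / 2 : ℝ) ≤ Real.pi * Real.exp 1 := by
    have h1 := Real.pi_gt_d2
    have h2 := Real.exp_one_gt_d9
    nlinarith
  set r := δ / σ with hr
  have hr0 : 0 < r := by positivity
  set w := √((d : ℝ) * Real.pi * Real.exp 1) with hw
  have hw2 : w ^ 2 = d * (Real.pi * Real.exp 1) := by
    rw [hw, Real.sq_sqrt (by positivity)]; ring
  have hw0 : 0 < w := by rw [hw]; positivity
  set y := w / r with hy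
  have hy0 : 0 < y := by positivity
  have hys : Q * y ^ d ≤ η ^ d := by
    have h1 : y ≤ Q ^ (-(1 / (d : ℝ))) * η := by
      rw [hy, hr, div_div_eq_mul_div, div_le_iff₀ hδ]
      have h2 := mul_le_mul_of_nonneg_left hσ₂ hw0.le
      refine h2.trans (le_of_eq ?_)
      rw [constKappa₂, ← hw, ← hQ]
      field_simp
    have h3 : y ^ d ≤ Q⁻¹ * η ^ d := by
      refine (pow_le_pow_left₀ hy0.le h1 d).trans (le_of_eq ?_)
      rw [mul_pow, ← Real.rpow_natCast (Q ^ _), ← Real.rpow_mul hP0.le,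
        show -(1 / (d : ℝ)) * (d : ℝ) = -1 by field_simp, Real.rpow_neg_one]
    calc Q * y ^ d ≤ Q * (Q⁻¹ * η ^ d) := by gcongr
      _ = _ := by field_simp
  have hηdn : η ^ d ≤ η ^ n := pow_le_pow_of_le_one hη0 hη1 hnd
  -- `4 R₂ y ^ d ≤ 𝒫 y ^ d ≤ η ^ n ≤ 5 R₂`
  have hy54 : y ≤ 5 / 4 := by
    by_contra! hlt
    have h1 : y ≤ y ^ d := le_self_pow₀ (by linarith) hd0
    nlinarith
  obtain ⟨q, hq⟩ : ∃ q, (stdGaussian 𝔼).real (Metric.closedBall 0 r)ᶜ = q := ⟨_, rfl⟩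
  have hq0 : 0 ≤ q := hq ▸ measureReal_nonneg
  have hq5 : q ≤ 1 / 5 := by
    have h1 := measureReal_compl_closedBall_stdGaussian_le (d := d) r hr0 2
    rw [hq, integral_norm_sq_stdGaussian hd] at h1
    have h2 : (d : ℝ) / r ^ 2 * (Real.pi * Real.exp 1) = y ^ 2 := by
      rw [hy, div_pow w r, hw2]; ring
    have h3 : y ^ 2 ≤ 25 / 16 := by nlinarith
    have h4 : 0 ≤ (d : ℝ) / r ^ 2 := by positivity
    nlinarith
  have hqy : q ≤ y ^ d := by
    have h1 := measureReal_compl_closedBall_stdGaussian_le (d := d) r hr0 d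
    rw [hq] at h1
    refine h1.trans ?_
    rw [hy, div_pow w r]
    gcongr
    refine (integral_norm_pow_stdGaussian_le hd d).trans ?_
    have h2 : w ^ d = (w ^ 2) ^ ((d : ℝ) / 2) := by
      rw [← Real.rpow_natCast w 2, ← Real.rpow_mul hw0.le, ← Real.rpow_natCast]
      congr 1
      push_cast
      ring
    rw [h2, hw2]
    refine Real.rpow_le_rpow (by positivity) ?_ (by positivity)
    nlinarith
  have hPq : Q * q ≤ η ^ n := (mul_le_mul_of_nonneg_left hqy hP0.le).trans (hys.trans hηdn)
  have hmain := hf.infDist_goldsteinSubdiff_le_tail x hσ hq (by linarith)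
  have ha0 : 0 ≤ ‖x‖ ^ m := by positivity
  have t1 : (splitCoeff R₁ m * ‖x‖ ^ m + R₂) * q ≤ (1 + ‖x‖ ^ m) * (η ^ n / 4) := by
    have h1 : splitCoeff R₁ m * ‖x‖ ^ m + R₂ ≤ (1 + ‖x‖ ^ m) * (Q / 4) := by
      nlinarith [mul_nonneg hρ ha0, mul_nonneg hR₂.le ha0,
        mul_le_mul_of_nonneg_right hP4 ha0]
    have h2 := mul_le_mul_of_nonneg_right h1 hq0
    have h3 := mul_le_mul_of_nonneg_left hPq (by positivity : 0 ≤ (1 + ‖x‖ ^ m) / 4)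
    linarith
  have t2 : splitCoeff R₁ m * σ ^ m * ∫ u : 𝔼, ‖u‖ ^ m ∂stdGaussian 𝔼 ≤ η ^ n / 4 := by
    refine le_trans ?_ hσ₁
    have := integral_norm_pow_stdGaussian_le hd m
    calc _ ≤ splitCoeff R₁ m * σ ^ m * ((m : ℝ) + d) ^ ((m : ℝ) / 2) := by gcongr
      _ = _ := by ring
  have hinv : (1 - q)⁻¹ ≤ 5 / 4 := by
    rw [inv_le_comm₀ (by linarith) (by norm_num)]
    linarith
  have hg := norm_nonneg (smoothedGradient f σ x)
  have hηn : 0 ≤ η ^ n := by positivity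
  calc _ ≤ _ := hmain
    _ ≤ (1 - q)⁻¹ * (‖smoothedGradient f σ x‖ +
        ((1 + ‖x‖ ^ m) * (η ^ n / 4) + η ^ n / 4)) := by
      have : 0 ≤ (1 - q)⁻¹ := inv_nonneg.2 (by linarith)
      gcongr
    _ ≤ 5 / 4 * (‖smoothedGradient f σ x‖ +
        ((1 + ‖x‖ ^ m) * (η ^ n / 4) + η ^ n / 4)) := by gcongr
    _ = _ := by ring

end IsSPBWith

/-! ### The iterates as a stochastic process -/

lemma zoIterate_congr (f : 𝔼 → ℝ) (m : ℕ) (σ : ℝ) (τ : ℕ → ℝ) (x₀ : 𝔼) {u u' : ℕ → 𝔼} (k : ℕ)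
    (h : ∀ j < k, u j = u' j) : zoIterate f m σ τ x₀ u k = zoIterate f m σ τ x₀ u' k := by
  induction k with
  | zero => rfl
  | succ k ih =>
    simp only [zoIterate]
    rw [ih fun j hj => h j (by omega), h k (by omega)]

lemma measurable_zoIterate {f : 𝔼 → ℝ} (hf : Continuous f) (m : ℕ) (σ : ℝ) (τ : ℕ → ℝ) (x₀ : 𝔼)
    (k : ℕ) : Measurable fun u : ℕ → 𝔼 => zoIterate f m σ τ x₀ u k := by
  induction k with
  | zero => exact measurable_const
  | succ k ih =>
    have hfm := hf.measurable
    have hk : Measurable fun u : ℕ → 𝔼 => u k := measurable_pi_apply k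
    have step : ∀ z : (ℕ → 𝔼) → 𝔼, Measurable z → Measurable fun u =>
        z u - (τ k / (‖z u‖ ^ (2 * m) + 1)) • zoDirection f σ (z u) (u k) := by
      intro z hz
      unfold zoDirection
      fun_prop
    exact step _ ih

/-- The `k`-th iterate is a function of the first `k` directions, hence independent of the next. -/
lemma indepFun_zoIterate {f : 𝔼 → ℝ} (hf : Continuous f) (m : ℕ) (σ : ℝ) (τ : ℕ → ℝ) (x₀ : 𝔼)
    {Ω : Type*} [MeasurableSpace Ω] {P : Measure Ω} [IsProbabilityMeasure P] {u : ℕ → Ω → 𝔼}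
    (hu_meas : ∀ k, Measurable (u k)) (hu_indep : iIndepFun u P) (k : ℕ) :
    IndepFun (fun ω => zoIterate f m σ τ x₀ (fun j => u j ω) k) (u k) P := by
  classical
  have h := hu_indep.indepFun_finset (Finset.range k) {k} (by simp) hu_meas
  set Φ : ((j : Finset.range k) → 𝔼) → 𝔼 := fun w =>
    zoIterate f m σ τ x₀ (fun j => if hj : j ∈ Finset.range k then w ⟨j, hj⟩ else 0) k with hΦ
  have hΦm : Measurable Φ := by
    refine (measurable_zoIterate hf m σ τ x₀ k).comp (measurable_pi_lambda _ fun j => ?_)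
    by_cases hj : j ∈ Finset.range k
    · simp only [hj, dite_true]
      exact measurable_pi_apply _
    · simp only [hj, dite_false]
      exact measurable_const
  set Ψ : ((j : ({k} : Finset ℕ)) → 𝔼) → 𝔼 := fun w => w ⟨k, by simp⟩
  have hΨm : Measurable Ψ := measurable_pi_apply _
  have h2 := h.comp hΦm hΨm
  have e : (fun ω => zoIterate f m σ τ x₀ (fun j => u j ω) k) =
      Φ ∘ fun a (i : Finset.range k) => u i a := by
    funext ω
    simp only [hΦ, Function.comp]
    refine zoIterate_congr f m σ τ x₀ k fun j hj => ?_
    rw [dif_pos (Finset.mem_range.2 hj)]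
  rw [e]
  exact h2

namespace IsSPBWith

variable {f : EuclideanSpace ℝ (Fin d) → ℝ} {R₁ R₂ : ℝ} {m : ℕ}

/-- The one-step descent inequality in expectation along the iterates: since the `k`-th iterate and
the `k`-th direction are independent, the inequality at a fixed point can be integrated against the
law of the iterate. -/
lemma lintegral_step (hf : IsSPBWith f R₁ R₂ m) (hd : 1 ≤ d)
    (hbdd : BddBelow (Set.range f)) {σ : ℝ} {τ : ℕ → ℝ} (hσ : 0 < σ) (hσ1 : σ ≤ 1) (x₀ : 𝔼)
    {Ω : Type*} [MeasurableSpace Ω] {P : Measure Ω} [IsProbabilityMeasure P] {u : ℕ → Ω → 𝔼}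
    (hu_meas : ∀ k, Measurable (u k)) (hu_law : ∀ k, P.map (u k) = stdGaussian 𝔼)
    (hu_indep : iIndepFun u P) {x : ℕ → Ω → 𝔼}
    (hx : ∀ k ω, x k ω = zoIterate f m σ τ x₀ (fun j => u j ω) k) (k : ℕ)
    (hτ : 0 < τ k) (hτ1 : τ k ≤ 1) :
    ∫⁻ ω, ENNReal.ofReal (gaussianSmoothing f σ (x (k + 1) ω) - ⨅ y, f y) ∂P +
      ENNReal.ofReal (τ k) * ∫⁻ ω, ENNReal.ofReal
        (‖smoothedGradient f σ (x k ω)‖ ^ 2 / (‖x k ω‖ ^ (2 * m) + 1)) ∂P ≤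
    ∫⁻ ω, ENNReal.ofReal (gaussianSmoothing f σ (x k ω) - ⨅ y, f y) ∂P +
      ENNReal.ofReal (τ k ^ 2 / σ * descentConst R₁ R₂ m d) := by
  have hxm : ∀ k, Measurable (x k) := fun k => by
    have : x k = fun ω => zoIterate f m σ τ x₀ (fun j => u j ω) k := funext (hx k)
    rw [this]
    exact (measurable_zoIterate hf.continuous m σ τ x₀ k).comp
      (measurable_pi_lambda _ fun j => hu_meas j)
  have hind : IndepFun (x k) (u k) P := by
    have : x k = fun ω => zoIterate f m σ τ x₀ (fun j => u j ω) k := funext (hx k)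
    rw [this]
    exact indepFun_zoIterate hf.continuous m σ τ x₀ hu_meas hu_indep k
  have hprod := (indepFun_iff_map_prod_eq_prod_map_map (hxm k).aemeasurable
    (hu_meas k).aemeasurable).1 hind
  rw [hu_law k] at hprod
  have hFm := hf.measurable_gaussianSmoothing σ
  have hgm := (hf.stronglyMeasurable_smoothedGradient σ).measurable
  set Z : 𝔼 × 𝔼 → ENNReal := fun p => ENNReal.ofReal (gaussianSmoothing f σ
    (p.1 - (τ k / (‖p.1‖ ^ (2 * m) + 1)) • zoDirection f σ p.1 p.2) - ⨅ y, f y) with hZ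
  have hZm : Measurable Z := by
    have h1 : Measurable fun p : 𝔼 × 𝔼 => zoDirection f σ p.1 p.2 :=
      (hf.continuous_zoDirection σ).measurable
    have h2 : Measurable fun p : 𝔼 × 𝔼 =>
        p.1 - (τ k / (‖p.1‖ ^ (2 * m) + 1)) • zoDirection f σ p.1 p.2 := by fun_prop
    exact ((hFm.comp h2).sub_const _).ennreal_ofReal
  have e1 : ∫⁻ ω, ENNReal.ofReal (gaussianSmoothing f σ (x (k + 1) ω) - ⨅ y, f y) ∂P =
      ∫⁻ y, ∫⁻ v, Z (y, v) ∂stdGaussian 𝔼 ∂(P.map (x k)) := by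
    rw [← lintegral_prod _ hZm.aemeasurable, ← hprod,
      lintegral_map hZm ((hxm k).prodMk (hu_meas k))]
    refine lintegral_congr fun ω => ?_
    simp only [hZ]
    rw [hx (k + 1), zoIterate, ← hx k]
  set Y : 𝔼 → ENNReal := fun y => ENNReal.ofReal
    (τ k * (‖smoothedGradient f σ y‖ ^ 2 / (‖y‖ ^ (2 * m) + 1))) with hY
  have hYm : Measurable Y := by
    have : Measurable fun y : 𝔼 =>
      τ k * (‖smoothedGradient f σ y‖ ^ 2 / (‖y‖ ^ (2 * m) + 1)) := by fun_prop
    exact this.ennreal_ofReal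
  have e2 : ENNReal.ofReal (τ k) * ∫⁻ ω, ENNReal.ofReal
        (‖smoothedGradient f σ (x k ω)‖ ^ 2 / (‖x k ω‖ ^ (2 * m) + 1)) ∂P =
      ∫⁻ y, Y y ∂(P.map (x k)) := by
    rw [lintegral_map hYm (hxm k), ← lintegral_const_mul']
    · refine lintegral_congr fun ω => ?_
      simp only [hY]
      rw [ENNReal.ofReal_mul hτ.le]
    · exact ENNReal.ofReal_ne_top
  have hXm : Measurable fun y : 𝔼 => ENNReal.ofReal (gaussianSmoothing f σ y - ⨅ y, f y) :=
    (hFm.sub_const _).ennreal_ofReal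
  have e3 : ∫⁻ ω, ENNReal.ofReal (gaussianSmoothing f σ (x k ω) - ⨅ y, f y) ∂P =
      ∫⁻ y, ENNReal.ofReal (gaussianSmoothing f σ y - ⨅ y, f y) ∂(P.map (x k)) := by
    rw [lintegral_map hXm (hxm k)]
  have : IsProbabilityMeasure (P.map (x k)) := Measure.isProbabilityMeasure_map (hxm k).aemeasurable
  rw [e1, e2, e3, ← lintegral_add_right _ hYm]
  calc _ ≤ ∫⁻ y, (ENNReal.ofReal (gaussianSmoothing f σ y - ⨅ y, f y) +
        ENNReal.ofReal (τ k ^ 2 / σ * descentConst R₁ R₂ m d)) ∂(P.map (x k)) :=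
      lintegral_mono fun y => hf.lintegral_gaussianSmoothing_step hd hbdd y hσ hσ1 hτ hτ1
    _ = _ := by
      rw [lintegral_add_right _ measurable_const, lintegral_const, measure_univ, mul_one]

/-- Telescoping the one-step descent inequality over all iterations. -/
lemma lintegral_add_sum_le (hf : IsSPBWith f R₁ R₂ m) (hd : 1 ≤ d)
    (hbdd : BddBelow (Set.range f)) {σ : ℝ} {τ : ℕ → ℝ} (hσ : 0 < σ) (hσ1 : σ ≤ 1) (x₀ : 𝔼)
    {T : ℕ} (hτ : ∀ k ≤ T, τ k = σ / √((T : ℝ) + 1))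
    {Ω : Type*} [MeasurableSpace Ω] {P : Measure Ω} [IsProbabilityMeasure P] {u : ℕ → Ω → 𝔼}
    (hu_meas : ∀ k, Measurable (u k)) (hu_law : ∀ k, P.map (u k) = stdGaussian 𝔼)
    (hu_indep : iIndepFun u P) {x : ℕ → Ω → 𝔼}
    (hx : ∀ k ω, x k ω = zoIterate f m σ τ x₀ (fun j => u j ω) k) {n : ℕ} (hn : n ≤ T + 1) :
    ∫⁻ ω, ENNReal.ofReal (gaussianSmoothing f σ (x n ω) - ⨅ y, f y) ∂P +
      ∑ k ∈ Finset.range n, ENNReal.ofReal (σ / √((T : ℝ) + 1)) * ∫⁻ ω, ENNReal.ofReal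
        (‖smoothedGradient f σ (x k ω)‖ ^ 2 / (‖x k ω‖ ^ (2 * m) + 1)) ∂P ≤
    ENNReal.ofReal (constK f R₁ R₂ m x₀) := by
  have hT : (1 : ℝ) ≤ √((T : ℝ) + 1) := by
    rw [Real.one_le_sqrt]; linarith [(Nat.cast_nonneg T : (0 : ℝ) ≤ T)]
  have hT0 : 0 < √((T : ℝ) + 1) := by linarith
  have hT2 : √((T : ℝ) + 1) ^ 2 = (T : ℝ) + 1 := Real.sq_sqrt (by positivity)
  set τ' := σ / √((T : ℝ) + 1) with hτ'
  have hτ0 : 0 < τ' := by positivity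
  have hτ1 : τ' ≤ 1 := by
    rw [hτ', div_le_one hT0]; linarith
  have hC : 0 ≤ descentConst R₁ R₂ m d := by
    have := hf.splitCoeff_nonneg
    have := hf.splitCoeffTwo_nonneg
    have := hf.R₂_pos
    have := fun p => breveH_nonneg hf.R₁_nonneg hf.R₂_pos.le m d p
    have h2 := this 2
    have hm2 := this (m + 2)
    unfold descentConst
    positivity
  have hstart : 0 ≤ f x₀ - (⨅ y, f y) + breveM R₁ R₂ m d x₀ := by
    have h1 := hf.gaussianSmoothing_le hd x₀ hσ hσ1
    have h2 := hf.ciInf_le_gaussianSmoothing hbdd x₀ hσ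
    linarith
  have hsum : ∀ n ≤ T + 1, ∫⁻ ω, ENNReal.ofReal (gaussianSmoothing f σ (x n ω) - ⨅ y, f y) ∂P +
      ∑ k ∈ Finset.range n, ENNReal.ofReal τ' * ∫⁻ ω, ENNReal.ofReal
        (‖smoothedGradient f σ (x k ω)‖ ^ 2 / (‖x k ω‖ ^ (2 * m) + 1)) ∂P ≤
      ENNReal.ofReal (f x₀ - (⨅ y, f y) + breveM R₁ R₂ m d x₀) +
        n * ENNReal.ofReal (τ' ^ 2 / σ * descentConst R₁ R₂ m d) := by
    intro n
    induction n with
    | zero =>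
      intro _
      have h1 := hf.gaussianSmoothing_le hd x₀ hσ hσ1
      simp only [hx, zoIterate, lintegral_const, measure_univ, mul_one, Finset.range_zero,
        Finset.sum_empty, add_zero, Nat.cast_zero, zero_mul]
      exact ENNReal.ofReal_le_ofReal (by linarith)
    | succ n ih =>
      intro hn
      have h1 := ih (by omega)
      have hτn : τ n = τ' := hτ n (by omega)
      have h2 := hf.lintegral_step hd hbdd hσ hσ1 x₀ hu_meas hu_law hu_indep hx n
        (by rw [hτn]; exact hτ0) (by rw [hτn]; exact hτ1)
      rw [hτn] at h2
      rw [Finset.sum_range_succ, add_comm (∑ k ∈ Finset.range n, _), ← add_assoc]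
      refine (add_le_add_left h2 _).trans ?_
      rw [add_right_comm]
      refine (add_le_add_left h1 _).trans (le_of_eq ?_)
      push_cast
      ring
  refine (hsum n hn).trans ?_
  have hn' : (n : ENNReal) ≤ ENNReal.ofReal ((T : ℝ) + 1) := by
    rw [show (T : ℝ) + 1 = ((T + 1 : ℕ) : ℝ) by push_cast; ring, ENNReal.ofReal_natCast]
    exact_mod_cast hn
  calc _ ≤ ENNReal.ofReal (f x₀ - (⨅ y, f y) + breveM R₁ R₂ m d x₀) +
        ENNReal.ofReal ((T : ℝ) + 1) * ENNReal.ofReal (τ' ^ 2 / σ * descentConst R₁ R₂ m d) := by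
        gcongr
    _ = ENNReal.ofReal (f x₀ - (⨅ y, f y) + breveM R₁ R₂ m d x₀ +
        ((T : ℝ) + 1) * (τ' ^ 2 / σ * descentConst R₁ R₂ m d)) := by
        rw [← ENNReal.ofReal_mul (by positivity), ← ENNReal.ofReal_add hstart (by positivity)]
    _ ≤ _ := by
        refine ENNReal.ofReal_le_ofReal ?_
        rw [constK_eq]
        have : ((T : ℝ) + 1) * (τ' ^ 2 / σ * descentConst R₁ R₂ m d) =
            σ * descentConst R₁ R₂ m d := by
          rw [hτ', div_pow, hT2]
          field_simp
        rw [this]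
        have := mul_le_of_le_one_left hC hσ1
        linarith

end IsSPBWith

/-! ### The smoothing parameter as a power of the number of iterations -/

/-- The choice of the number of iterations: with `η = T^{-1/(4n+2)}`, the lower bound on `T` gives
`κ η ≤ 1` and `η ^ n ≤ M`. -/
lemma rate_parameters {n : ℕ} (hn : 1 ≤ n) {κ M : ℝ} (hκ : 0 < κ) (hM : 0 < M) {T : ℕ}
    (hT0 : 0 < T) (hT : max (M ^ (-(1 / (n : ℝ)))) κ ^ (4 * n + 2) + 1 ≤ (T : ℝ)) {η : ℝ}
    (hη : η = (T : ℝ) ^ (-(1 / (4 * (n : ℝ) + 2)))) :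
    0 < η ∧ η ≤ 1 ∧ κ * η ≤ 1 ∧ η ^ n ≤ M ∧ (T : ℝ) * η ^ (4 * n + 2) = 1 := by
  have hTpos : (0 : ℝ) < T := by exact_mod_cast hT0
  have hT1 : (1 : ℝ) ≤ T := by exact_mod_cast hT0
  have hn0 : (0 : ℝ) < n := by exact_mod_cast hn
  have hη0 : 0 < η := by rw [hη]; positivity
  have hpow : (T : ℝ) * η ^ (4 * n + 2) = 1 := by
    rw [hη, ← Real.rpow_natCast, ← Real.rpow_mul hTpos.le]
    have : -(1 / (4 * (n : ℝ) + 2)) * ((4 * n + 2 : ℕ) : ℝ) = -1 := by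
      push_cast; field_simp
    rw [this, Real.rpow_neg_one, mul_inv_cancel₀ hTpos.ne']
  have hbase : ∀ z : ℝ, 0 ≤ z → z ^ (4 * n + 2) ≤ T → z * η ≤ 1 := by
    intro z hz h
    have h1 : (z * η) ^ (4 * n + 2) ≤ 1 := by
      rw [mul_pow, ← hpow]; gcongr
    exact (pow_le_one_iff_of_nonneg (by positivity) (by omega)).1 h1
  refine ⟨hη0, ?_, ?_, ?_, hpow⟩
  · simpa using hbase 1 zero_le_one (by simpa using hT1)
  · refine hbase κ hκ.le ?_
    have : κ ^ (4 * n + 2) ≤ max (M ^ (-(1 / (n : ℝ)))) κ ^ (4 * n + 2) := by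
      gcongr; exact le_max_right _ _
    linarith
  · have h0 : 0 ≤ M ^ (-(1 / (n : ℝ))) := by positivity
    have h1 := hbase (M ^ (-(1 / (n : ℝ)))) h0 (by
      have : (M ^ (-(1 / (n : ℝ)))) ^ (4 * n + 2) ≤
          max (M ^ (-(1 / (n : ℝ)))) κ ^ (4 * n + 2) := by
        gcongr; exact le_max_left _ _
      linarith)
    have h2 : (M ^ (-(1 / (n : ℝ))) * η) ^ n ≤ 1 := pow_le_one₀ (by positivity) h1
    rw [mul_pow, ← Real.rpow_natCast (M ^ _), ← Real.rpow_mul hM.le,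
      show -(1 / (n : ℝ)) * (n : ℝ) = -1 by field_simp, Real.rpow_neg_one, inv_mul_le_iff₀ hM,
      mul_one] at h2
    exact h2

lemma rate_eq_rpow {n T : ℕ} {η : ℝ} (hη : η = (T : ℝ) ^ (-(1 / (4 * (n : ℝ) + 2)))) :
    η ^ n = (T : ℝ) ^ (-(1 / 4 - 1 / (8 * (n : ℝ) + 4))) := by
  rw [hη, ← Real.rpow_natCast, ← Real.rpow_mul (Nat.cast_nonneg T)]
  congr 1
  field_simp
  ring

lemma div_mul_sqrt_le_rate {n T : ℕ} {η κ K : ℝ} (hη0 : 0 < η) (hκ : 0 < κ) (hK : 0 ≤ K)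
    (hpow : (T : ℝ) * η ^ (4 * n + 2) = 1) :
    K / (κ * η * √((T : ℝ) + 1)) ≤ (K ^ (1 / 2 : ℝ) * κ ^ (-(1 / 2) : ℝ) * η ^ n) ^ 2 := by
  have h1 : 1 ≤ √((T : ℝ) + 1) * η ^ (2 * n + 1) := by
    have : (1 : ℝ) = √(T : ℝ) * η ^ (2 * n + 1) := by
      have h2 : (√(T : ℝ) * η ^ (2 * n + 1)) ^ 2 = 1 := by
        rw [mul_pow, Real.sq_sqrt (Nat.cast_nonneg T), ← pow_mul, ← hpow]
        ring
      have h0 : 0 ≤ √(T : ℝ) * η ^ (2 * n + 1) := by positivity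
      nlinarith
    rw [this]
    gcongr
    linarith
  have hT0 : 0 < √((T : ℝ) + 1) := by positivity
  have e : (K ^ (1 / 2 : ℝ) * κ ^ (-(1 / 2) : ℝ) * η ^ n) ^ 2 = K / κ * η ^ (2 * n) := by
    rw [mul_pow, mul_pow, ← Real.sqrt_eq_rpow, Real.sq_sqrt hK, ← Real.rpow_natCast (κ ^ _),
      ← Real.rpow_mul hκ.le]
    norm_num
    rw [Real.rpow_neg_one, ← pow_mul, mul_comm n 2]
    ring
  rw [e, div_le_iff₀ (by positivity)]
  have e2 : K / κ * η ^ (2 * n) * (κ * η * √((T : ℝ) + 1)) =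
      K * (√((T : ℝ) + 1) * η ^ (2 * n + 1)) := by
    field_simp
    ring
  rw [e2]
  exact le_mul_of_one_le_right hK h1

/-! ### Bounds on expectations -/

/-- A Hölder-type bound for a product of powers, proved by the weighted inequality of arithmetic
and geometric means after normalizing by the bounds on the expectations. -/
lemma integrable_rpow_mul_rpow_and_integral_le {Ω : Type*} [MeasurableSpace Ω] {P : Measure Ω}
    [IsProbabilityMeasure P] {U W : Ω → ℝ} (hU : Integrable U P) (hW : Integrable W P)
    (hU0 : ∀ ω, 0 ≤ U ω) (hW0 : ∀ ω, 0 ≤ W ω) {a b α β : ℝ} (ha : 0 < a) (hb : 0 < b)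
    (hUa : ∫ ω, U ω ∂P ≤ a) (hWb : ∫ ω, W ω ∂P ≤ b) (hα : 0 ≤ α) (hβ : 0 ≤ β) (hαβ : α + β ≤ 1) :
    Integrable (fun ω => U ω ^ α * W ω ^ β) P ∧ ∫ ω, U ω ^ α * W ω ^ β ∂P ≤ a ^ α * b ^ β := by
  set R := fun ω => a ^ α * b ^ β * (α / a * U ω + β / b * W ω + (1 - α - β)) with hR
  have hi : Integrable (fun ω => α / a * U ω + β / b * W ω) P :=
    (hU.const_mul _).add (hW.const_mul _)
  have hRi : Integrable R P := (hi.add (integrable_const _)).const_mul _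
  have hle : ∀ ω, U ω ^ α * W ω ^ β ≤ R ω := by
    intro ω
    have h := Real.geom_mean_le_arith_mean3_weighted hα hβ (by linarith : 0 ≤ 1 - α - β)
      (div_nonneg (hU0 ω) ha.le) (div_nonneg (hW0 ω) hb.le) zero_le_one (by ring)
    rw [Real.one_rpow, mul_one, Real.div_rpow (hU0 ω) ha.le, Real.div_rpow (hW0 ω) hb.le,
      div_mul_div_comm, div_le_iff₀ (by positivity)] at h
    refine h.trans (le_of_eq ?_)
    simp only [hR]
    ring
  have h0 : ∀ ω, 0 ≤ U ω ^ α * W ω ^ β := fun ω =>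
    mul_nonneg (Real.rpow_nonneg (hU0 ω) _) (Real.rpow_nonneg (hW0 ω) _)
  have hint : Integrable (fun ω => U ω ^ α * W ω ^ β) P := by
    refine hRi.mono' ?_ (ae_of_all _ fun ω => ?_)
    · exact ((hU.aemeasurable.pow_const α).mul (hW.aemeasurable.pow_const β)).aestronglyMeasurable
    · rw [Real.norm_of_nonneg (h0 ω)]
      exact hle ω
  refine ⟨hint, (integral_mono hint hRi hle).trans ?_⟩
  simp only [hR]
  rw [integral_const_mul, integral_add hi (integrable_const _), integral_add (hU.const_mul _)
    (hW.const_mul _), integral_const_mul, integral_const_mul]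
  simp only [integral_const, probReal_univ, smul_eq_mul, one_mul]
  refine mul_le_of_le_one_right (by positivity) ?_
  have h1 : α / a * ∫ ω, U ω ∂P ≤ α := by
    calc _ ≤ α / a * a := by gcongr
      _ = α := by field_simp
  have h2 : β / b * ∫ ω, W ω ∂P ≤ β := by
    calc _ ≤ β / b * b := by gcongr
      _ = β := by field_simp
  linarith

/-- A bound `A` on the root mean square of `b` gives the bound of `2 b + 2 ε` in the mean and in the
mean square. -/
lemma integral_sq_affine_le {Ω : Type*} [MeasurableSpace Ω] {P : Measure Ω}
    [IsProbabilityMeasure P] {b : Ω → ℝ} (hbm : AEStronglyMeasurable b P)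
    (hb2 : Integrable (fun ω => b ω ^ 2) P) {A ε : ℝ} (hA : 0 ≤ A) (hε : 0 ≤ ε)
    (h : ∫ ω, b ω ^ 2 ∂P ≤ A ^ 2) :
    Integrable b P ∧ ∫ ω, b ω ∂P ≤ A ∧ Integrable (fun ω => (2 * b ω + 2 * ε) ^ 2) P ∧
      ∫ ω, (2 * b ω + 2 * ε) ^ 2 ∂P ≤ (2 * A + 2 * ε) ^ 2 := by
  have hbi : Integrable b P := ((memLp_two_iff_integrable_sq hbm).2 hb2).integrable one_le_two
  have h1 : ∫ ω, b ω ∂P ≤ A :=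
    (abs_le_of_sq_le_sq' ((sq_integral_le hbi hb2).trans h) hA).2
  have e : ∀ ω, (2 * b ω + 2 * ε) ^ 2 = 4 * b ω ^ 2 + 8 * ε * b ω + 4 * ε ^ 2 := fun ω => by ring
  have i1 : Integrable (fun ω => 4 * b ω ^ 2 + 8 * ε * b ω) P :=
    (hb2.const_mul 4).add (hbi.const_mul (8 * ε))
  refine ⟨hbi, h1, ?_, ?_⟩
  · simp_rw [e]
    exact i1.add (integrable_const _)
  · simp_rw [e]
    rw [integral_add i1 (integrable_const _), integral_add (hb2.const_mul 4)
      (hbi.const_mul (8 * ε)), integral_const_mul, integral_const_mul]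
    simp only [integral_const, probReal_univ, smul_eq_mul, one_mul]
    nlinarith [mul_le_mul_of_nonneg_left h1 hε]

lemma isClosed_argminSet {f : 𝔼 → ℝ} (hf : Continuous f) : IsClosed (argminSet f) := by
  have : argminSet f = ⋂ y, {x | f x ≤ f y} := by ext; simp [argminSet]
  rw [this]
  exact isClosed_iInter fun y => isClosed_le hf continuous_const

namespace IsSPBWith

variable {f : EuclideanSpace ℝ (Fin d) → ℝ} {R₁ R₂ : ℝ} {m : ℕ}

lemma constKappa₂_pos (hf : IsSPBWith f R₁ R₂ m) (hd : 1 ≤ d) {δ : ℝ} (hδ : 0 < δ) :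
    0 < constKappa₂ R₁ R₂ m d δ := by
  have h1 : 0 < constP R₁ R₂ m d := by
    have := hf.constP_ge hd
    have := hf.splitCoeff_nonneg
    have := hf.R₂_pos
    linarith
  have hd1 : (0 : ℝ) < d := by exact_mod_cast hd
  unfold constKappa₂
  positivity

lemma constKappa₁_spec (hf : IsSPBWith f R₁ R₂ m) (hd : 1 ≤ d) (hm : 1 ≤ m) {δ : ℝ} (hδ : 0 < δ) :
    0 < constKappa₁ R₁ R₂ m d δ ∧ constKappa₁ R₁ R₂ m d δ ≤ constKappa₂ R₁ R₂ m d δ ∧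
      splitCoeff R₁ m * ((m : ℝ) + d) ^ ((m : ℝ) / 2) * constKappa₁ R₁ R₂ m d δ ^ m ≤ 1 / 4 := by
  have hm0 : (0 : ℝ) < m := by exact_mod_cast hm
  have hR₁ : 0 < R₁ := lt_of_le_of_ne hf.R₁_nonneg fun h => by
    have := hf.R₁_eq_zero_iff.1 h.symm
    omega
  set Q := 2 ^ (m + 1) * R₁ * ((m : ℝ) + d) ^ ((m : ℝ) / 2) with hQ
  have hQ0 : 0 < Q := by positivity
  have hpos : 0 < constKappa₁ R₁ R₂ m d δ :=
    lt_min (by rw [← hQ]; positivity) (hf.constKappa₂_pos hd hδ)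
  refine ⟨hpos, min_le_right _ _, ?_⟩
  have h1 : constKappa₁ R₁ R₂ m d δ ≤ Q ^ (-(1 / (m : ℝ))) := min_le_left _ _
  have h2 : constKappa₁ R₁ R₂ m d δ ^ m ≤ Q⁻¹ := by
    refine (pow_le_pow_left₀ hpos.le h1 m).trans (le_of_eq ?_)
    rw [← Real.rpow_natCast (Q ^ _), ← Real.rpow_mul hQ0.le,
      show -(1 / (m : ℝ)) * (m : ℝ) = -1 by field_simp, Real.rpow_neg_one]
  have h3 : splitCoeff R₁ m * ((m : ℝ) + d) ^ ((m : ℝ) / 2) = Q / 4 := by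
    rw [hQ]
    unfold splitCoeff
    rw [zpow_sub₀ two_ne_zero, zpow_natCast, pow_succ]
    norm_num
    ring
  rw [h3]
  calc Q / 4 * constKappa₁ R₁ R₂ m d δ ^ m ≤ Q / 4 * Q⁻¹ := by gcongr
    _ = 1 / 4 := by field_simp

lemma constK_pos (hf : IsSPBWith f R₁ R₂ m) (hd : 1 ≤ d) (hbdd : BddBelow (Set.range f)) (x₀ : 𝔼) :
    0 < constK f R₁ R₂ m x₀ := by
  have := hf.splitCoeff_nonneg
  have := hf.splitCoeffTwo_nonneg
  have hR₁ := hf.R₁_nonneg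
  have := hf.R₂_pos
  have hH := fun p => breveH_nonneg hf.R₁_nonneg hf.R₂_pos.le m d p
  have h2 := hH 2
  have hm2 := hH (m + 2)
  have hd1 : (0 : ℝ) < d := by exact_mod_cast hd
  have h3 : (⨅ y, f y) ≤ f x₀ := ciInf_le hbdd x₀
  have h4 : 0 < breveM R₁ R₂ m d x₀ := by unfold breveM; positivity
  have h5 : 0 ≤ descentConst R₁ R₂ m d := by unfold descentConst; positivity
  rw [constK_eq]
  linarith

/-- Quadratic growth transfers to the smoothing and bounds the norm of a point by the smoothed
optimality gap. -/
lemma norm_sq_le_of_quadratic_growth (hf : IsSPBWith f R₁ R₂ m) (hd : 1 ≤ d)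
    (hne : (argminSet f).Nonempty) (hb : Bornology.IsBounded (argminSet f)) {μ : ℝ} (hμ : 0 < μ)
    (hgrowth : ∀ y, μ / 2 * Metric.infDist y (argminSet f) ^ 2 ≤ f y - ⨅ z, f z) {σ : ℝ}
    (hσ : 0 < σ) (hσ1 : σ ≤ 1) (x : 𝔼) :
    ‖x‖ ^ 2 ≤ 8 * μ⁻¹ * (gaussianSmoothing f σ x - ⨅ z, f z) + 4 * (d : ℝ) +
      2 * sSup ((fun w => ‖w‖ ^ 2) '' argminSet f) := by
  set S := argminSet f with hS
  set c := ⨅ z, f z with hc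
  have h1 : Metric.infDist x S ^ 2 ≤ 4 * μ⁻¹ * (gaussianSmoothing f σ x - c) + 2 * d := by
    have hpt : ∀ u : 𝔼, Metric.infDist x S ^ 2 ≤
        4 * μ⁻¹ * (f (x + σ • u) - c) + 2 * ‖u‖ ^ 2 := by
      intro u
      have h2 := Metric.infDist_le_infDist_add_dist (s := S) (x := x) (y := x + σ • u)
      have h3 : dist x (x + σ • u) ≤ ‖u‖ := by
        rw [dist_self_add_right, norm_smul, Real.norm_of_nonneg hσ.le]
        exact mul_le_of_le_one_left (norm_nonneg u) hσ1
      have h4 := hgrowth (x + σ • u)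
      have h5 : Metric.infDist (x + σ • u) S ^ 2 ≤ 2 * μ⁻¹ * (f (x + σ • u) - c) := by
        calc _ = 2 * μ⁻¹ * (μ / 2 * Metric.infDist (x + σ • u) S ^ 2) := by field_simp
          _ ≤ _ := by gcongr
      have h6 : Metric.infDist x S ≤ Metric.infDist (x + σ • u) S + ‖u‖ := by linarith
      have h7 := pow_le_pow_left₀ Metric.infDist_nonneg h6 2
      nlinarith [sq_nonneg (Metric.infDist (x + σ • u) S - ‖u‖)]
    have i1 : Integrable (fun u : 𝔼 => 4 * μ⁻¹ * (f (x + σ • u) - c)) (stdGaussian 𝔼) :=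
      ((hf.integrable_shift x hσ.le).sub (integrable_const c)).const_mul _
    have i2 : Integrable (fun u : 𝔼 => 2 * ‖u‖ ^ 2) (stdGaussian 𝔼) :=
      (integrable_norm_pow_stdGaussian 2).const_mul 2
    have h2 := integral_mono (integrable_const _) (i1.add i2) hpt
    simp only [Pi.add_apply] at h2
    rw [integral_add i1 i2, integral_const_mul, integral_const_mul,
      integral_sub (hf.integrable_shift x hσ.le) (integrable_const c),
      integral_norm_sq_stdGaussian hd] at h2
    simpa [gaussianSmoothing] using h2
  obtain ⟨w, hw, hwd⟩ := (isClosed_argminSet hf.continuous).exists_infDist_eq_dist hne x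
  have h3 : ‖w‖ ^ 2 ≤ sSup ((fun w => ‖w‖ ^ 2) '' S) := by
    refine le_csSup ?_ ⟨w, hw, rfl⟩
    obtain ⟨r, hr⟩ := hb.exists_norm_le
    refine ⟨r ^ 2, ?_⟩
    rintro _ ⟨z, hz, rfl⟩
    exact pow_le_pow_left₀ (norm_nonneg z) (hr z hz) 2
  have h4 : ‖x‖ ≤ Metric.infDist x S + ‖w‖ := by
    rw [hwd, dist_eq_norm]
    simpa using norm_add_le (x - w) w
  have h5 := pow_le_pow_left₀ (norm_nonneg x) h4 2
  nlinarith [sq_nonneg (Metric.infDist x S - ‖w‖)]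

/-- The consequences of the telescoped descent inequality, for real-valued expectations. -/
lemma expectation_bounds (hf : IsSPBWith f R₁ R₂ m) (hd : 1 ≤ d)
    (hbdd : BddBelow (Set.range f)) {σ : ℝ} {τ : ℕ → ℝ} (hσ : 0 < σ) (hσ1 : σ ≤ 1) (x₀ : 𝔼)
    {T : ℕ} (hτ : ∀ k ≤ T, τ k = σ / √((T : ℝ) + 1))
    {Ω : Type*} [MeasurableSpace Ω] {P : Measure Ω} [IsProbabilityMeasure P] {u : ℕ → Ω → 𝔼}
    (hu_meas : ∀ k, Measurable (u k)) (hu_law : ∀ k, P.map (u k) = stdGaussian 𝔼)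
    (hu_indep : iIndepFun u P) {x : ℕ → Ω → 𝔼}
    (hx : ∀ k ω, x k ω = zoIterate f m σ τ x₀ (fun j => u j ω) k) :
    (∀ k, Measurable (x k)) ∧
    (∀ k ≤ T, Integrable (fun ω => gaussianSmoothing f σ (x k ω) - ⨅ y, f y) P ∧
      ∫ ω, (gaussianSmoothing f σ (x k ω) - ⨅ y, f y) ∂P ≤ constK f R₁ R₂ m x₀) ∧
    (∀ k ≤ T, Integrable (fun ω =>
      ‖smoothedGradient f σ (x k ω)‖ ^ 2 / (‖x k ω‖ ^ (2 * m) + 1)) P) ∧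
    ∃ k ≤ T, ∫ ω, ‖smoothedGradient f σ (x k ω)‖ ^ 2 / (‖x k ω‖ ^ (2 * m) + 1) ∂P ≤
      constK f R₁ R₂ m x₀ / (σ * √((T : ℝ) + 1)) := by
  have hK0 := hf.constK_pos hd hbdd x₀
  set K := constK f R₁ R₂ m x₀ with hK
  have hT0 : 0 < √((T : ℝ) + 1) := by positivity
  have hxm : ∀ k, Measurable (x k) := fun k => by
    have : x k = fun ω => zoIterate f m σ τ x₀ (fun j => u j ω) k := funext (hx k)
    rw [this]
    exact (measurable_zoIterate hf.continuous m σ τ x₀ k).comp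
      (measurable_pi_lambda _ fun j => hu_meas j)
  have hFm := hf.measurable_gaussianSmoothing σ
  have hgm := (hf.stronglyMeasurable_smoothedGradient σ).measurable
  have hsum := fun n hn => hf.lintegral_add_sum_le hd hbdd hσ hσ1 x₀ hτ hu_meas hu_law hu_indep hx
    (n := n) hn
  rw [← hK] at hsum
  set Y := fun k ω => ‖smoothedGradient f σ (x k ω)‖ ^ 2 / (‖x k ω‖ ^ (2 * m) + 1) with hY
  have hY0 : ∀ k ω, 0 ≤ Y k ω := fun k ω => by simp only [hY]; positivity
  have hYm : ∀ k, Measurable (Y k) := fun k => by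
    have h1 := hxm k
    simp only [hY]
    fun_prop
  have hτ0 : 0 < σ / √((T : ℝ) + 1) := by positivity
  have hYfin : ∀ k ≤ T, ∫⁻ ω, ENNReal.ofReal (Y k ω) ∂P ≠ ⊤ := by
    intro k hk htop
    have h1 := (le_add_self.trans (hsum (T + 1) le_rfl) :
      ∑ k ∈ Finset.range (T + 1), ENNReal.ofReal (σ / √((T : ℝ) + 1)) *
        ∫⁻ ω, ENNReal.ofReal (Y k ω) ∂P ≤ _)
    have h2 := (Finset.single_le_sum (f := fun k => ENNReal.ofReal (σ / √((T : ℝ) + 1)) *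
        ∫⁻ ω, ENNReal.ofReal (Y k ω) ∂P) (fun _ _ => zero_le) (Finset.mem_range.2
        (by omega : k < T + 1))).trans h1
    simp only [htop] at h2
    rw [ENNReal.mul_top (by simpa using hτ0)] at h2
    exact ENNReal.ofReal_ne_top (top_le_iff.1 h2)
  have hYi : ∀ k ≤ T, Integrable (Y k) P := fun k hk =>
    ⟨(hYm k).aestronglyMeasurable, (hasFiniteIntegral_iff_ofReal (ae_of_all _ (hY0 k))).2
      (lt_top_iff_ne_top.2 (hYfin k hk))⟩
  refine ⟨hxm, fun k hk => ?_, hYi, ?_⟩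
  · have h0 : ∀ ω, 0 ≤ gaussianSmoothing f σ (x k ω) - ⨅ y, f y := fun ω =>
      sub_nonneg.2 (hf.ciInf_le_gaussianSmoothing hbdd _ hσ)
    have h1 := le_self_add.trans (hsum k (by omega))
    have hm : Measurable fun ω => gaussianSmoothing f σ (x k ω) - ⨅ y, f y :=
      (hFm.comp (hxm k)).sub_const _
    refine ⟨⟨hm.aestronglyMeasurable, (hasFiniteIntegral_iff_ofReal (ae_of_all _ h0)).2
      (h1.trans_lt ENNReal.ofReal_lt_top)⟩, ?_⟩
    rw [integral_eq_lintegral_of_nonneg_ae (ae_of_all _ h0) hm.aestronglyMeasurable]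
    exact ENNReal.toReal_le_of_le_ofReal hK0.le h1
  · by_contra! hcon
    have h1 := (le_add_self.trans (hsum (T + 1) le_rfl) :
      ∑ k ∈ Finset.range (T + 1), ENNReal.ofReal (σ / √((T : ℝ) + 1)) *
        ∫⁻ ω, ENNReal.ofReal (Y k ω) ∂P ≤ _)
    have h2 : ∀ k ∈ Finset.range (T + 1), ENNReal.ofReal (σ / √((T : ℝ) + 1)) *
        ∫⁻ ω, ENNReal.ofReal (Y k ω) ∂P =
        ENNReal.ofReal (σ / √((T : ℝ) + 1) * ∫ ω, Y k ω ∂P) := by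
      intro k hk
      rw [ENNReal.ofReal_mul hτ0.le, ofReal_integral_eq_lintegral_ofReal
        (hYi k (by have := Finset.mem_range.1 hk; omega)) (ae_of_all _ (hY0 k))]
    rw [Finset.sum_congr rfl h2, ← ENNReal.ofReal_sum_of_nonneg (fun k _ =>
      mul_nonneg hτ0.le (integral_nonneg (hY0 k))), ENNReal.ofReal_le_ofReal_iff hK0.le] at h1
    have h3 : ∑ k ∈ Finset.range (T + 1), K / ((T : ℝ) + 1) <
        ∑ k ∈ Finset.range (T + 1), σ / √((T : ℝ) + 1) * ∫ ω, Y k ω ∂P := by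
      refine Finset.sum_lt_sum_of_nonempty Finset.nonempty_range_add_one fun k hk => ?_
      have h4 := mul_lt_mul_of_pos_left (hcon k (by have := Finset.mem_range.1 hk; omega)) hτ0
      refine lt_of_eq_of_lt ?_ h4
      have h5 : √((T : ℝ) + 1) * √((T : ℝ) + 1) = (T : ℝ) + 1 := Real.mul_self_sqrt (by positivity)
      rw [div_mul_div_comm, mul_left_comm (√((T : ℝ) + 1)) σ, h5]
      field_simp
    rw [Finset.sum_const, Finset.card_range, nsmul_eq_mul] at h3
    have h6 : ((T + 1 : ℕ) : ℝ) * (K / ((T : ℝ) + 1)) = K := by push_cast; field_simp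
    rw [h6] at h3
    linarith

end IsSPBWith

/-! ### The convergence rates -/

lemma measurable_infDist_goldsteinSubdiff {f : 𝔼 → ℝ} (hf : LocallyLipschitz f) {δ : ℝ}
    (hδ : 0 ≤ δ) : Measurable fun x => Metric.infDist 0 (goldsteinSubdiff f δ x) :=
  (lowerSemicontinuous_infDist_goldsteinSubdiff hf hδ).measurable

lemma sqrt_one_add_le {a : ℝ} (ha : 0 ≤ a) : √(1 + a) ≤ 1 + √a := by
  rw [Real.sqrt_le_left (by positivity)]
  nlinarith [Real.sq_sqrt ha, Real.sqrt_nonneg a]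

/-- The normalization of the step, raised to a power `θ ≤ 1 / m`, is controlled by the second
moment. -/
lemma sqrt_pow_add_one_rpow_le {r θ : ℝ} {m : ℕ} (hr : 0 ≤ r) (hm : m ≠ 0) (hθ : 0 ≤ θ)
    (hmθ : m * θ ≤ 1) : √(r ^ (2 * m) + 1) ^ θ ≤ (1 + r ^ 2) ^ (1 / 2 : ℝ) := by
  have h8 : r ^ (2 * m) + 1 ≤ (1 + r ^ 2) ^ m := by
    rw [pow_mul, add_comm]
    simpa using pow_add_pow_le zero_le_one (sq_nonneg r) hm
  rw [Real.sqrt_eq_rpow, ← Real.rpow_mul (by positivity)]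
  calc (r ^ (2 * m) + 1) ^ (1 / 2 * θ) ≤ ((1 + r ^ 2) ^ m) ^ (1 / 2 * θ) :=
        Real.rpow_le_rpow (by positivity) h8 (by positivity)
    _ = (1 + r ^ 2) ^ (m * (1 / 2 * θ)) := by
        rw [← Real.rpow_natCast, ← Real.rpow_mul (by positivity)]
    _ ≤ _ := Real.rpow_le_rpow_of_exponent_le (by nlinarith [sq_nonneg r]) (by linarith)

set_option maxHeartbeats 400000 in
theorem theorem4p11
    {d : ℕ} (hd : 1 ≤ d)
    (f : EuclideanSpace ℝ (Fin d) → ℝ) (R₁ R₂ : ℝ) (m : ℕ) (hf : IsSPBWith f R₁ R₂ m)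
    (hbdd : BddBelow (Set.range f))
    (δ : ℝ) (hδ0 : 0 < δ) (hδ1 : δ < 1)
    (T : ℕ) (hT0 : 0 < T) (hT : breveN R₁ R₂ m d δ ≤ (T : ℝ))
    (τ : ℕ → ℝ) (hτ : ∀ k ≤ T, τ k = breveSigma R₁ R₂ m d δ T / √((T : ℝ) + 1))
    (x₀ : EuclideanSpace ℝ (Fin d))
    {Ω : Type*} [MeasurableSpace Ω] (P : Measure Ω) [IsProbabilityMeasure P]
    (u : ℕ → Ω → EuclideanSpace ℝ (Fin d))
    (hu_meas : ∀ k, Measurable (u k))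
    (hu_law : ∀ k, P.map (u k) = stdGaussian (EuclideanSpace ℝ (Fin d)))
    (hu_indep : iIndepFun u P)
    (x : ℕ → Ω → EuclideanSpace ℝ (Fin d))
    (hx : ∀ k ω, x k ω =
      zoIterate f m (breveSigma R₁ R₂ m d δ T) τ x₀ (fun j => u j ω) k) :
    (1 ≤ m →
      (argminSet f).Nonempty → Bornology.IsBounded (argminSet f) →
      ∀ μ : ℝ, 0 < μ →
      (∀ y, μ / 2 * Metric.infDist y (argminSet f) ^ 2 ≤ f y - ⨅ z, f z) →
      (∀ k ≤ T, Integrable (fun ω => Metric.infDist 0 (goldsteinSubdiff f δ (x k ω)) ^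
          (1 / (2 * (⌈(m : ℝ) / 2⌉₊ : ℝ)))) P) ∧
      (Finset.range (T + 1)).inf' Finset.nonempty_range_add_one
          (fun k => ∫ ω, Metric.infDist 0 (goldsteinSubdiff f δ (x k ω)) ^
            (1 / (2 * (⌈(m : ℝ) / 2⌉₊ : ℝ))) ∂P) ≤
        (1 + √(constKTilde f R₁ R₂ m x₀ μ)) *
          (2 * constK f R₁ R₂ m x₀ ^ (1 / 2 : ℝ) *
            constKappa₁ R₁ R₂ m d δ ^ (-(1 / 2) : ℝ) + 2) ^
              (1 / (2 * (⌈(m : ℝ) / 2⌉₊ : ℝ))) /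
          (T : ℝ) ^ ((1 / 4 - 1 / (8 * ((min m d : ℕ) : ℝ) + 4)) *
            (1 / (2 * (⌈(m : ℝ) / 2⌉₊ : ℝ))))) ∧
    (m = 0 →
      (∀ k ≤ T, Integrable (fun ω => Metric.infDist 0 (goldsteinSubdiff f δ (x k ω))) P) ∧
      (Finset.range (T + 1)).inf' Finset.nonempty_range_add_one
          (fun k => ∫ ω, Metric.infDist 0 (goldsteinSubdiff f δ (x k ω)) ∂P) ≤
        (2 * constK f R₁ R₂ m x₀ ^ (1 / 2 : ℝ) *
            constKappa₂ R₁ R₂ m d δ ^ (-(1 / 2) : ℝ) + 2) *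
          (T : ℝ) ^ (-(1 / 4 - 1 / (8 * (d : ℝ) + 4)) : ℝ)) := by
  have hK0 := hf.constK_pos hd hbdd x₀
  have hR₂ := hf.R₂_pos
  have hM : 0 < min (5 * R₂) 1 := lt_min (by linarith) one_pos
  have hTpos : (0 : ℝ) < T := by exact_mod_cast hT0
  refine ⟨fun hm hne hb μ hμ hgrowth => ?_, fun hm => ?_⟩
  · obtain ⟨hκ0, hκ₂, hκ₁⟩ := hf.constKappa₁_spec hd hm hδ0
    set κ := constKappa₁ R₁ R₂ m d δ with hκ
    set n := min m d with hn
    have hn1 : 1 ≤ n := le_min hm hd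
    obtain ⟨η, hη⟩ : ∃ η, η = (T : ℝ) ^ (-(1 / (4 * (n : ℝ) + 2))) := ⟨_, rfl⟩
    have hT' : max ((min (5 * R₂) 1) ^ (-(1 / (n : ℝ)))) κ ^ (4 * n + 2) + 1 ≤ (T : ℝ) := by
      rw [breveN, if_pos hm] at hT
      exact hT
    obtain ⟨hη0, hη1, hκη, hηM, hpow⟩ := rate_parameters hn1 hκ0 hM hT0 hT' hη
    have hσ : breveSigma R₁ R₂ m d δ T = κ * η := by rw [breveSigma, if_pos hm, hη]
    rw [hσ] at hτ hx
    have hσ0 : 0 < κ * η := by positivity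
    obtain ⟨hxm, hF, hYi, k₀, hk₀, hk₀le⟩ := hf.expectation_bounds hd hbdd hσ0 hκη x₀ hτ hu_meas
      hu_law hu_indep hx
    have hdist : ∀ y, Metric.infDist 0 (goldsteinSubdiff f δ y) ≤
        5 / 4 * ‖smoothedGradient f (κ * η) y‖ + 5 / 16 * (2 + ‖y‖ ^ m) * η ^ n := by
      intro y
      refine hf.infDist_goldsteinSubdiff_le hd y hσ0 hδ0 hη0.le hη1 (min_le_right _ _)
        (hηM.trans (min_le_left _ _)) (by gcongr) ?_
      rw [mul_pow, ← mul_assoc]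
      have h1 : η ^ m ≤ η ^ n := pow_le_pow_of_le_one hη0.le hη1 (min_le_left _ _)
      calc _ ≤ 1 / 4 * η ^ m := by gcongr
        _ ≤ _ := by linarith
    set θ : ℝ := 1 / (2 * (⌈(m : ℝ) / 2⌉₊ : ℝ)) with hθ
    have hc1 : (1 : ℝ) ≤ (⌈(m : ℝ) / 2⌉₊ : ℝ) := by
      have : 0 < ⌈(m : ℝ) / 2⌉₊ := Nat.ceil_pos.2 (by
        have : (1 : ℝ) ≤ m := by exact_mod_cast hm
        linarith)
      exact_mod_cast this
    have hθ0 : 0 < θ := by rw [hθ]; positivity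
    have hθ1 : θ ≤ 1 := by
      rw [hθ, div_le_one (by positivity)]; linarith
    have hmθ : m * θ ≤ 1 := by
      rw [hθ, mul_one_div, div_le_one (by positivity)]
      have := Nat.le_ceil ((m : ℝ) / 2)
      linarith
    set ε := η ^ n with hε
    have hε0 : 0 < ε := by positivity
    set Kt := constKTilde f R₁ R₂ m x₀ μ with hKt
    -- the normalized gradient norm
    set b := fun k ω => ‖smoothedGradient f (κ * η) (x k ω)‖ / √(‖x k ω‖ ^ (2 * m) + 1) with hb'
    have hb0 : ∀ k ω, 0 ≤ b k ω := fun k ω => by simp only [hb']; positivity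
    have hgm := (hf.stronglyMeasurable_smoothedGradient (κ * η)).measurable
    have hbm : ∀ k, Measurable (b k) := fun k => by
      have h1 := hxm k
      simp only [hb']
      fun_prop
    have hb2 : ∀ k ω, b k ω ^ 2 =
        ‖smoothedGradient f (κ * η) (x k ω)‖ ^ 2 / (‖x k ω‖ ^ (2 * m) + 1) := fun k ω => by
      simp only [hb']
      rw [div_pow, Real.sq_sqrt (by positivity)]
    -- both `1` and `‖x‖ ^ m` in `hdist` are at most `√(‖x‖ ^ (2 * m) + 1)`
    have hX : ∀ k ω, Metric.infDist 0 (goldsteinSubdiff f δ (x k ω)) ≤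
        √(‖x k ω‖ ^ (2 * m) + 1) * (2 * b k ω + 2 * ε) := by
      intro k ω
      have hD0 : 0 < √(‖x k ω‖ ^ (2 * m) + 1) := by positivity
      have h1 : ‖smoothedGradient f (κ * η) (x k ω)‖ = √(‖x k ω‖ ^ (2 * m) + 1) * b k ω := by
        simp only [hb']; field_simp
      have h2 : 1 ≤ √(‖x k ω‖ ^ (2 * m) + 1) := by
        rw [Real.one_le_sqrt]; linarith [pow_nonneg (norm_nonneg (x k ω)) (2 * m)]
      have h3 : ‖x k ω‖ ^ m ≤ √(‖x k ω‖ ^ (2 * m) + 1) := by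
        refine Real.le_sqrt_of_sq_le ?_
        rw [← pow_mul, mul_comm m 2]; linarith
      have h4 := hdist (x k ω)
      rw [h1] at h4
      have h5 := mul_nonneg hD0.le (hb0 k ω)
      nlinarith [mul_le_mul_of_nonneg_right h2 hε0.le, mul_le_mul_of_nonneg_right h3 hε0.le,
        mul_nonneg hD0.le hε0.le]
    -- the second moment of the iterates, from quadratic growth
    have hsup0 : 0 ≤ sSup ((fun w => ‖w‖ ^ 2) '' argminSet f) :=
      Real.sSup_nonneg (by rintro _ ⟨w, -, rfl⟩; positivity)
    have hKt0 : 0 ≤ Kt := by rw [hKt]; unfold constKTilde; positivity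
    have hU : ∀ k ≤ T, Integrable (fun ω => 1 + ‖x k ω‖ ^ 2) P ∧
        ∫ ω, (1 + ‖x k ω‖ ^ 2) ∂P ≤ 1 + Kt := by
      intro k hk
      obtain ⟨i1, h1⟩ := hF k hk
      have hpt : ∀ ω, 1 + ‖x k ω‖ ^ 2 ≤ 8 * μ⁻¹ * (gaussianSmoothing f (κ * η) (x k ω) - ⨅ y, f y) +
          (1 + 4 * (d : ℝ) + 2 * sSup ((fun w => ‖w‖ ^ 2) '' argminSet f)) := by
        intro ω
        have := hf.norm_sq_le_of_quadratic_growth hd hne hb hμ hgrowth hσ0 hκη (x k ω)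
        linarith
      have i2 := i1.const_mul (8 * μ⁻¹)
      have i2' : Integrable (fun ω => 8 * μ⁻¹ * (gaussianSmoothing f (κ * η) (x k ω) - ⨅ y, f y) +
          (1 + 4 * (d : ℝ) + 2 * sSup ((fun w => ‖w‖ ^ 2) '' argminSet f))) P :=
        i2.add (integrable_const _)
      have hm2 : Measurable fun ω => 1 + ‖x k ω‖ ^ 2 := by
        have := hxm k
        fun_prop
      have i3 : Integrable (fun ω => 1 + ‖x k ω‖ ^ 2) P := by
        refine i2'.mono' hm2.aestronglyMeasurable (ae_of_all _ fun ω => ?_)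
        rw [Real.norm_of_nonneg (by positivity)]
        exact hpt ω
      refine ⟨i3, (integral_mono i3 i2' hpt).trans ?_⟩
      rw [integral_add i2 (integrable_const _), integral_const_mul]
      simp only [integral_const, probReal_univ, smul_eq_mul, one_mul]
      rw [hKt]
      unfold constKTilde
      have : 8 * μ⁻¹ * ∫ ω, (gaussianSmoothing f (κ * η) (x k ω) - ⨅ y, f y) ∂P ≤
          8 * μ⁻¹ * constK f R₁ R₂ m x₀ := by gcongr
      linarith
    -- stated for an arbitrary `A`, to give integrability at every `k` and the rate at `k₀`
    have hmain : ∀ k ≤ T, ∀ A : ℝ, 0 ≤ A → ∫ ω, b k ω ^ 2 ∂P ≤ A ^ 2 →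
        Integrable (fun ω => Metric.infDist 0 (goldsteinSubdiff f δ (x k ω)) ^ θ) P ∧
        ∫ ω, Metric.infDist 0 (goldsteinSubdiff f δ (x k ω)) ^ θ ∂P ≤
          (1 + √Kt) * (2 * A + 2 * ε) ^ θ := by
      intro k hk A hA hA2
      have hb2i : Integrable (fun ω => b k ω ^ 2) P := by
        simp_rw [hb2]; exact hYi k hk
      obtain ⟨-, -, i4, h4⟩ := integral_sq_affine_le (hbm k).aestronglyMeasurable hb2i hA hε0.le hA2
      obtain ⟨i5, h5⟩ := hU k hk
      obtain ⟨i6, h6⟩ := integrable_rpow_mul_rpow_and_integral_le i5 i4 (fun ω => by positivity)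
        (fun ω => sq_nonneg _) (by linarith) (by positivity) h5 h4
        (by norm_num : (0 : ℝ) ≤ 1 / 2) (by positivity : 0 ≤ θ / 2) (by linarith)
      have hpt : ∀ ω, Metric.infDist 0 (goldsteinSubdiff f δ (x k ω)) ^ θ ≤
          (1 + ‖x k ω‖ ^ 2) ^ (1 / 2 : ℝ) * ((2 * b k ω + 2 * ε) ^ 2) ^ (θ / 2) := by
        intro ω
        have hB : 0 ≤ 2 * b k ω + 2 * ε := by linarith [hb0 k ω]
        have e1 : ((2 * b k ω + 2 * ε) ^ 2) ^ (θ / 2) = (2 * b k ω + 2 * ε) ^ θ := by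
          rw [← Real.rpow_natCast, ← Real.rpow_mul hB]
          congr 1; push_cast; ring
        have h7 : √(‖x k ω‖ ^ (2 * m) + 1) ^ θ ≤ (1 + ‖x k ω‖ ^ 2) ^ (1 / 2 : ℝ) :=
          sqrt_pow_add_one_rpow_le (norm_nonneg _) (by omega) hθ0.le hmθ
        rw [e1]
        calc _ ≤ (√(‖x k ω‖ ^ (2 * m) + 1) * (2 * b k ω + 2 * ε)) ^ θ :=
              Real.rpow_le_rpow Metric.infDist_nonneg (hX k ω) hθ0.le
          _ = √(‖x k ω‖ ^ (2 * m) + 1) ^ θ * (2 * b k ω + 2 * ε) ^ θ :=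
              Real.mul_rpow (by positivity) hB
          _ ≤ _ := by gcongr
      have hXm : Measurable fun ω => Metric.infDist 0 (goldsteinSubdiff f δ (x k ω)) :=
        (measurable_infDist_goldsteinSubdiff hf.locallyLipschitz hδ0.le).comp (hxm k)
      have i7 : Integrable (fun ω => Metric.infDist 0 (goldsteinSubdiff f δ (x k ω)) ^ θ) P := by
        refine i6.mono' (hXm.pow_const θ).aestronglyMeasurable (ae_of_all _ fun ω => ?_)
        rw [Real.norm_of_nonneg (Real.rpow_nonneg Metric.infDist_nonneg _)]
        exact hpt ω
      refine ⟨i7, (integral_mono i7 i6 hpt).trans (h6.trans ?_)⟩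
      have e2 : ((2 * A + 2 * ε) ^ 2) ^ (θ / 2) = (2 * A + 2 * ε) ^ θ := by
        rw [← Real.rpow_natCast, ← Real.rpow_mul (by positivity)]
        congr 1; push_cast; ring
      rw [e2, ← Real.sqrt_eq_rpow]
      gcongr
      exact sqrt_one_add_le hKt0
    refine ⟨fun k hk => ?_, ?_⟩
    · have h0 : 0 ≤ ∫ ω, b k ω ^ 2 ∂P := integral_nonneg fun ω => sq_nonneg _
      exact (hmain k hk (√(∫ ω, b k ω ^ 2 ∂P)) (Real.sqrt_nonneg _) (Real.sq_sqrt h0).ge).1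
    · refine (Finset.inf'_le _ (Finset.mem_range.2 (by omega : k₀ < T + 1))).trans ?_
      have h1 : ∫ ω, b k₀ ω ^ 2 ∂P ≤
          (constK f R₁ R₂ m x₀ ^ (1 / 2 : ℝ) * κ ^ (-(1 / 2) : ℝ) * ε) ^ 2 := by
        simp_rw [hb2]
        exact hk₀le.trans (div_mul_sqrt_le_rate hη0 hκ0 hK0.le hpow)
      refine (hmain k₀ hk₀ _ (by positivity) h1).2.trans (le_of_eq ?_)
      have e3 : 2 * (constK f R₁ R₂ m x₀ ^ (1 / 2 : ℝ) * κ ^ (-(1 / 2) : ℝ) * ε) + 2 * ε =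
          (2 * constK f R₁ R₂ m x₀ ^ (1 / 2 : ℝ) * κ ^ (-(1 / 2) : ℝ) + 2) * ε := by ring
      rw [e3, Real.mul_rpow (by positivity) hε0.le, hε, rate_eq_rpow hη, ← Real.rpow_mul hTpos.le,
        neg_mul, Real.rpow_neg hTpos.le]
      ring
  · have hκ0 := hf.constKappa₂_pos hd hδ0
    set κ := constKappa₂ R₁ R₂ m d δ with hκ
    obtain ⟨η, hη⟩ : ∃ η, η = (T : ℝ) ^ (-(1 / (4 * (d : ℝ) + 2))) := ⟨_, rfl⟩
    have hm' : ¬ 1 ≤ m := by omega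
    have hT' : max ((min (5 * R₂) 1) ^ (-(1 / (d : ℝ)))) κ ^ (4 * d + 2) + 1 ≤ (T : ℝ) := by
      rw [breveN, if_neg hm'] at hT
      exact hT
    obtain ⟨hη0, hη1, hκη, hηM, hpow⟩ := rate_parameters hd hκ0 hM hT0 hT' hη
    have hσ : breveSigma R₁ R₂ m d δ T = κ * η := by rw [breveSigma, if_neg hm', hη]
    rw [hσ] at hτ hx
    have hσ0 : 0 < κ * η := by positivity
    obtain ⟨hxm, -, hYi, k₀, hk₀, hk₀le⟩ := hf.expectation_bounds hd hbdd hσ0 hκη x₀ hτ hu_meas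
      hu_law hu_indep hx
    set ε := η ^ d with hε
    have hε0 : 0 < ε := by positivity
    have hdist : ∀ y, Metric.infDist 0 (goldsteinSubdiff f δ y) ≤
        5 / 4 * ‖smoothedGradient f (κ * η) y‖ + 5 / 16 * (2 + ‖y‖ ^ m) * ε := by
      intro y
      refine hf.infDist_goldsteinSubdiff_le hd y hσ0 hδ0 hη0.le hη1 le_rfl
        (hηM.trans (min_le_left _ _)) le_rfl ?_
      have : splitCoeff R₁ m = 0 := by rw [splitCoeff, hf.R₁_eq_zero_iff.2 hm, mul_zero]
      rw [this]
      simp only [zero_mul]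
      positivity
    -- for `m = 0` the normalization `‖x‖ ^ (2 * m) + 1` is the constant `2`
    set b := fun k ω => ‖smoothedGradient f (κ * η) (x k ω)‖ / √2 with hb'
    have hb0 : ∀ k ω, 0 ≤ b k ω := fun k ω => by simp only [hb']; positivity
    have hgm := (hf.stronglyMeasurable_smoothedGradient (κ * η)).measurable
    have hbm : ∀ k, Measurable (b k) := fun k => by
      have h1 := hxm k
      simp only [hb']
      fun_prop
    have hb2 : ∀ k ω, b k ω ^ 2 =
        ‖smoothedGradient f (κ * η) (x k ω)‖ ^ 2 / (‖x k ω‖ ^ (2 * m) + 1) := fun k ω => by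
      simp only [hb', hm]
      rw [div_pow, Real.sq_sqrt (by positivity)]
      norm_num
    have hX : ∀ k ω, Metric.infDist 0 (goldsteinSubdiff f δ (x k ω)) ≤ 2 * b k ω + 2 * ε := by
      intro k ω
      have h1 : ‖smoothedGradient f (κ * η) (x k ω)‖ = √2 * b k ω := by
        simp only [hb']; field_simp
      have h2 : √2 ≤ 8 / 5 := by
        rw [Real.sqrt_le_left (by norm_num)]; norm_num
      have h4 := hdist (x k ω)
      rw [h1, hm, pow_zero] at h4
      nlinarith [mul_le_mul_of_nonneg_right h2 (hb0 k ω)]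
    have hmain : ∀ k ≤ T, ∀ A : ℝ, 0 ≤ A → ∫ ω, b k ω ^ 2 ∂P ≤ A ^ 2 →
        Integrable (fun ω => Metric.infDist 0 (goldsteinSubdiff f δ (x k ω))) P ∧
        ∫ ω, Metric.infDist 0 (goldsteinSubdiff f δ (x k ω)) ∂P ≤ 2 * A + 2 * ε := by
      intro k hk A hA hA2
      have hb2i : Integrable (fun ω => b k ω ^ 2) P := by
        simp_rw [hb2]; exact hYi k hk
      obtain ⟨i3, h3, -, -⟩ := integral_sq_affine_le (hbm k).aestronglyMeasurable hb2i hA hε0.le hA2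
      have hXm : Measurable fun ω => Metric.infDist 0 (goldsteinSubdiff f δ (x k ω)) :=
        (measurable_infDist_goldsteinSubdiff hf.locallyLipschitz hδ0.le).comp (hxm k)
      have i6 : Integrable (fun ω => 2 * b k ω + 2 * ε) P :=
        (i3.const_mul 2).add (integrable_const _)
      have i7 : Integrable (fun ω => Metric.infDist 0 (goldsteinSubdiff f δ (x k ω))) P := by
        refine i6.mono' hXm.aestronglyMeasurable (ae_of_all _ fun ω => ?_)
        rw [Real.norm_of_nonneg Metric.infDist_nonneg]
        exact hX k ω
      refine ⟨i7, (integral_mono i7 i6 (hX k)).trans ?_⟩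
      rw [integral_add (i3.const_mul 2) (integrable_const _), integral_const_mul]
      simp only [integral_const, probReal_univ, smul_eq_mul, one_mul]
      linarith
    refine ⟨fun k hk => ?_, ?_⟩
    · have h0 : 0 ≤ ∫ ω, b k ω ^ 2 ∂P := integral_nonneg fun ω => sq_nonneg _
      exact (hmain k hk (√(∫ ω, b k ω ^ 2 ∂P)) (Real.sqrt_nonneg _) (Real.sq_sqrt h0).ge).1
    · refine (Finset.inf'_le _ (Finset.mem_range.2 (by omega : k₀ < T + 1))).trans ?_
      have h1 : ∫ ω, b k₀ ω ^ 2 ∂P ≤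
          (constK f R₁ R₂ m x₀ ^ (1 / 2 : ℝ) * κ ^ (-(1 / 2) : ℝ) * ε) ^ 2 := by
        simp_rw [hb2]
        exact hk₀le.trans (div_mul_sqrt_le_rate hη0 hκ0 hK0.le hpow)
      refine (hmain k₀ hk₀ _ (by positivity) h1).2.trans (le_of_eq ?_)
      rw [← rate_eq_rpow hη, ← hε]
      ring
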